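/- Let $k$ be an algebraically closed field of characteristic $p>0$, let $X$ be a positive-dimensional projective variety over $k$ (an integral closed subscheme of some $\mathbf{P}^n_k$), let $L$ be an ample line bundle on $X$, let $x\in X$ be a closed point with ideal sheaf $\mathfrak{m}_x\subset\mathcal{O}_X$, and fix an integer $\ell\ge 0$. For an ideal sheaf $\mathfrak{a}$ and an integer $e\ge0$, let $\mathfrak{a}^{[p^e]}$ be its $e$-th Frobenius power (the ideal sheaf locally generated by the $p^e$-th powers of sections of $\mathfrak{a}$). For integers $m\ge1$ and $e\ge 0$, say that $L^m$ separates $p^e$-Frobenius $\ell$-jets at $x$ if the restriction map \[ H^0(X,L^m)\longrightarrow H^0\bigl(X,L^m\otimes\mathcal{O}_X/(\mathfrak{m}_x^{\ell+1})^{[p^e]}\bigr) \] is surjective. Let $s_F^\ell(L^m;x)$ be the largest integer $e\ge0$ for which $L^m$ separates $p^e$-Frobenius $\ell$-jets at $x$, with $s_F^\ell(L^m;x)=-\infty$ if there is no such $e$ (and $p^{-\infty}=0$), and define the $\ell$-th Frobenius--Seshadri constant \[ \varepsilon_F^\ell(L;x)=\sup_{m\ge1}\frac{p^{s_F^\ell(L^m;x)}-1}{m/(\ell+1)}.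 \] Then the following hold. (i) There are positive integers $m$ and $e$ such that $L^m$ separates $p^e$-Frobenius $\ell$-jets at $x$. (ii) We have \[ \varepsilon_F^\ell(L;x)=\sup_{m,e}\frac{p^e-1}{m/(\ell+1)}, \] where the supremum is over all positive integers $m$ and $e$ such that $L^m$ separates $p^e$-Frobenius $\ell$-jets at $x$. (iii) For every $\delta>0$ there is a positive integer $e_0$ such that for every positive integer $e$ divisible by $e_0$ there is a positive integer $m$ such that $L^m$ separates $p^e$-Frobenius $\ell$-jets at $x$ and \[ \frac{p^e-1}{m/(\ell+1)}>\varepsilon_F^\ell(L;x)-\delta; \] in particular $\varepsilon_F^\ell(L;x)$ is finite. (iv) We have \[ \varepsilon_F^\ell(L;x)=\limsup_{m\to\infty}\frac{p^{s_F^\ell(L^m;x)}-1}{m/(\ell+1)}. \] -/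

import Mathlib

open CategoryTheory AlgebraicGeometry Filter

universe u

noncomputable section

namespace FrobSeshadri

attribute [local instance] MvPolynomial.gradedAlgebra

/-! ### Projective varieties -/

/-- Projective space `ℙⁿ` over a field `k`, as `Proj` of the polynomial ring in `n + 1` variables. -/
def projSpace (k : Type u) [Field k] (n : ℕ) : Scheme.{u} :=
  Proj (MvPolynomial.homogeneousSubmodule (Fin (n + 1)) k)

/-- The structure morphism `ℙⁿ ⟶ Spec k`. -/
def projSpaceStructure (k : Type u) [Field k] (n : ℕ) :
    projSpace k n ⟶ Spec (CommRingCat.of k) :=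
  Proj.toSpecZero (MvPolynomial.homogeneousSubmodule (Fin (n + 1)) k) ≫
    Spec.map (CommRingCat.ofHom
      (algebraMap k (MvPolynomial.homogeneousSubmodule (Fin (n + 1)) k 0)))

/-- A `k`-scheme `f : X ⟶ Spec k` is a projective variety if it is integral (reduced and
irreducible) and admits a closed immersion over `k` into some projective space. -/
structure IsProjectiveVariety (k : Type u) [Field k] {X : Scheme.{u}}
    (f : X ⟶ Spec (CommRingCat.of k)) : Prop where
  isIntegral : IsIntegral X
  exists_embedding : ∃ (n : ℕ) (i : X ⟶ projSpace k n),
    IsClosedImmersion i ∧ i ≫ projSpaceStructure k n = f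

/-! ### Tensor products, line bundles, ampleness -/

section Modules

variable {X : Scheme.{u}}

/-- The structure sheaf as a module over itself. -/
def structureModule (X : Scheme.{u}) : X.Modules :=
  SheafOfModules.unit X.ringCatSheaf

/-- The presheaf `U ↦ M(U) ⊗ N(U)`, the tensor product being over `𝒪(U)`. -/
def presheafTensor (M N : X.Modules) : X.PresheafOfModules :=
  PresheafOfModules.Monoidal.tensorObj (R := X.presheaf) M.val N.val

/-- The tensor product of two `𝒪_X`-modules: the sheaf associated with `U ↦ M(U) ⊗ N(U)`. -/
def tensor (M N : X.Modules) : X.Modules :=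
  (PresheafOfModules.sheafification (𝟙 X.ringCatSheaf.obj)).obj (presheafTensor M N)

/-- The canonical map from the presheaf tensor product to the sheaf tensor product. -/
def toTensor (M N : X.Modules) : presheafTensor M N ⟶
    (PresheafOfModules.restrictScalars (𝟙 X.ringCatSheaf.obj)).obj (tensor M N).val :=
  (PresheafOfModules.sheafificationAdjunction (𝟙 X.ringCatSheaf.obj)).unit.app (presheafTensor M N)

/-- The section `s ⊗ t` of `M ⊗ N` over `U`. -/
def tmul (M N : X.Modules) (U : X.Opens) (s : Γ(M, U)) (t : Γ(N, U)) : Γ(tensor M N, U) :=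
  ((toTensor M N).app (Opposite.op U)).hom
    (TensorProduct.tmul Γ(X, U) (M := Γ(M, U)) (N := Γ(N, U)) s t)

/-- Tensor powers, `L⁰ = 𝒪_X` and `L^(m+1) = L^m ⊗ L`. -/
def tensorPow (L : X.Modules) : ℕ → X.Modules
  | 0 => structureModule X
  | m + 1 => tensor (tensorPow L m) L

/-- A line bundle: an `𝒪_X`-module that is locally isomorphic to `𝒪_X`. -/
def IsLineBundle (L : X.Modules) : Prop :=
  ∀ x : X, ∃ U : X.Opens, x ∈ U ∧ Nonempty (L.restrict U.ι ≅ structureModule (U : Scheme.{u}))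

/-- The stalk of an `𝒪_X`-module is a module over the local ring. -/
instance stalkModule (M : X.Modules) (x : X) :
    Module (X.presheaf.stalk x) (M.presheaf.stalk x) :=
  PresheafOfModules.instModuleCarrierStalkCommRingCatCarrierAbPresheafOpensCarrier
    (R := X.presheaf) M.val x

/-- The locus `X_s` where a global section `s` of `M` does not vanish,
that is, `s_x ∉ 𝔪_x M_x`. -/
def nonvanishingLocus (M : X.Modules) (s : Γ(M, ⊤)) : Set X :=
  {x | M.presheaf.germ ⊤ x trivial s ∉
    (IsLocalRing.maximalIdeal (X.presheaf.stalk x) •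
      (⊤ : Submodule (X.presheaf.stalk x) (M.presheaf.stalk x)))}

/-- A line bundle `L` on a scheme `X` is ample if `X` is quasi-compact and every point of `X` lies
in an affine open of the form `X_s` with `s ∈ H⁰(X, L^n)` and `n ≥ 1`. -/
structure IsAmple (L : X.Modules) : Prop where
  isLineBundle : IsLineBundle L
  compactSpace : CompactSpace X
  exists_affine : ∀ x : X, ∃ n : ℕ, 1 ≤ n ∧ ∃ s : Γ(tensorPow L n, ⊤), ∃ U : X.Opens,
    IsAffineOpen U ∧ (U : Set X) = nonvanishingLocus (tensorPow L n) s ∧ x ∈ U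

end Modules

/-! ### Frobenius powers of ideal sheaves -/

section Ideals

/-- The ideal `𝔞^[q]` generated by the `q`-th powers of the elements of `𝔞`. -/
def idealFrobPow {R : Type*} [CommRing R] (a : Ideal R) (q : ℕ) : Ideal R :=
  Ideal.span ((fun r => r ^ q) '' (a : Set R))

theorem map_idealFrobPow_le {R S : Type*} [CommRing R] [CommRing S] (φ : R →+* S)
    (a : Ideal R) (q : ℕ) : (idealFrobPow a q).map φ ≤ idealFrobPow (a.map φ) q := by
  rw [idealFrobPow, Ideal.map_span, Ideal.span_le]
  rintro _ ⟨_, ⟨r, hr, rfl⟩, rfl⟩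
  simp only [map_pow]
  exact Ideal.subset_span ⟨φ r, Ideal.mem_map_of_mem φ hr, rfl⟩

theorem map_idealFrobPow_of_isLocalization {R S : Type*} [CommRing R] [CommRing S] [Algebra R S]
    (f : R) [IsLocalization.Away f S] (a : Ideal R) (q : ℕ) :
    (idealFrobPow a q).map (algebraMap R S) = idealFrobPow (a.map (algebraMap R S)) q := by
  refine le_antisymm (map_idealFrobPow_le _ a q) ?_
  rw [idealFrobPow, Ideal.span_le]
  rintro _ ⟨b, hb, rfl⟩
  obtain ⟨⟨r, t⟩, h⟩ := (IsLocalization.mem_map_algebraMap_iff (Submonoid.powers f) S).mp hb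
  have ht : IsUnit (algebraMap R S t ^ q) := (IsLocalization.map_units S t).pow q
  have h2 : b ^ q * algebraMap R S t ^ q ∈ (idealFrobPow a q).map (algebraMap R S) := by
    rw [← mul_pow, h, ← map_pow]
    exact Ideal.mem_map_of_mem _ (Ideal.subset_span ⟨r, r.2, rfl⟩)
  exact (Ideal.mul_unit_mem_iff_mem _ ht).mp h2

variable {X : Scheme.{u}}

/-- The Frobenius power `𝔞^[q]` of an ideal sheaf: on every affine open it is generated by the
`q`-th powers of the sections of `𝔞`. If `X` has characteristic `p` and `q = p ^ e`, this is the
inverse image ideal of `𝔞` under the `e`-th iterate of the absolute Frobenius morphism. -/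
def frobPow (I : X.IdealSheafData) (q : ℕ) : X.IdealSheafData where
  ideal U := idealFrobPow (I.ideal U) q
  map_ideal_basicOpen U f := by
    let _ : Algebra Γ(X, U) Γ(X, X.basicOpen f) :=
      (X.presheaf.map (homOfLE <| X.basicOpen_le f).op).hom.toAlgebra
    have : IsLocalization.Away f Γ(X, X.basicOpen f) := U.2.isLocalization_basicOpen f
    rw [← I.map_ideal_basicOpen U f]
    exact map_idealFrobPow_of_isLocalization (S := Γ(X, X.basicOpen f)) f (I.ideal U) q

/-- The ideal sheaf `𝔪_x` of a closed point `x`. -/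
def pointIdeal (x : X) (hx : IsClosed ({x} : Set X)) : X.IdealSheafData :=
  Scheme.IdealSheafData.vanishingIdeal ⟨{x}, hx⟩

/-- The `𝒪_X`-module `𝒪_X / I`, as the direct image of the structure sheaf of the closed subscheme
that `I` defines. -/
def quotientModule (I : X.IdealSheafData) : X.Modules :=
  (Scheme.Modules.pushforward I.subschemeι).obj (structureModule I.subscheme)

/-- The section `1` of `𝒪_X / I` over `U`. -/
def quotientOne (I : X.IdealSheafData) (U : X.Opens) : Γ(quotientModule I, U) :=
  (1 : Γ(I.subscheme, I.subschemeι ⁻¹ᵁ U))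

/-- The restriction map `H⁰(X, M) ⟶ H⁰(X, M ⊗ 𝒪_X / I)`, `s ↦ s ⊗ 1`. -/
def restrictionMap (M : X.Modules) (I : X.IdealSheafData) :
    Γ(M, ⊤) → Γ(tensor M (quotientModule I), ⊤) :=
  fun s => tmul M (quotientModule I) ⊤ s (quotientOne I ⊤)

end Ideals

/-! ### Separation of Frobenius jets and Frobenius–Seshadri constants -/

section Constants

variable {X : Scheme.{u}}

/-- `M` separates `p^e`-Frobenius `ℓ`-jets at the closed point `x`: the restriction map
`H⁰(X, M) ⟶ H⁰(X, M ⊗ 𝒪_X / (𝔪_x^(ℓ+1))^[p^e])` is surjective. -/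
def SeparatesFrobJets (p : ℕ) (M : X.Modules) (x : X) (hx : IsClosed ({x} : Set X))
    (ℓ e : ℕ) : Prop :=
  Function.Surjective (restrictionMap M (frobPow (pointIdeal x hx ^ (ℓ + 1)) (p ^ e)))

/-- `s_F^ℓ(M; x)`: the largest `e ≥ 0` such that `M` separates `p^e`-Frobenius `ℓ`-jets at `x`;
it is `⊥ = -∞` if there is no such `e` (and `⊤` if such `e` are unbounded). -/
def sF (p : ℕ) (M : X.Modules) (x : X) (hx : IsClosed ({x} : Set X)) (ℓ : ℕ) : WithBot ℕ∞ :=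
  ⨆ (e : ℕ) (_ : SeparatesFrobJets p M x hx ℓ e), ((e : ℕ∞) : WithBot ℕ∞)

/-- The power `p ^ s` for `s ∈ {-∞, 0, 1, 2, …, +∞}`, with `p ^ (-∞) = 0` and
`p ^ (+∞) = +∞`. -/
def extPow (p : ℕ) : WithBot ℕ∞ → EReal :=
  WithBot.recBotCoe 0 (ENat.recTopCoe ⊤ (fun e : ℕ => (((p : ℝ) ^ e : ℝ) : EReal)))

/-- The quotient `(p^(s_F^ℓ(L^m; x)) - 1) / (m / (ℓ + 1))`. -/
def frobQuotient (p : ℕ) (L : X.Modules) (x : X) (hx : IsClosed ({x} : Set X)) (ℓ m : ℕ) : EReal :=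
  (extPow p (sF p (tensorPow L m) x hx ℓ) - 1) / (((m : ℝ) / ((ℓ : ℝ) + 1) : ℝ) : EReal)

/-- The `ℓ`-th Frobenius–Seshadri constant `ε_F^ℓ(L; x)`, the supremum of the quotients
`(p^(s_F^ℓ(L^m; x)) - 1) / (m / (ℓ + 1))` over `m ≥ 1`. -/
def frobSeshadri (p : ℕ) (L : X.Modules) (x : X) (hx : IsClosed ({x} : Set X)) (ℓ : ℕ) : EReal :=
  ⨆ (m : ℕ) (_ : 1 ≤ m), frobQuotient p L x hx ℓ m

end Constants

end FrobSeshadri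

end

/-! ### Sections of modules, gluing, and the sheafified tensor product -/

noncomputable section
namespace FrobSeshadri

variable {X : Scheme.{u}}

/-! Let O be the local ring at x, 𝔪 its maximal ideal, J = 𝔪^(ℓ+1) and q = p^e. A generator of L
near x turns the global sections of L^m into an additive subgroup R_m of O, with R_a R_b ⊆ R_{a+b}.
Since the quotient by J^[q] is supported at x, L^m separates p^e-Frobenius ℓ-jets exactly when R_m
surjects onto O/J^[q] (`Triv.separates_iff`). What remains is a statement about the family R, and it
rests on three facts.

Amplification (`SurjMod.frob`, `SurjMod.frob_iterate`): if R_a surjects onto O/J^[q] and R_b onto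
O/J^[q'], then R_{a+bq} surjects onto O/J^[qq']. One filters by the expansions of the ideals J^n
under the e-th Frobenius and multiplies sections by q-th powers of sections. Iterating with a = b =
m, one passes from (m, e) to (m(1 + q + ... + q^r), e(r+1)), and by the geometric sum the quotient
(q - 1)/m does not change (`jetQuotient_geom`). Hence a nearly optimal pair (m, e₀) propagates to
every multiple of e₀ and to arbitrarily large m, which gives (iii) and (iv).

Existence (`Triv.exists_surjMod`): ampleness makes some R_m surject onto O/𝔪^N for any given N, and
J^[q] contains a power of 𝔪. This is (i).

Boundedness (`Triv.exists_linear_bound`): if R_m surjects onto O/J^[q], some nonzero section of L^m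
vanishes at x to order at least q - 1, so it suffices to bound orders of vanishing linearly in m. In
a projective embedding such a section, multiplied by the m-th power of a fixed form, behaves like a
form of degree proportional to m (`exists_vanishing_bound`). A nonzero polynomial of degree n in
fixed elements of an affine domain has order O(n) at a point (`exists_order_bound`): by
Cayley–Hamilton it divides a polynomial of degree O(n) on a Noether normalization, whose order is
bounded by restriction to a line (`order_le_of_finite`). So s_F is never +∞ and the constant is
finite; (ii) then compares the maximal e for each m with all e. -/

/-- Restriction of sections of a module. -/
def res (M : X.Modules) {U V : X.Opens} (h : V ≤ U) : Γ(M, U) →+ Γ(M, V) :=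
  (M.presheaf.map (homOfLE h).op).hom

/-- Restriction of functions. -/
def resO {U V : X.Opens} (h : V ≤ U) : Γ(X, U) →+* Γ(X, V) :=
  (X.presheaf.map (homOfLE h).op).hom

theorem res_smul (M : X.Modules) {U V : X.Opens} (h : V ≤ U) (a : Γ(X, U)) (s : Γ(M, U)) :
    res M h (a • s) = resO h a • res M h s :=
  Scheme.Modules.map_smul M (homOfLE h) a s

theorem res_res (M : X.Modules) {U V W : X.Opens} (h : V ≤ U) (h' : W ≤ V) (s : Γ(M, U)) :
    res M h' (res M h s) = res M (h'.trans h) s := by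
  have := M.presheaf.map_comp (homOfLE h).op (homOfLE h').op
  exact (congr($(this) s)).symm

theorem resO_resO {U V W : X.Opens} (h : V ≤ U) (h' : W ≤ V) (s : Γ(X, U)) :
    resO h' (resO h s) = resO (h'.trans h) s := by
  have := X.presheaf.map_comp (homOfLE h).op (homOfLE h').op
  exact (congr($(this) s)).symm

theorem res_self (M : X.Modules) {U : X.Opens} (h : U ≤ U) (s : Γ(M, U)) : res M h s = s := by
  have := M.presheaf.map_id (Opposite.op U)
  exact (congr($(this) s))

theorem eq_of_locally_res_eq (M : X.Modules) {U : X.Opens} (s t : Γ(M, U))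
    (h : ∀ y ∈ U, ∃ V : X.Opens, ∃ hV : V ≤ U, y ∈ V ∧ res M hV s = res M hV t) : s = t := by
  choose! V hV hy hs using h
  let F : TopCat.Sheaf Ab X := ⟨M.presheaf, M.isSheaf⟩
  refine TopCat.Sheaf.eq_of_locally_eq' F (fun y : U => V y) U
    (fun y => homOfLE (hV y y.2)) ?_ s t ?_
  · intro y hyU
    exact TopologicalSpace.Opens.mem_iSup.mpr ⟨⟨y, hyU⟩, hy y hyU⟩
  · intro y
    exact hs y y.2

theorem exists_gluing (M : X.Modules) {ι : Type u} (V : ι → X.Opens) {U : X.Opens}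
    (hV : ∀ i, V i ≤ U) (hU : U ≤ ⨆ i, V i) (s : ∀ i, Γ(M, V i))
    (h : ∀ i j, res M (inf_le_left : V i ⊓ V j ≤ V i) (s i) =
      res M (inf_le_right : V i ⊓ V j ≤ V j) (s j)) :
    ∃ σ : Γ(M, U), ∀ i, res M (hV i) σ = s i := by
  let F : TopCat.Sheaf Ab X := ⟨M.presheaf, M.isSheaf⟩
  obtain ⟨σ, hσ, -⟩ := TopCat.Sheaf.existsUnique_gluing' F V U
    (fun i => homOfLE (hV i)) hU s (fun i j => h i j)
  exact ⟨σ, hσ⟩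

theorem resO_eq_of_locally {U : X.Opens} (s t : Γ(X, U))
    (h : ∀ y ∈ U, ∃ V : X.Opens, ∃ hV : V ≤ U, y ∈ V ∧ resO hV s = resO hV t) : s = t := by
  choose! V hV hy hs using h
  refine TopCat.Sheaf.eq_of_locally_eq' X.sheaf (fun y : U => V y) U
    (fun y => homOfLE (hV y y.2)) ?_ s t ?_
  · intro y hyU
    exact TopologicalSpace.Opens.mem_iSup.mpr ⟨⟨y, hyU⟩, hy y hyU⟩
  · intro y
    exact hs y y.2

theorem exists_gluingO {ι : Type u} (V : ι → X.Opens) {U : X.Opens}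
    (hV : ∀ i, V i ≤ U) (hU : U ≤ ⨆ i, V i) (s : ∀ i, Γ(X, V i))
    (h : ∀ i j, resO (inf_le_left : V i ⊓ V j ≤ V i) (s i) =
      resO (inf_le_right : V i ⊓ V j ≤ V j) (s j)) :
    ∃ σ : Γ(X, U), ∀ i, resO (hV i) σ = s i := by
  obtain ⟨σ, hσ, -⟩ := TopCat.Sheaf.existsUnique_gluing' X.sheaf V U
    (fun i => homOfLE (hV i)) hU s (fun i j => h i j)
  exact ⟨σ, hσ⟩

/-! ### Sections of the tensor product -/
variable (M N : X.Modules)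

/-- sections of the presheaf tensor -/
abbrev PT (U : X.Opens) : Type u := TensorProduct Γ(X, U) Γ(M, U) Γ(N, U)

def toT (U : X.Opens) : PT M N U →ₗ[Γ(X, U)] Γ(tensor M N, U) :=
  ((toTensor M N).app (Opposite.op U)).hom

theorem tmul_eq (U : X.Opens) (s : Γ(M, U)) (t : Γ(N, U)) :
    tmul M N U s t = toT M N U (s ⊗ₜ t) := rfl

def resPT {U V : X.Opens} (h : V ≤ U) : PT M N U →+ PT M N V :=
  ((presheafTensor M N).presheaf.map (homOfLE h).op).hom

theorem resPT_tmul {U V : X.Opens} (h : V ≤ U) (s : Γ(M, U)) (t : Γ(N, U)) :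
    resPT M N h (s ⊗ₜ t) = res M h s ⊗ₜ res N h t := rfl

theorem res_toT {U V : X.Opens} (h : V ≤ U) (z : PT M N U) :
    res (tensor M N) h (toT M N U z) = toT M N V (resPT M N h z) := by
  have := ((PresheafOfModules.toPresheaf _).map (toTensor M N)).naturality (homOfLE h).op
  exact (congr($(this) z)).symm

/-- Local surjectivity of the map to the sheafification; the next lemma is its local injectivity.
Through these two, questions about `tensor` become questions about ordinary tensor products over a
small open. -/
theorem exists_toT_eq {U : X.Opens} (σ : Γ(tensor M N, U)) {y : X} (hy : y ∈ U) :
    ∃ V : X.Opens, ∃ h : V ≤ U, y ∈ V ∧ ∃ z : PT M N V, toT M N V z = res _ h σ := by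
  have : Presheaf.IsLocallySurjective (Opens.grothendieckTopology X)
    (CategoryTheory.toSheafify (Opens.grothendieckTopology X) (presheafTensor M N).presheaf) :=
      inferInstance
  obtain ⟨V, i, ⟨z, hz⟩, hV⟩ := (this.imageSieve_mem (U := U) σ) y hy
  exact ⟨V, i.le, hV, z, hz⟩

theorem exists_resPT_eq_zero {U : X.Opens} (z : PT M N U) (hz : toT M N U z = 0) {y : X}
    (hy : y ∈ U) : ∃ V : X.Opens, ∃ h : V ≤ U, y ∈ V ∧ resPT M N h z = 0 := by
  have : Presheaf.IsLocallyInjective (Opens.grothendieckTopology X)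
    (CategoryTheory.toSheafify (Opens.grothendieckTopology X) (presheafTensor M N).presheaf) :=
      inferInstance
  obtain ⟨V, i, hi, hV⟩ := (this.equalizerSieve_mem (X := Opposite.op U) z 0
    (by rw [map_zero]; exact hz)) y hy
  refine ⟨V, i.le, hV, ?_⟩
  exact hi.trans (map_zero (resPT M N i.le))

end FrobSeshadri

end

/-! ### Local generators of line bundles and of their tensor powers -/

noncomputable section
namespace FrobSeshadri

variable {X : Scheme.{u}} (M N : X.Modules)

theorem tmul_smul_smul {U : X.Opens} (a b : Γ(X, U)) (s : Γ(M, U)) (t : Γ(N, U)) :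
    tmul M N U (a • s) (b • t) = (a * b) • tmul M N U s t := by
  rw [tmul_eq, tmul_eq, TensorProduct.smul_tmul_smul, map_smul]

theorem tmul_smul_right {U : X.Opens} (a : Γ(X, U)) (s : Γ(M, U)) (t : Γ(N, U)) :
    tmul M N U s (a • t) = a • tmul M N U s t := by
  simpa using tmul_smul_smul M N 1 a s t

theorem tmul_smul_left {U : X.Opens} (a : Γ(X, U)) (s : Γ(M, U)) (t : Γ(N, U)) :
    tmul M N U (a • s) t = a • tmul M N U s t := by
  simpa using tmul_smul_smul M N a 1 s t

theorem res_tmul {U V : X.Opens} (h : V ≤ U) (s : Γ(M, U)) (t : Γ(N, U)) :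
    res (tensor M N) h (tmul M N U s t) = tmul M N V (res M h s) (res N h t) := by
  rw [tmul_eq, res_toT, resPT_tmul, tmul_eq]

variable {M N}

/-- `t` freely generates `M` over `U`. -/
def IsGen (M : X.Modules) (U : X.Opens) (t : Γ(M, U)) : Prop :=
  ∀ (V : X.Opens) (h : V ≤ U), Function.Bijective (fun a : Γ(X, V) => a • res M h t)

theorem IsGen.mono {U V : X.Opens} {t : Γ(M, U)} (ht : IsGen M U t) (h : V ≤ U) :
    IsGen M V (res M h t) := by
  intro W hW
  rw [res_res]
  exact ht W _

theorem IsGen.eq_of_smul_eq {U : X.Opens} {t : Γ(M, U)} (ht : IsGen M U t) {a b : Γ(X, U)}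
    (h : a • t = b • t) : a = b := by
  have := (ht U le_rfl).1
  rw [res_self] at this
  exact this h

theorem IsGen.exists_smul_eq {U : X.Opens} {t : Γ(M, U)} (ht : IsGen M U t) (s : Γ(M, U)) :
    ∃ a : Γ(X, U), a • t = s := by
  have := (ht U le_rfl).2 s
  rwa [res_self] at this

/-- Linear form on `M(U) ⊗ N(U)` -/
theorem IsGen.exists_tensor_form {U : X.Opens} {s : Γ(M, U)} {t : Γ(N, U)} (hs : IsGen M U s)
    (ht : IsGen N U t) : ∃ φ : PT M N U →ₗ[Γ(X, U)] Γ(X, U), φ (s ⊗ₜ t) = 1 ∧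
      ∀ z, z = φ z • (s ⊗ₜ[Γ(X, U)] t : PT M N U) := by
  have hs' := hs U le_rfl
  have ht' := ht U le_rfl
  rw [res_self] at hs' ht'
  let es : Γ(X, U) ≃ₗ[Γ(X, U)] Γ(M, U) :=
    LinearEquiv.ofBijective (LinearMap.toSpanSingleton _ _ s) hs'
  let et : Γ(X, U) ≃ₗ[Γ(X, U)] Γ(N, U) :=
    LinearEquiv.ofBijective (LinearMap.toSpanSingleton _ _ t) ht'
  let e : Γ(X, U) ≃ₗ[Γ(X, U)] PT M N U := (TensorProduct.lid _ _).symm ≪≫ₗ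
    TensorProduct.congr es et
  have he : e 1 = s ⊗ₜ t := by
    simp only [e, LinearEquiv.trans_apply, TensorProduct.lid_symm_apply,
      TensorProduct.congr_tmul]
    congr 1
    · exact one_smul _ s
    · exact one_smul _ t
  refine ⟨e.symm, by rw [← he]; exact e.symm_apply_apply 1, fun z => ?_⟩
  rw [← he, LinearEquiv.coe_coe, ← map_smul, smul_eq_mul, mul_one, e.apply_symm_apply]

/-- The presheaf tensor product is free on s ⊗ t over every smaller open. Sheafification is locally
bijective, so coefficients exist locally and are unique (`key`), hence they glue. -/
theorem isGen_tmul {U : X.Opens} {s : Γ(M, U)} {t : Γ(N, U)} (hs : IsGen M U s)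
    (ht : IsGen N U t) : IsGen (tensor M N) U (tmul M N U s t) := by
  have key : ∀ (V : X.Opens) (h : V ≤ U) (a : Γ(X, V)),
      a • tmul M N V (res M h s) (res N h t) = 0 → a = 0 := by
    intro V h a ha
    rw [← tmul_smul_left, tmul_eq] at ha
    refine resO_eq_of_locally _ _ fun y hy => ?_
    obtain ⟨W, hW, hyW, hz⟩ := exists_resPT_eq_zero M N _ ha hy
    refine ⟨W, hW, hyW, ?_⟩
    rw [resPT_tmul, res_smul, res_res, res_res] at hz
    obtain ⟨φ, hφ, -⟩ := (hs.mono (hW.trans h)).exists_tensor_form (ht.mono (hW.trans h))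
    have := congrArg φ hz
    rw [map_zero] at this ⊢
    refine Eq.trans ?_ this
    have h4 := φ.map_smul (resO hW a) (res M (hW.trans h) s ⊗ₜ[Γ(X, W)] res N (hW.trans h) t)
    rw [hφ, smul_eq_mul, mul_one] at h4
    exact h4.symm
  intro V h
  rw [res_tmul]
  constructor
  · intro a b hab
    rw [← sub_eq_zero]
    refine key V h _ ?_
    rw [sub_smul, sub_eq_zero]
    exact hab
  · intro σ
    have loc : ∀ y : V, ∃ W : X.Opens, ∃ hW : W ≤ V, (y : X) ∈ W ∧ ∃ a : Γ(X, W),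
        a • tmul M N W (res M (hW.trans h) s) (res N (hW.trans h) t)
          = res _ hW σ := by
      intro y
      obtain ⟨W, hW, hyW, z, hz⟩ := exists_toT_eq M N σ y.2
      obtain ⟨φ, -, hφ⟩ := (hs.mono (hW.trans h)).exists_tensor_form (ht.mono (hW.trans h))
      refine ⟨W, hW, hyW, φ z, ?_⟩
      rw [tmul_eq, ← map_smul, ← hφ z, hz]
    choose W hW hyW a ha using loc
    have hcov : V ≤ ⨆ i, W i := fun y hy =>
      TopologicalSpace.Opens.mem_iSup.mpr ⟨⟨y, hy⟩, hyW ⟨y, hy⟩⟩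
    obtain ⟨b, hb⟩ := exists_gluingO W hW hcov a (by
      intro i j
      rw [← sub_eq_zero]
      refine key _ ((inf_le_left.trans (hW i)).trans h) _ ?_
      rw [sub_smul, sub_eq_zero]
      have h1 := congrArg (res _ (inf_le_left : W i ⊓ W j ≤ W i)) (ha i)
      have h2 := congrArg (res _ (inf_le_right : W i ⊓ W j ≤ W j)) (ha j)
      simp only [res_smul, res_tmul, res_res] at h1 h2
      exact h1.trans h2.symm)
    refine ⟨b, ?_⟩
    refine eq_of_locally_res_eq _ _ _ fun y hy => ⟨W ⟨y, hy⟩, hW _, hyW _, ?_⟩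
    rw [← ha]
    simp only [res_smul, res_tmul, res_res]
    rw [hb]

theorem isGen_one (U : X.Opens) : IsGen (structureModule X) U (1 : Γ(X, U)) := by
  intro V h
  have : res (structureModule X) h (1 : Γ(X, U)) = (1 : Γ(X, V)) := map_one (resO h)
  have h2 : (fun a : Γ(X, V) => a • res (structureModule X) h (1 : Γ(X, U))) =
      (id : Γ(X, V) → Γ(X, V)) := by
    funext a
    rw [this]
    exact mul_one a
  rw [h2]
  exact Function.bijective_id

/-- The generator is the image of 1 under a local trivialization; the work lies in matching opens of
the subscheme U with opens of X inside U. -/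
theorem IsLineBundle.exists_isGen {L : X.Modules} (hL : IsLineBundle L) (x : X) :
    ∃ U : X.Opens, x ∈ U ∧ ∃ t, IsGen L U t := by
  obtain ⟨U, hx, ⟨e⟩⟩ := hL x
  refine ⟨U.ι ''ᵁ ⊤, by simpa using hx, e.inv.app ⊤ (1 : Γ(U, ⊤)), ?_⟩
  intro V h
  obtain ⟨W, rfl⟩ : ∃ W : (U : Scheme).Opens, U.ι ''ᵁ W = V := by
    refine ⟨U.ι ⁻¹ᵁ V, ?_⟩
    rw [Scheme.Hom.image_preimage_eq_opensRange_inf]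
    simp only [Scheme.Opens.opensRange_ι, inf_eq_right]
    simpa using h
  have h1 : res L h (e.inv.app ⊤ (1 : Γ(U, ⊤))) = e.inv.app W (1 : Γ(U, W)) := by
    have := (e.inv.mapPresheaf).naturality (homOfLE (le_top : W ≤ ⊤)).op
    have := congr($(this) (1 : Γ(U, ⊤)))
    refine Eq.trans ?_ (this.symm.trans ?_)
    · rfl
    · change e.inv.app W (res (structureModule U) le_top (1 : Γ(U, ⊤))) = _
      congr 1
      exact map_one (resO (le_top : W ≤ ⊤))
  rw [h1]
  have h2 : (fun a : Γ(X, U.ι ''ᵁ W) => a • (show Γ(L, U.ι ''ᵁ W) from e.inv.app W (1 : Γ(U, W)))) =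
      fun a => e.inv.app W ((U.ι.appIso W).hom a : Γ(U, W)) := by
    funext a
    have := e.inv.app_smul ((U.ι.appIso W).hom a) (1 : Γ(U, W))
    have h4 : (U.ι.appIso W).hom a * (1 : Γ(U, W)) = (U.ι.appIso W).hom a := mul_one _
    refine Eq.trans ?_ (this.symm.trans (congrArg (e.inv.app W) h4))
    have h3 : (U.ι.appIso W).inv ((U.ι.appIso W).hom a) = a :=
      congr($((U.ι.appIso W).hom_inv_id) a)
    conv_lhs => rw [← h3]
    rfl
  refine (congrArg Function.Bijective h2).mpr ?_
  refine Function.Bijective.comp (g := e.inv.app W) (f := (U.ι.appIso W).hom) ?_ ?_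
  · exact ConcreteCategory.bijective_of_isIso _
  · exact ConcreteCategory.bijective_of_isIso _

/-- The powers of a section of `L`. -/
def tpow {L : X.Modules} {U : X.Opens} (t : Γ(L, U)) : (m : ℕ) → Γ(tensorPow L m, U)
  | 0 => (1 : Γ(X, U))
  | m + 1 => tmul (tensorPow L m) L U (tpow t m) t

variable {L : X.Modules}

theorem isGen_tpow {U : X.Opens} {t : Γ(L, U)} (ht : IsGen L U t) (m : ℕ) :
    IsGen (tensorPow L m) U (tpow t m) := by
  induction m with
  | zero => exact isGen_one U
  | succ m ih => exact isGen_tmul ih ht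

theorem res_tpow {U V : X.Opens} (h : V ≤ U) (t : Γ(L, U)) (m : ℕ) :
    res (tensorPow L m) h (tpow t m) = tpow (res L h t) m := by
  induction m with
  | zero => exact map_one (resO h)
  | succ m ih =>
    have := res_tmul (tensorPow L m) L h (tpow t m) t
    rw [ih] at this
    exact this

theorem tpow_smul {U : X.Opens} (a : Γ(X, U)) (t : Γ(L, U)) (m : ℕ) :
    tpow (a • t) m = a ^ m • tpow t m := by
  induction m with
  | zero => rw [pow_zero, one_smul]; rfl
  | succ m ih =>
    have := tmul_smul_smul (tensorPow L m) L (a ^ m) a (tpow t m) t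
    rw [← ih, ← pow_succ] at this
    exact this

end FrobSeshadri

end

/-! ### Surjectivity of the restriction map as a condition near the point -/

noncomputable section
namespace FrobSeshadri

/-- The annihilator of the generator n lies in I, so N maps to R/I with n ↦ 1. Tensoring with M
sends m ⊗ n to the class of m in M/IM. -/
theorem mem_smul_top_of_tmul_eq_zero {R M N : Type*} [CommRing R] [AddCommGroup M] [Module R M]
    [AddCommGroup N] [Module R N] (I : Ideal R) (n : N)
    (hn : Function.Surjective (fun a : R => a • n)) (hI : ∀ a : R, a • n = 0 → a ∈ I)
    (m : M) (h : m ⊗ₜ[R] n = 0) : m ∈ I • (⊤ : Submodule R M) := by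
  let f : R →ₗ[R] N := LinearMap.toSpanSingleton R N n
  have hker : LinearMap.ker f ≤ I := fun a ha => hI a ha
  let e : (R ⧸ LinearMap.ker f) ≃ₗ[R] N := f.quotKerEquivOfSurjective hn
  let g : N →ₗ[R] R ⧸ I := (Submodule.factor hker) ∘ₗ e.symm.toLinearMap
  have hg : g n = Ideal.Quotient.mk I 1 := by
    have : e.symm n = Submodule.Quotient.mk 1 := by
      rw [LinearEquiv.symm_apply_eq]
      exact (one_smul R n).symm
    simp only [g, LinearMap.comp_apply, LinearEquiv.coe_coe, this]
    rfl
  have h2 := congrArg (TensorProduct.tensorQuotEquivQuotSMul M I) (congrArg (g.lTensor M) h)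
  rw [LinearMap.lTensor_tmul, hg, map_zero, map_zero,
    TensorProduct.tensorQuotEquivQuotSMul_tmul_mk, one_smul] at h2
  exact (Submodule.Quotient.mk_eq_zero _).mp h2

variable {X : Scheme.{u}}

theorem quotientModule_smul_one (I : X.IdealSheafData) (U : X.Opens) (a : Γ(X, U)) :
    a • quotientOne I U = (show Γ(quotientModule I, U) from I.subschemeι.app U a) :=
  mul_one (I.subschemeι.app U a)

theorem res_quotientOne (I : X.IdealSheafData) {U V : X.Opens} (h : V ≤ U) :
    res (quotientModule I) h (quotientOne I U) = quotientOne I V :=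
  map_one (resO (X := I.subscheme) ((TopologicalSpace.Opens.map I.subschemeι.base).map
    (homOfLE h)).le)

theorem quotientOne_surjective (I : X.IdealSheafData) (U : X.affineOpens) :
    Function.Surjective (fun a : Γ(X, U) => a • quotientOne I U) := by
  simp only [quotientModule_smul_one]
  exact I.subschemeι_app_surjective U

theorem smul_quotientOne_eq_zero (I : X.IdealSheafData) (U : X.affineOpens) (a : Γ(X, U)) :
    a • quotientOne I U = 0 ↔ a ∈ I.ideal U := by
  rw [quotientModule_smul_one, ← I.ker_subschemeι_app U]
  rfl

theorem subsingleton_quotientModule (I : X.IdealSheafData) (U : X.Opens)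
    (hU : ∀ y ∈ U, y ∉ I.support) (n : Γ(quotientModule I, U)) : n = 0 := by
  have : I.subschemeι ⁻¹ᵁ U = ⊥ := by
    ext y
    simp only [TopologicalSpace.Opens.coe_bot, Set.mem_empty_iff_false, iff_false]
    intro hy
    refine hU _ hy ?_
    rw [← SetLike.mem_coe, ← I.range_subschemeι]
    exact ⟨y, rfl⟩
  have h2 : Subsingleton Γ(I.subscheme, I.subschemeι ⁻¹ᵁ U) := by
    rw [this]; infer_instance
  exact h2.elim _ _

/-- Away from x the factor 𝒪/I is zero, hence so is the tensor product; two sections can differ only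
near x. -/
theorem tensor_quotient_eq (M : X.Modules) (I : X.IdealSheafData) (x : X)
    (hI : ∀ y, y ∈ I.support → y = x) {U : X.Opens} (σ τ : Γ(tensor M (quotientModule I), U))
    (h : x ∈ U → ∃ V : X.Opens, ∃ hV : V ≤ U, x ∈ V ∧ res _ hV σ = res _ hV τ)
    (hx : IsClosed ({x} : Set X)) : σ = τ := by
  refine eq_of_locally_res_eq _ _ _ fun y hy => ?_
  by_cases hyx : y = x
  · subst hyx
    exact h hy
  have zero : ∀ σ : Γ(tensor M (quotientModule I), U), ∃ V : X.Opens, ∃ hV : V ≤ U, y ∈ V ∧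
      res _ hV σ = 0 := by
    intro σ
    let W : X.Opens := ⟨{x}ᶜ, hx.isOpen_compl⟩
    obtain ⟨V, hV, hyV, z, hz⟩ := exists_toT_eq M (quotientModule I) σ hy
    refine ⟨V ⊓ W, inf_le_left.trans hV, ⟨hyV, hyx⟩, ?_⟩
    rw [← res_res _ hV inf_le_left, ← hz, res_toT]
    generalize resPT M (quotientModule I) _ z = z'
    have : z' = 0 := by
      induction z' using TensorProduct.induction_on with
      | zero => rfl
      | tmul m n =>
        rw [subsingleton_quotientModule I _ (fun y hy hys => (show y ∈ V ⊓ W from hy).2 (hI y hys)) n,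
          TensorProduct.tmul_zero]
      | add a b ha hb => rw [ha, hb, add_zero]
    rw [this, map_zero]
  obtain ⟨V, hV, hyV, hσ⟩ := zero σ
  obtain ⟨V', hV', hyV', hτ⟩ := zero τ
  refine ⟨V ⊓ V', inf_le_left.trans hV, ⟨hyV, hyV'⟩, ?_⟩
  rw [← res_res _ hV inf_le_left, hσ, ← res_res _ hV' inf_le_right, hτ, map_zero, map_zero]

theorem exists_affine_le {U : X.Opens} {x : X} (hx : x ∈ U) :
    ∃ V : X.affineOpens, (V : X.Opens) ≤ U ∧ x ∈ (V : X.Opens) := by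
  obtain ⟨_, ⟨V, hV, rfl⟩, hxV, hVU⟩ :=
    X.isBasis_affineOpens.exists_subset_of_mem_open hx U.isOpen
  exact ⟨⟨V, hV⟩, hVU, hxV⟩

/-- Since M ⊗ 𝒪/I is concentrated at x, its global sections are its germs at x. This removes the
sheaf tensor product: surjectivity says that each local section of M near x is congruent to a global
one modulo I. -/
theorem restrictionMap_surjective_iff (M : X.Modules) (I : X.IdealSheafData) (x : X)
    (hx : IsClosed ({x} : Set X)) (hI : ∀ y, y ∈ I.support → y = x) :
    Function.Surjective (restrictionMap M I) ↔ ∀ (U : X.Opens) (_ : x ∈ U) (μ : Γ(M, U)),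
      ∃ (s : Γ(M, ⊤)) (V : X.affineOpens) (hV : (V : X.Opens) ≤ U), x ∈ (V : X.Opens) ∧
        res M le_top s - res M hV μ ∈ I.ideal V • (⊤ : Submodule Γ(X, V) Γ(M, V)) := by
  constructor
  · intro H U hxU μ
    let W : X.Opens := ⟨{x}ᶜ, hx.isOpen_compl⟩
    -- Cover X by U and the complement of x, and extend μ ⊗ 1 by zero. The overlaps agree because
    -- every section vanishes off x.
    let V : ULift.{u} Bool → X.Opens := fun b => if b.down then U else W
    let σ : ∀ b, Γ(tensor M (quotientModule I), V b) := fun b => match b with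
      | ⟨true⟩ => tmul M (quotientModule I) U μ (quotientOne I U)
      | ⟨false⟩ => (0 : Γ(tensor M (quotientModule I), W))
    obtain ⟨τ, hτ⟩ := exists_gluing (tensor M (quotientModule I)) V (U := ⊤) (fun _ => le_top)
      (fun y _ => by
        rw [TopologicalSpace.Opens.mem_iSup]
        by_cases hy : y = x
        · exact ⟨⟨true⟩, by subst hy; exact hxU⟩
        · exact ⟨⟨false⟩, hy⟩) σ (by
        rintro ⟨i⟩ ⟨j⟩
        cases i <;> cases j
        · rfl
        · exact tensor_quotient_eq M I x hI _ _ (fun h => (h.1 rfl).elim) hx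
        · exact tensor_quotient_eq M I x hI _ _ (fun h => (h.2 rfl).elim) hx
        · rfl)
    obtain ⟨s, hs⟩ := H τ
    have h1 := hτ ⟨true⟩
    rw [← hs] at h1
    have h2 : tmul M (quotientModule I) U (res M le_top s) (quotientOne I U) =
        tmul M (quotientModule I) U μ (quotientOne I U) := by
      refine Eq.trans ?_ h1
      refine Eq.symm ((res_tmul _ _ _ _ _).trans ?_)
      rw [res_quotientOne]
      rfl
    have h3 : toT M (quotientModule I) U ((res M le_top s - μ) ⊗ₜ quotientOne I U) = 0 := by
      rw [TensorProduct.sub_tmul, map_sub, sub_eq_zero]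
      exact h2
    obtain ⟨V', hV', hxV', h4⟩ := exists_resPT_eq_zero _ _ _ h3 hxU
    obtain ⟨V, hV, hxV⟩ := exists_affine_le hxV'
    refine ⟨s, V, hV.trans hV', hxV, ?_⟩
    refine mem_smul_top_of_tmul_eq_zero _ (quotientOne I V) (quotientOne_surjective I V)
      (fun a => (smul_quotientOne_eq_zero I V a).mp) _ ?_
    have h5 := congrArg (resPT _ _ hV) h4
    rw [map_zero, resPT_tmul, resPT_tmul, res_quotientOne, res_quotientOne, map_sub, map_sub,
      res_res, res_res, res_res] at h5
    exact h5
  · intro H τ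
    obtain ⟨V', hV', hxV', z, hz⟩ := exists_toT_eq M (quotientModule I) τ (y := x) trivial
    obtain ⟨V, hV, hxV⟩ := exists_affine_le hxV'
    -- Over an affine open 𝒪/I is generated by 1, so every tensor has the form μ ⊗ 1.
    have h1 : ∀ z : PT M (quotientModule I) V, ∃ μ : Γ(M, V), z = μ ⊗ₜ quotientOne I V := by
      intro z
      induction z using TensorProduct.induction_on with
      | zero => exact ⟨0, (TensorProduct.zero_tmul _ _).symm⟩
      | tmul m n =>
        obtain ⟨a, rfl⟩ := quotientOne_surjective I V n
        exact ⟨a • m, (TensorProduct.smul_tmul _ _ _).symm⟩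
      | add a b ha hb =>
        obtain ⟨m, rfl⟩ := ha
        obtain ⟨n, rfl⟩ := hb
        exact ⟨m + n, (TensorProduct.add_tmul _ _ _).symm⟩
    obtain ⟨μ, hμ⟩ := h1 (resPT _ _ hV z)
    obtain ⟨s, W, hW, hxW, hs⟩ := H V hxV μ
    refine ⟨s, tensor_quotient_eq M I x hI _ _ (fun _ => ⟨W, le_top, hxW, ?_⟩) hx⟩
    have h2 : ∀ m ∈ I.ideal W • (⊤ : Submodule Γ(X, W) Γ(M, W)),
        tmul M (quotientModule I) W m (quotientOne I W) = 0 := by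
      intro m hm
      refine Submodule.smul_induction_on hm ?_ ?_
      · intro a ha n _
        rw [tmul_smul_left, ← tmul_smul_right, (smul_quotientOne_eq_zero I W a).mpr ha, tmul_eq,
          TensorProduct.tmul_zero, map_zero]
      · intro a b ha hb
        rw [tmul_eq] at ha hb ⊢
        rw [TensorProduct.add_tmul, map_add, ha, hb, add_zero]
    have h3 := h2 _ hs
    rw [tmul_eq, TensorProduct.sub_tmul, map_sub, sub_eq_zero] at h3
    refine ((res_tmul _ _ _ _ _).trans ?_)
    rw [res_quotientOne, tmul_eq, h3]
    rw [← res_res _ hV' (hW.trans hV), ← hz, res_toT]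
    congr 1
    have h4 := congrArg (resPT _ _ hW) hμ
    rw [resPT_tmul, res_quotientOne] at h4
    rw [← h4]
    have := (presheafTensor M (quotientModule I)).presheaf.map_comp (homOfLE hV).op (homOfLE hW).op
    exact congr($(this) z).symm

end FrobSeshadri

end

/-! ### Global sections of powers of a line bundle as rational functions -/

noncomputable section
namespace FrobSeshadri

variable {X : Scheme.{u}}

theorem inf_mem {U V : X.Opens} {y : X} (hU : y ∈ U) (hV : y ∈ V) : y ∈ U ⊓ V := ⟨hU, hV⟩

variable [IsIntegral X]

theorem genericPoint_mem {U : X.Opens} {y : X} (hy : y ∈ U) : genericPoint X ∈ U :=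
  ((genericPoint_spec X).mem_open_set_iff U.isOpen).mpr ⟨y, trivial, hy⟩

/-- The map from functions on `U` to the function field. -/
def toK {U : X.Opens} (hU : genericPoint X ∈ U) : Γ(X, U) →+* X.functionField :=
  (X.presheaf.germ U (genericPoint X) hU).hom

theorem toK_resO {U V : X.Opens} (h : V ≤ U) (hU : genericPoint X ∈ U) (hV : genericPoint X ∈ V)
    (a : Γ(X, U)) : toK hV (resO h a) = toK hU a :=
  TopCat.Presheaf.germ_res_apply X.presheaf (homOfLE h) _ hV a

theorem toK_injective {U : X.Opens} (hU : genericPoint X ∈ U) : Function.Injective (toK hU) :=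
  germ_injective_of_isIntegral _ _ _

/-- Rational functions that are regular at `y`. -/
def regAt (y : X) : Subring X.functionField :=
  (algebraMap (X.presheaf.stalk y) X.functionField).range

theorem algebraMap_germ {U : X.Opens} (hU : genericPoint X ∈ U) {y : X} (hy : y ∈ U)
    (a : Γ(X, U)) : algebraMap (X.presheaf.stalk y) X.functionField (X.presheaf.germ U y hy a) =
      toK hU a := by
  have : Nonempty U := ⟨⟨y, hy⟩⟩
  exact Scheme.algebraMap_germ_eq_germToFunctionField X hy a

theorem toK_mem_regAt {U : X.Opens} (hU : genericPoint X ∈ U) {y : X} (hy : y ∈ U)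
    (a : Γ(X, U)) : toK hU a ∈ regAt y :=
  ⟨_, algebraMap_germ hU hy a⟩

theorem exists_toK_of_mem_regAt {y : X} {f : X.functionField} (hf : f ∈ regAt y) {U : X.Opens}
    (hy : y ∈ U) : ∃ (V : X.Opens) (_ : V ≤ U) (_ : y ∈ V) (hV : genericPoint X ∈ V)
      (a : Γ(X, V)), toK hV a = f := by
  obtain ⟨g, rfl⟩ := hf
  obtain ⟨V, hyV, a, ha⟩ := TopCat.Presheaf.exists_germ_eq X.presheaf g
  refine ⟨V ⊓ U, inf_le_right, ⟨hyV, hy⟩, genericPoint_mem ⟨hyV, hy⟩, resO inf_le_left a, ?_⟩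
  rw [toK_resO _ (genericPoint_mem hyV), ← algebraMap_germ _ hyV, ha]

theorem exists_toK {f : X.functionField} {U : X.Opens} (hU : genericPoint X ∈ U)
    (h : ∀ y ∈ U, f ∈ regAt y) : ∃ a : Γ(X, U), toK hU a = f := by
  have h' : ∀ y : U, f ∈ regAt (y : X) := fun y => h y y.2
  choose V hV hyV hgV a ha using fun y : U => exists_toK_of_mem_regAt (h' y) y.2
  obtain ⟨b, hb⟩ := exists_gluingO V hV (fun y hy =>
    TopologicalSpace.Opens.mem_iSup.mpr ⟨⟨y, hy⟩, hyV ⟨y, hy⟩⟩) a (by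
      intro i j
      have hg : genericPoint X ∈ V i ⊓ V j := ⟨hgV i, hgV j⟩
      apply toK_injective hg
      rw [toK_resO _ (hgV i), toK_resO _ (hgV j), ha, ha])
  refine ⟨b, ?_⟩
  rw [← toK_resO (hV ⟨_, hU⟩) hU (hgV _), hb, ha]

/-- A finite affine trivializing cover for a line bundle, with the rational transition functions
to a generator near the point `x`. -/
structure Triv (L : X.Modules) (x : X) where
  ι : Type u
  fin : Finite ι
  U : ι → X.Opens
  affine : ∀ i, IsAffineOpen (U i)
  gen : ∀ i, genericPoint X ∈ U i
  cover : ∀ y, ∃ i, y ∈ U i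
  t : ∀ i, Γ(L, U i)
  isGen : ∀ i, IsGen L (U i) (t i)
  o : ι
  mem : x ∈ U o
  w : ι → X.functionField
  w_o : w o = 1
  w_ne : ∀ i, w i ≠ 0
  trans : ∀ i j, ∃ c : Γ(X, U i ⊓ U j), c • res L inf_le_right (t j) = res L inf_le_left (t i) ∧
    w i * toK (inf_mem (gen i) (gen j)) c = w j

/-- The functions w i are the transition functions c x i with t_x = w_i t_i. Thus f · t_x^m equals f
w_i^m · t_i^m on the i-th chart, which is why `sec` asks for f w_i^m to be regular there. The
relation between w i and w j is the cocycle identity `hcoc`. -/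
theorem exists_triv [CompactSpace X] {L : X.Modules} (hL : IsLineBundle L) (x : X) :
    Nonempty (Triv L x) := by
  have h1 : ∀ y : X, ∃ V : X.affineOpens, y ∈ (V : X.Opens) ∧ ∃ t, IsGen L V t := by
    intro y
    obtain ⟨U, hy, t, ht⟩ := hL.exists_isGen y
    obtain ⟨V, hV, hyV⟩ := exists_affine_le hy
    exact ⟨V, hyV, _, ht.mono hV⟩
  choose V hyV t ht using h1
  obtain ⟨S, hS⟩ := isCompact_univ.elim_finite_subcover (fun y : X => ((V y : X.Opens) : Set X))
    (fun y => (V y : X.Opens).isOpen) (fun y _ => Set.mem_iUnion.mpr ⟨y, hyV y⟩)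
  classical
  have hgen : ∀ y, genericPoint X ∈ (V y : X.Opens) := fun y => genericPoint_mem (hyV y)
  have hc : ∀ i j, ∃ c : Γ(X, (V i : X.Opens) ⊓ V j),
      c • res L inf_le_right (t j) = res L inf_le_left (t i) := fun i j =>
    ((ht j).mono inf_le_right).exists_smul_eq _
  choose c hc using hc
  have hcoc : ∀ i j l, toK (inf_mem (hgen i) (hgen j)) (c i j) *
      toK (inf_mem (hgen j) (hgen l)) (c j l) =
      toK (inf_mem (hgen i) (hgen l)) (c i l) := by
    intro i j l
    let W : X.Opens := (V i : X.Opens) ⊓ V j ⊓ V l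
    have hij : W ≤ (V i : X.Opens) ⊓ V j := inf_le_left
    have hjl : W ≤ (V j : X.Opens) ⊓ V l := inf_le_inf_right _ inf_le_right
    have hil : W ≤ (V i : X.Opens) ⊓ V l := inf_le_inf_right _ inf_le_left
    have hW : genericPoint X ∈ W := ⟨⟨hgen i, hgen j⟩, hgen l⟩
    rw [← toK_resO hij _ hW, ← toK_resO hjl _ hW, ← toK_resO hil _ hW, ← map_mul]
    congr 1
    refine ((ht l).mono (inf_le_right : W ≤ V l)).eq_of_smul_eq ?_
    have h1 := congrArg (res L hij) (hc i j)
    have h2 := congrArg (res L hjl) (hc j l)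
    have h3 := congrArg (res L hil) (hc i l)
    simp only [res_smul, res_res] at h1 h2 h3
    rw [mul_smul, h2, h1, h3]
  have hself : ∀ i, toK (inf_mem (hgen i) (hgen i)) (c i i) = 1 := by
    intro i
    have : c i i = 1 := by
      refine ((ht i).mono (inf_le_right : (V i : X.Opens) ⊓ V i ≤ V i)).eq_of_smul_eq ?_
      rw [hc, one_smul]
    rw [this, map_one]
  exact ⟨{
    ι := (insert x S : Finset X)
    fin := inferInstance
    U := fun i => V i
    affine := fun i => (V i).2
    gen := fun i => hgen i
    cover := fun y => by
      obtain ⟨i, hi, hy⟩ := Set.mem_iUnion₂.mp (hS (Set.mem_univ y))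
      exact ⟨⟨i, Finset.mem_insert_of_mem hi⟩, hy⟩
    t := fun i => t i
    isGen := fun i => ht i
    o := ⟨x, Finset.mem_insert_self _ _⟩
    mem := hyV x
    w := fun i => toK (inf_mem (hgen x) (hgen i)) (c x i)
    w_o := hself x
    w_ne := fun i h => by
      have := hcoc x i x
      rw [h, zero_mul, hself] at this
      exact zero_ne_one this
    trans := fun i j => ⟨c i j, hc i j, hcoc x i j⟩ }⟩

namespace Triv

variable {L : X.Modules} {x : X} (T : Triv L x)

/-- The rational functions that correspond to global sections of `L ^ m`. -/
def sec (m : ℕ) : AddSubgroup X.functionField where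
  carrier := {f | ∀ i, ∀ y ∈ T.U i, f * T.w i ^ m ∈ regAt y}
  zero_mem' i y _ := by rw [zero_mul]; exact zero_mem _
  add_mem' ha hb i y hy := by rw [add_mul]; exact add_mem (ha i y hy) (hb i y hy)
  neg_mem' ha i y hy := by rw [neg_mul]; exact neg_mem (ha i y hy)

theorem mul_mem_sec {a b : ℕ} {f g : X.functionField} (hf : f ∈ T.sec a) (hg : g ∈ T.sec b) :
    f * g ∈ T.sec (a + b) := by
  intro i y hy
  rw [pow_add, mul_mul_mul_comm]
  exact mul_mem (hf i y hy) (hg i y hy)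

theorem pow_mem_sec {a : ℕ} {f : X.functionField} (hf : f ∈ T.sec a) (j : ℕ) :
    f ^ j ∈ T.sec (a * j) := by
  intro i y hy
  rw [pow_mul, ← mul_pow]
  exact pow_mem (hf i y hy) j

/-- The rational function `f` corresponds to the section `s`. -/
def Rep (m : ℕ) (s : Γ(tensorPow L m, ⊤)) (f : X.functionField) : Prop :=
  ∀ i, ∃ F : Γ(X, T.U i), F • tpow (T.t i) m = res _ le_top s ∧ toK (T.gen i) F = f * T.w i ^ m

/-- The coefficient on the chart o, where w = 1, is the rational function; the transition functions
determine the coefficients on the other charts. -/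
theorem exists_rep_of_section (m : ℕ) (s : Γ(tensorPow L m, ⊤)) : ∃ f ∈ T.sec m, T.Rep m s f := by
  choose F hF using fun i => (isGen_tpow (T.isGen i) m).exists_smul_eq (res _ le_top s)
  have key : ∀ i, toK (T.gen i) (F i) = toK (T.gen T.o) (F T.o) * T.w i ^ m := by
    intro i
    obtain ⟨c, hc, hw⟩ := T.trans T.o i
    rw [T.w_o, one_mul] at hw
    have hW : genericPoint X ∈ T.U T.o ⊓ T.U i := ⟨T.gen _, T.gen i⟩
    rw [← hw, ← map_pow, ← toK_resO inf_le_left (T.gen T.o) hW,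
      ← toK_resO inf_le_right (T.gen i) hW, ← map_mul]
    congr 1
    refine (isGen_tpow ((T.isGen i).mono (inf_le_right : T.U T.o ⊓ T.U i ≤ _)) m).eq_of_smul_eq ?_
    rw [mul_smul, ← tpow_smul, hc, ← res_tpow, ← res_tpow, ← res_smul, ← res_smul, hF, hF,
      res_res, res_res]
  refine ⟨toK (T.gen T.o) (F T.o), fun i y hy => ?_, fun i => ⟨F i, hF i, key i⟩⟩
  rw [← key]
  exact toK_mem_regAt _ hy _

theorem exists_section_of_mem (m : ℕ) {f : X.functionField} (hf : f ∈ T.sec m) :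
    ∃ s, T.Rep m s f := by
  choose F hF using fun i => exists_toK (T.gen i) (hf i)
  obtain ⟨s, hs⟩ := exists_gluing (tensorPow L m) T.U (fun i => le_top) (U := ⊤)
    (fun y _ => TopologicalSpace.Opens.mem_iSup.mpr (T.cover y))
    (fun i => F i • tpow (T.t i) m) (by
      intro i j
      obtain ⟨c, hc, hw⟩ := T.trans i j
      have hW : genericPoint X ∈ T.U i ⊓ T.U j := ⟨T.gen i, T.gen j⟩
      rw [res_smul, res_smul, res_tpow, res_tpow, ← hc, tpow_smul, ← mul_smul]
      congr 1
      apply toK_injective hW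
      rw [map_mul, map_pow, toK_resO _ (T.gen i), toK_resO _ (T.gen j), hF, hF, ← hw, mul_pow,
        mul_assoc])
  exact ⟨s, fun i => ⟨F i, (hs i).symm, hF i⟩⟩

end Triv

end FrobSeshadri

end

/-! ### Frobenius jets in the local ring at the point -/

noncomputable section
namespace FrobSeshadri

theorem map_idealFrobPow_localization {R S : Type*} [CommRing R] [CommRing S] [Algebra R S]
    (M : Submonoid R) [IsLocalization M S] (a : Ideal R) (q : ℕ) :
    (idealFrobPow a q).map (algebraMap R S) = idealFrobPow (a.map (algebraMap R S)) q := by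
  refine le_antisymm (map_idealFrobPow_le _ a q) ?_
  rw [idealFrobPow, Ideal.span_le]
  rintro _ ⟨b, hb, rfl⟩
  obtain ⟨⟨r, t⟩, h⟩ := (IsLocalization.mem_map_algebraMap_iff M S).mp hb
  have ht : IsUnit (algebraMap R S t ^ q) := (IsLocalization.map_units S t).pow q
  have h2 : b ^ q * algebraMap R S t ^ q ∈ (idealFrobPow a q).map (algebraMap R S) := by
    rw [← mul_pow, h, ← map_pow]
    exact Ideal.mem_map_of_mem _ (Ideal.subset_span ⟨r, r.2, rfl⟩)
  exact (Ideal.mul_unit_mem_iff_mem _ ht).mp h2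

theorem IsGen.mem_of_smul_mem {X : Scheme.{u}} {M : X.Modules} {U : X.Opens} {t : Γ(M, U)}
    (ht : IsGen M U t) (I : Ideal Γ(X, U)) (a : Γ(X, U)) :
    a • t ∈ I • (⊤ : Submodule Γ(X, U) Γ(M, U)) ↔ a ∈ I := by
  constructor
  · intro h
    have : ∀ m ∈ I • (⊤ : Submodule Γ(X, U) Γ(M, U)), ∃ b ∈ I, b • t = m := by
      intro m hm
      refine Submodule.smul_induction_on hm ?_ ?_
      · intro r hr n _
        obtain ⟨c, rfl⟩ := ht.exists_smul_eq n
        exact ⟨r * c, I.mul_mem_right _ hr, mul_smul _ _ _⟩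
      · rintro _ _ ⟨b, hb, rfl⟩ ⟨c, hc, rfl⟩
        exact ⟨b + c, I.add_mem hb hc, add_smul _ _ _⟩
    obtain ⟨b, hb, hbt⟩ := this _ h
    rwa [← ht.eq_of_smul_eq hbt]
  · intro h
    exact Submodule.smul_mem_smul h trivial

variable {X : Scheme.{u}}

theorem pointIdeal_ideal (x : X) (hx : IsClosed ({x} : Set X)) (V : X.affineOpens)
    (hxV : x ∈ (V : X.Opens)) :
    (pointIdeal x hx).ideal V = (V.2.primeIdealOf ⟨x, hxV⟩).asIdeal := by
  have h : (V.2.fromSpec ⁻¹' ({x} : Set X)) = {V.2.primeIdealOf ⟨x, hxV⟩} := by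
    ext y
    refine Iff.trans (b := V.2.fromSpec y = x) Iff.rfl
      (Iff.trans (b := y = V.2.primeIdealOf ⟨x, hxV⟩) ?_ Iff.rfl)
    constructor
    · intro hy
      have hV : IsAffineOpen (V : X.Opens) := V.2
      exact hV.fromSpec.isOpenEmbedding.injective
        (hy.trans (hV.fromSpec_primeIdealOf ⟨x, hxV⟩).symm)
    · rintro rfl
      exact V.2.fromSpec_primeIdealOf ⟨x, hxV⟩
  rw [pointIdeal, Scheme.IdealSheafData.vanishingIdeal_ideal]
  change PrimeSpectrum.vanishingIdeal (V.2.fromSpec ⁻¹' ({x} : Set X)) = _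
  exact (congrArg PrimeSpectrum.vanishingIdeal h).trans
    (PrimeSpectrum.vanishingIdeal_singleton _)

theorem pointIdeal_ideal_of_notMem (x : X) (hx : IsClosed ({x} : Set X)) (V : X.affineOpens)
    (hxV : x ∉ (V : X.Opens)) : (pointIdeal x hx).ideal V = ⊤ := by
  have h : (V.2.fromSpec ⁻¹' ({x} : Set X)) = ∅ := by
    ext y
    simp only [Set.mem_preimage, Set.mem_singleton_iff, Set.mem_empty_iff_false, iff_false]
    intro hy
    apply hxV
    rw [← hy, ← SetLike.mem_coe, ← V.2.range_fromSpec]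
    exact ⟨y, rfl⟩
  rw [pointIdeal, Scheme.IdealSheafData.vanishingIdeal_ideal]
  change PrimeSpectrum.vanishingIdeal (V.2.fromSpec ⁻¹' ({x} : Set X)) = _
  exact (congrArg PrimeSpectrum.vanishingIdeal h).trans PrimeSpectrum.vanishingIdeal_empty

/-- The ideal sheaf `(𝔪_x^(ℓ+1))^[q]`. -/
abbrev jetIdeal (x : X) (hx : IsClosed ({x} : Set X)) (ℓ q : ℕ) : X.IdealSheafData :=
  frobPow (pointIdeal x hx ^ (ℓ + 1)) q

/-- Frobenius powers and ordinary powers commute with localization, and the ideal of x localizes to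
the maximal ideal. -/
theorem map_jetIdeal (x : X) (hx : IsClosed ({x} : Set X)) (ℓ q : ℕ) (V : X.affineOpens)
    (hxV : x ∈ (V : X.Opens)) :
    ((jetIdeal x hx ℓ q).ideal V).map (X.presheaf.germ V x hxV).hom =
      idealFrobPow (IsLocalRing.maximalIdeal (X.presheaf.stalk x) ^ (ℓ + 1)) q := by
  let : Algebra Γ(X, V) (X.presheaf.stalk x) := X.presheaf.algebra_section_stalk ⟨x, hxV⟩
  have hloc : IsLocalization.AtPrime (X.presheaf.stalk x) (V.2.primeIdealOf ⟨x, hxV⟩).asIdeal :=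
    V.2.isLocalization_stalk ⟨x, hxV⟩
  change (idealFrobPow (((pointIdeal x hx) ^ (ℓ + 1)).ideal V) q).map (algebraMap _ _) = _
  rw [map_idealFrobPow_localization (V.2.primeIdealOf ⟨x, hxV⟩).asIdeal.primeCompl,
    Scheme.IdealSheafData.ideal_pow, Pi.pow_apply, Ideal.map_pow, pointIdeal_ideal x hx V hxV,
    IsLocalization.AtPrime.map_eq_maximalIdeal]

theorem eq_of_mem_support_jetIdeal (x : X) (hx : IsClosed ({x} : Set X)) (ℓ q : ℕ) (y : X)
    (hy : y ∈ (jetIdeal x hx ℓ q).support) : y = x := by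
  by_contra hyx
  let W : X.Opens := ⟨{x}ᶜ, hx.isOpen_compl⟩
  obtain ⟨V, hVW, hyV⟩ := exists_affine_le (show y ∈ W from hyx)
  have hxV : x ∉ (V : X.Opens) := fun h => hVW h rfl
  rw [Scheme.IdealSheafData.mem_support_iff_of_mem hyV] at hy
  have h1 : (1 : Γ(X, V)) ∈ (jetIdeal x hx ℓ q).ideal V := by
    change (1 : Γ(X, V)) ∈ idealFrobPow (((pointIdeal x hx) ^ (ℓ + 1)).ideal V) q
    rw [Scheme.IdealSheafData.ideal_pow, Pi.pow_apply, pointIdeal_ideal_of_notMem x hx V hxV,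
      Ideal.top_pow]
    exact Ideal.subset_span ⟨1, trivial, one_pow q⟩
  rw [Scheme.mem_zeroLocus_iff] at hy
  refine hy 1 h1 ?_
  rw [Scheme.basicOpen_of_isUnit _ isUnit_one]
  exact hyV

/-- Membership of the germ means m · c ∈ I for some m not vanishing at x; on the basic open of m
this factor is a unit. -/
theorem exists_resO_mem_ideal (I : X.IdealSheafData) (V : X.affineOpens) {x : X}
    (hxV : x ∈ (V : X.Opens)) (c : Γ(X, V))
    (hc : X.presheaf.germ V x hxV c ∈ (I.ideal V).map (X.presheaf.germ V x hxV).hom) :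
    ∃ (W : X.affineOpens) (hW : (W : X.Opens) ≤ V), x ∈ (W : X.Opens) ∧ resO hW c ∈ I.ideal W := by
  let : Algebra Γ(X, V) (X.presheaf.stalk x) := X.presheaf.algebra_section_stalk ⟨x, hxV⟩
  have hloc : IsLocalization.AtPrime (X.presheaf.stalk x) (V.2.primeIdealOf ⟨x, hxV⟩).asIdeal :=
    V.2.isLocalization_stalk ⟨x, hxV⟩
  obtain ⟨m, hm, hmc⟩ := (IsLocalization.algebraMap_mem_map_algebraMap_iff
    (V.2.primeIdealOf ⟨x, hxV⟩).asIdeal.primeCompl (X.presheaf.stalk x) _ _).mp hc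
  have hxm : x ∈ X.basicOpen m := by
    rw [Scheme.mem_basicOpen _ _ _ hxV]
    exact (IsLocalization.map_units (X.presheaf.stalk x)
      (⟨m, hm⟩ : (V.2.primeIdealOf ⟨x, hxV⟩).asIdeal.primeCompl))
  refine ⟨X.affineBasicOpen m, X.basicOpen_le m, hxm, ?_⟩
  have h1 : resO (X.basicOpen_le m) (m * c) ∈ I.ideal (X.affineBasicOpen m) := by
    have := I.map_ideal (U := X.affineBasicOpen m) (V := V) (X.basicOpen_le m)
    rw [← this]
    exact Ideal.mem_map_of_mem _ hmc
  rw [map_mul] at h1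
  have hu : IsUnit (resO (X.basicOpen_le m) m) := RingedSpace.isUnit_res_basicOpen _ m
  exact (Ideal.unit_mul_mem_iff_mem _ hu).mp h1

namespace Triv

variable [IsIntegral X] {L : X.Modules} {x : X} (T : Triv L x)

/-- The germs at `x` of the sections of `L ^ m`, with respect to the chosen generator. -/
def jets (m : ℕ) : AddSubgroup (X.presheaf.stalk x) :=
  (T.sec m).comap (algebraMap (X.presheaf.stalk x) X.functionField).toAddMonoidHom

/-- The bridge from sheaves to algebra. Near x the generator t_o^m identifies sections of L^m with
functions, so the local criterion `restrictionMap_surjective_iff` can be read off in the stalk. -/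
theorem separates_iff (p : ℕ) (hx : IsClosed ({x} : Set X)) (ℓ e m : ℕ) :
    SeparatesFrobJets p (tensorPow L m) x hx ℓ e ↔ ∀ g : X.presheaf.stalk x, ∃ r ∈ T.jets m,
      r - g ∈ idealFrobPow (IsLocalRing.maximalIdeal (X.presheaf.stalk x) ^ (ℓ + 1)) (p ^ e) := by
  have hinj := IsFractionRing.injective (X.presheaf.stalk x) X.functionField
  have htp := isGen_tpow (T.isGen T.o) m
  rw [SeparatesFrobJets, restrictionMap_surjective_iff _ _ x hx
    (eq_of_mem_support_jetIdeal x hx ℓ (p ^ e))]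
  constructor
  · intro H g
    obtain ⟨V', hxV', a', ha'⟩ := TopCat.Presheaf.exists_germ_eq X.presheaf g
    let V : X.Opens := V' ⊓ T.U T.o
    have hxV : x ∈ V := ⟨hxV', T.mem⟩
    let a : Γ(X, V) := resO inf_le_left a'
    have ha : X.presheaf.germ V x hxV a = g := by
      rw [← ha']
      exact TopCat.Presheaf.germ_res_apply X.presheaf (homOfLE inf_le_left) _ hxV a'
    obtain ⟨s, W, hW, hxW, hs⟩ := H V hxV (a • res _ inf_le_right (tpow (T.t T.o) m))
    obtain ⟨f, hf, hrep⟩ := T.exists_rep_of_section m s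
    obtain ⟨F, hF, hFf⟩ := hrep T.o
    rw [T.w_o, one_pow, mul_one] at hFf
    have hr : algebraMap _ X.functionField (X.presheaf.germ _ x T.mem F) = f := by
      rw [algebraMap_germ (T.gen _), hFf]
    refine ⟨X.presheaf.germ _ x T.mem F, ?_, ?_⟩
    · change algebraMap _ X.functionField _ ∈ T.sec m
      rwa [hr]
    · have hWo : (W : X.Opens) ≤ T.U T.o := hW.trans inf_le_right
      rw [← res_res _ le_top hWo, ← hF, res_smul, res_smul, res_res, ← sub_smul,
        (htp.mono hWo).mem_of_smul_mem] at hs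
      rw [← map_jetIdeal x hx ℓ (p ^ e) W hxW]
      have := Ideal.mem_map_of_mem (X.presheaf.germ W x hxW).hom hs
      rw [map_sub] at this
      convert this using 2
      · exact (TopCat.Presheaf.germ_res_apply X.presheaf (homOfLE hWo) _ hxW F).symm
      · rw [← ha]
        exact (TopCat.Presheaf.germ_res_apply X.presheaf (homOfLE hW) _ hxW a).symm
  · intro H U hxU μ
    obtain ⟨V, hV, hxV⟩ := exists_affine_le (inf_mem hxU T.mem)
    have hVU : (V : X.Opens) ≤ U := hV.trans inf_le_left
    have hVo : (V : X.Opens) ≤ T.U T.o := hV.trans inf_le_right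
    obtain ⟨a, ha⟩ := (htp.mono hVo).exists_smul_eq (res _ hVU μ)
    obtain ⟨r, hr, hra⟩ := H (X.presheaf.germ V x hxV a)
    obtain ⟨s, hs⟩ := T.exists_section_of_mem m (f := algebraMap _ X.functionField r) hr
    obtain ⟨F, hF, hFf⟩ := hs T.o
    rw [T.w_o, one_pow, mul_one, ← algebraMap_germ (T.gen _) T.mem] at hFf
    have hFr := hinj hFf
    have h1 : X.presheaf.germ V x hxV (resO hVo F - a) ∈
        ((jetIdeal x hx ℓ (p ^ e)).ideal V).map (X.presheaf.germ V x hxV).hom := by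
      rw [map_jetIdeal, map_sub]
      convert hra using 2
      rw [← hFr]
      exact (TopCat.Presheaf.germ_res_apply X.presheaf (homOfLE hVo) _ hxV F)
    obtain ⟨W, hW, hxW, h2⟩ := exists_resO_mem_ideal _ V hxV _ h1
    refine ⟨s, W, hW.trans hVU, hxW, ?_⟩
    rw [← res_res _ hVU hW, ← ha, ← res_res _ le_top (hW.trans hVo), ← hF, res_smul, res_smul,
      res_res, ← sub_smul, (htp.mono (hW.trans hVo)).mem_of_smul_mem]
    rw [map_sub, resO_resO] at h2
    exact h2

end Triv

end FrobSeshadri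

end

/-! ### Composing separations of Frobenius jets -/

noncomputable section
namespace FrobSeshadri

section FrobeniusJets

variable {O : Type*} [CommRing O] (p : ℕ) [ExpChar O p]

theorem idealFrobPow_eq_map (J : Ideal O) (e : ℕ) :
    idealFrobPow J (p ^ e) = J.map (iterateFrobenius O p e) := rfl

theorem map_iterateFrobenius_add (J : Ideal O) (e e' : ℕ) :
    idealFrobPow J (p ^ (e + e')) = (idealFrobPow J (p ^ e')).map (iterateFrobenius O p e) := by
  rw [idealFrobPow_eq_map, idealFrobPow_eq_map, Ideal.map_map]
  congr 1
  ext x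
  exact iterateFrobenius_add_apply O p e e' x

/-- J lies in the radical of its Frobenius power, and J is finitely generated. -/
theorem exists_pow_le_idealFrobPow {O : Type*} [CommRing O] {J : Ideal O} (hJ : J.FG) (q : ℕ) :
    ∃ N, J ^ N ≤ idealFrobPow J q := by
  refine Ideal.exists_pow_le_of_le_radical_of_fg (fun f hf => ⟨q, ?_⟩) hJ
  exact Ideal.subset_span ⟨f, hf, rfl⟩

theorem idealFrobPow_le_pow {O : Type*} [CommRing O] (J : Ideal O) (q : ℕ) :
    idealFrobPow J q ≤ J ^ q := by
  rw [idealFrobPow, Ideal.span_le]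
  rintro _ ⟨f, hf, rfl⟩
  exact Ideal.pow_mem_pow hf q

/-- The graded family `R` surjects in degree `m` onto `O / J^[q]`. -/
def SurjMod (R : ℕ → AddSubgroup O) (m : ℕ) (I : Ideal O) : Prop :=
  ∀ g : O, ∃ r ∈ R m, r - g ∈ I

variable {p} {R : ℕ → AddSubgroup O} (hmul : ∀ {a b f g}, f ∈ R a → g ∈ R b → f * g ∈ R (a + b))
  (hpow : ∀ {a f}, f ∈ R a → ∀ j, f ^ j ∈ R (a * j))
include hmul hpow

/-- Let φ be the e-th Frobenius, so that the target ideal is I = φ(J^[p^e'])O. Filter O by the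
ideals φ(J^n)O. For f ∈ J^n, take r ∈ R_a congruent to α modulo J^[p^e] = φ(J)O and u ∈ R_b
congruent to f modulo J^[p^e']. Then r φ(u) - α φ(f) = r φ(u - f) + (r - α) φ(f), where the first
term lies in I and the second in φ(J^(n+1))O. Only sums of elements of R occur, so no scalars are
needed. -/
theorem SurjMod.frob {J : Ideal O} (hJ : J.FG) {a b e e' : ℕ}
    (ha : SurjMod R a (idealFrobPow J (p ^ e))) (hb : SurjMod R b (idealFrobPow J (p ^ e'))) :
    SurjMod R (a + b * p ^ e) (idealFrobPow J (p ^ (e + e'))) := by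
  let φ := iterateFrobenius O p e
  set I := idealFrobPow J (p ^ (e + e')) with hI
  have hIφ : I = (idealFrobPow J (p ^ e')).map φ := map_iterateFrobenius_add p J e e'
  have step : ∀ n, ∀ c ∈ (J ^ n).map φ, ∃ r ∈ R (a + b * p ^ e), ∃ c' ∈ (J ^ (n + 1)).map φ,
      r + c' - c ∈ I := by
    intro n c hc
    refine Submodule.closure_induction (p := fun c _ => ∃ r ∈ R (a + b * p ^ e),
      ∃ c' ∈ (J ^ (n + 1)).map φ, r + c' - c ∈ I) ?_ ?_ ?_ hc
    · exact ⟨0, zero_mem _, 0, zero_mem _, by simp⟩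
    · rintro c d - - ⟨r, hr, c', hc', h⟩ ⟨r₁, hr₁, d', hd', h₁⟩
      refine ⟨r + r₁, add_mem hr hr₁, c' + d', add_mem hc' hd', ?_⟩
      convert add_mem h h₁ using 1
      ring
    · rintro α _ ⟨f, hf, rfl⟩
      obtain ⟨r, hr, hrα⟩ := ha α
      obtain ⟨u, hu, huf⟩ := hb f
      have hφu : φ u ∈ R (b * p ^ e) := hpow hu _
      refine ⟨r * φ u, hmul hr hφu, -((r - α) * φ f), neg_mem ?_, ?_⟩
      · rw [pow_succ', Ideal.map_mul]
        exact Ideal.mul_mem_mul hrα (Ideal.mem_map_of_mem φ hf)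
      · have : r * φ u + -((r - α) * φ f) - α • φ f = r * φ (u - f) := by
          rw [map_sub, smul_eq_mul]; ring
        rw [this, hIφ]
        exact Ideal.mul_mem_left _ _ (Ideal.mem_map_of_mem φ huf)
  have iter : ∀ n, ∀ g : O, ∃ r ∈ R (a + b * p ^ e), ∃ c ∈ (J ^ n).map φ, r + c - g ∈ I := by
    intro n
    induction n with
    | zero =>
      intro g
      refine ⟨0, zero_mem _, g, ?_, by simp⟩
      rw [pow_zero, Ideal.one_eq_top, Ideal.map_top]
      trivial
    | succ n ih =>
      intro g
      obtain ⟨r, hr, c, hc, h⟩ := ih g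
      obtain ⟨r', hr', c', hc', h'⟩ := step n c hc
      refine ⟨r + r', add_mem hr hr', c', hc', ?_⟩
      convert add_mem h h' using 1
      ring
  intro g
  -- The filtration ends inside the target: J^N ⊆ J^[p^e'] gives φ(J^N)O ⊆ I.
  obtain ⟨N, hN⟩ := exists_pow_le_idealFrobPow hJ (p ^ e')
  obtain ⟨r, hr, c, hc, h⟩ := iter N g
  refine ⟨r, hr, ?_⟩
  have hc' : c ∈ I := by
    rw [hIφ]
    exact Ideal.map_mono hN hc
  convert sub_mem h hc' using 1
  ring

theorem SurjMod.frob_iterate {J : Ideal O} (hJ : J.FG) {m e : ℕ}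
    (hm : SurjMod R m (idealFrobPow J (p ^ e))) (r : ℕ) :
    SurjMod R (m * ∑ i ∈ Finset.range (r + 1), (p ^ e) ^ i)
      (idealFrobPow J (p ^ (e * (r + 1)))) := by
  induction r with
  | zero => simpa using hm
  | succ r ih =>
    have := SurjMod.frob hmul hpow hJ hm ih
    -- Split off the constant term: with q = p^e, the new sum is 1 + q times the old one, the form m
    -- + b q produced by `SurjMod.frob`.
    rw [Finset.sum_range_succ' _ (r + 1), mul_add, pow_zero, mul_one, add_comm,
      show e * (r + 1 + 1) = e + e * (r + 1) by ring]
    convert this using 2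
    rw [mul_assoc, Finset.sum_mul]
    simp only [pow_succ]

end FrobeniusJets
end FrobSeshadri

end

/-! ### Degrees of multiplication matrices over a polynomial ring -/

noncomputable section
namespace FrobSeshadri

section OrderBound

open MvPolynomial

theorem totalDegree_coeff_prod_le {σ k ι : Type*} [CommRing k] (s : Finset ι)
    (f : ι → Polynomial (MvPolynomial σ k)) (d : ℕ)
    (hf : ∀ i ∈ s, ∀ n, ((f i).coeff n).totalDegree ≤ d) (n : ℕ) :
    ((∏ i ∈ s, f i).coeff n).totalDegree ≤ s.card * d := by
  classical
  induction s using Finset.induction_on generalizing n with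
  | empty =>
    rw [Finset.prod_empty, Polynomial.coeff_one]
    split_ifs <;> simp
  | insert a s ha ih =>
    rw [Finset.prod_insert ha, Polynomial.coeff_mul, Finset.card_insert_of_notMem ha]
    refine totalDegree_finsetSum_le fun x _ => (totalDegree_mul _ _).trans ?_
    have h1 := hf a (Finset.mem_insert_self _ _) x.1
    have h2 := ih (fun i hi => hf i (Finset.mem_insert_of_mem hi)) x.2
    linarith

/-- Each term of the determinant is a product of D entries of X - M, whose coefficients have degree
at most d. -/
theorem totalDegree_coeff_charpoly_le {σ k : Type*} [CommRing k] {D : ℕ}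
    (M : Matrix (Fin D) (Fin D) (MvPolynomial σ k)) (d : ℕ) (hM : ∀ i j, (M i j).totalDegree ≤ d)
    (n : ℕ) : (M.charpoly.coeff n).totalDegree ≤ D * d := by
  rw [Matrix.charpoly, Matrix.det_apply, Polynomial.finsetSum_coeff]
  refine totalDegree_finsetSum_le fun π _ => ?_
  have h : ((∏ i, M.charmatrix (π i) i).coeff n).totalDegree ≤ D * d := by
    refine (totalDegree_coeff_prod_le _ _ d ?_ n).trans (by simp)
    intro i _ m
    rw [Matrix.charmatrix_apply, Polynomial.coeff_sub, Polynomial.coeff_C]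
    refine (totalDegree_sub _ _).trans (max_le ?_ ?_)
    · rw [Matrix.diagonal_apply]
      split_ifs
      · rw [Polynomial.coeff_X]
        split_ifs <;> simp
      · simp
    · split_ifs
      · exact hM _ _
      · simp
  rcases Int.units_eq_one_or (Equiv.Perm.sign π) with h1 | h1 <;> rw [h1]
  · simpa using h
  · simpa using h

variable {k : Type*} [Field k] {τ : Type*} {A : Type*} [CommRing A] [Algebra k A]
  [Algebra (MvPolynomial τ k) A] [IsScalarTower k (MvPolynomial τ k) A]

/-- Elements of `A` whose multiplication is represented, with respect to the generators `b`, by a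
matrix of polynomials of degree at most `n`. -/
def repDegreeLE {D : ℕ} (b : Fin D → A) (n : ℕ) : Submodule k A where
  carrier := {a | ∃ M : Matrix (Fin D) (Fin D) (MvPolynomial τ k),
    M.Represents b (Algebra.lmul (MvPolynomial τ k) A a) ∧ ∀ i j, (M i j).totalDegree ≤ n}
  zero_mem' := ⟨0, by rw [map_zero]; exact Matrix.Represents.zero, by simp⟩
  add_mem' := by
    rintro x y ⟨M, hM, hMd⟩ ⟨M', hM', hMd'⟩
    refine ⟨M + M', by rw [map_add]; exact hM.add hM', fun i j => ?_⟩
    exact (totalDegree_add _ _).trans (max_le (hMd i j) (hMd' i j))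
  smul_mem' := by
    rintro c x ⟨M, hM, hMd⟩
    refine ⟨(C c : MvPolynomial τ k) • M, ?_, fun i j => ?_⟩
    · have h : c • x = (C c : MvPolynomial τ k) • x := by
        rw [← algebraMap_eq, algebraMap_smul]
      rw [h, map_smul]
      exact hM.smul _
    · refine (totalDegree_mul _ _).trans ?_
      simpa using hMd i j

theorem mul_mem_repDegreeLE {D : ℕ} (b : Fin D → A) {m n : ℕ} {x y : A}
    (hx : x ∈ repDegreeLE (k := k) (τ := τ) b m) (hy : y ∈ repDegreeLE (k := k) (τ := τ) b n) :
    x * y ∈ repDegreeLE (k := k) (τ := τ) b (m + n) := by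
  obtain ⟨M, hM, hMd⟩ := hx
  obtain ⟨M', hM', hMd'⟩ := hy
  refine ⟨M * M', by rw [map_mul]; exact hM.mul hM', fun i j => ?_⟩
  rw [Matrix.mul_apply]
  exact totalDegree_finsetSum_le fun l _ =>
    (totalDegree_mul _ _).trans (add_le_add (hMd i l) (hMd' l j))

theorem one_mem_repDegreeLE {D : ℕ} (b : Fin D → A) :
    (1 : A) ∈ repDegreeLE (k := k) (τ := τ) b 0 := by
  refine ⟨1, by rw [map_one]; exact Matrix.Represents.one, fun i j => ?_⟩
  rw [Matrix.one_apply]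
  split_ifs <;> simp

theorem repDegreeLE_mono {D : ℕ} (b : Fin D → A) {m n : ℕ} (h : m ≤ n) :
    repDegreeLE (k := k) (τ := τ) b m ≤ repDegreeLE (k := k) (τ := τ) b n := by
  rintro x ⟨M, hM, hMd⟩
  exact ⟨M, hM, fun i j => (hMd i j).trans h⟩

theorem exists_mem_repDegreeLE {D : ℕ} (b : Fin D → A)
    (hb : Submodule.span (MvPolynomial τ k) (Set.range b) = ⊤) (x : A) :
    ∃ n, x ∈ repDegreeLE (k := k) (τ := τ) b n := by
  obtain ⟨M, hM⟩ := Matrix.isRepresentation.toEnd_surjective (MvPolynomial τ k) b hb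
    (Algebra.lmul (MvPolynomial τ k) A x)
  refine ⟨Finset.univ.sup fun i => Finset.univ.sup fun j => (M.1 i j).totalDegree, M.1, ?_, ?_⟩
  · rw [← hM]
    exact Matrix.isRepresentation.toEnd_represents _ _ _ _
  · intro i j
    exact (Finset.le_sup (f := fun j => (M.1 i j).totalDegree) (Finset.mem_univ j)).trans
      (Finset.le_sup (f := fun i => Finset.univ.sup fun j => (M.1 i j).totalDegree)
        (Finset.mem_univ i))

/-- `repDegreeLE` is a multiplicative filtration, so it is enough to let C bound the matrix degrees
of the finitely many z i. -/
theorem exists_aeval_mem_repDegreeLE {D : ℕ} (b : Fin D → A)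
    (hb : Submodule.span (MvPolynomial τ k) (Set.range b) = ⊤) {σ : Type*} [Finite σ]
    (z : σ → A) : ∃ C, ∀ (n : ℕ) (G : MvPolynomial σ k), G.totalDegree ≤ n →
      aeval z G ∈ repDegreeLE (k := k) (τ := τ) b (C * n) := by
  classical
  have := Fintype.ofFinite σ
  choose d hd using fun i => exists_mem_repDegreeLE (k := k) (τ := τ) b hb (z i)
  let C := Finset.univ.sup d
  have hz : ∀ i, z i ∈ repDegreeLE (k := k) (τ := τ) b C := fun i =>
    repDegreeLE_mono b (Finset.le_sup (Finset.mem_univ i)) (hd i)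
  have hmon : ∀ s : σ →₀ ℕ, aeval z (monomial s (1 : k)) ∈
      repDegreeLE (k := k) (τ := τ) b (C * s.degree) := by
    intro s
    induction s using Finsupp.induction_linear with
    | zero => simpa using one_mem_repDegreeLE b
    | add s t hs ht =>
      have : (monomial (s + t) (1 : k)) = monomial s 1 * monomial t 1 := by
        rw [monomial_mul, mul_one]
      rw [this, map_mul, map_add, mul_add]
      exact mul_mem_repDegreeLE b hs ht
    | single i n =>
      rw [aeval_monomial, map_one, one_mul, Finsupp.degree_single,
        Finsupp.prod_single_index (h := fun i n => z i ^ n) (pow_zero _)]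
      induction n with
      | zero => simpa using one_mem_repDegreeLE b
      | succ n ih =>
        rw [pow_succ, mul_add, mul_one]
        exact mul_mem_repDegreeLE b ih (hz i)
  refine ⟨C, fun n G hG => ?_⟩
  rw [G.as_sum, map_sum]
  refine sum_mem fun s hs => ?_
  have : monomial s (coeff s G) = coeff s G • monomial s (1 : k) := by
    rw [smul_monomial, smul_eq_mul, mul_one]
  rw [this, map_smul]
  refine Submodule.smul_mem _ _ (repDegreeLE_mono b (Nat.mul_le_mul_left _ ?_) (hmon s))
  exact (le_totalDegree hs).trans hG

/-- By Cayley–Hamilton g is a root of the characteristic polynomial of its matrix. Since A is a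
domain and g ≠ 0, powers of X can be stripped off; the constant term that remains is nonzero and
divisible by g. It plays the role of a norm. -/
theorem exists_dvd_of_mem_repDegreeLE [IsDomain A] {D : ℕ} (b : Fin D → A)
    (hb : Submodule.span (MvPolynomial τ k) (Set.range b) = ⊤) {n : ℕ} {g : A} (hg : g ≠ 0)
    (h : g ∈ repDegreeLE (k := k) (τ := τ) b n) :
    ∃ c : MvPolynomial τ k, c ≠ 0 ∧ c.totalDegree ≤ D * n ∧
      g ∣ algebraMap (MvPolynomial τ k) A c := by
  obtain ⟨M, hM, hMd⟩ := h
  have hχ : Polynomial.aeval g M.charpoly = 0 := by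
    let M' : Matrix.isRepresentation (MvPolynomial τ k) b := ⟨M, _, hM⟩
    have h1 : Matrix.isRepresentation.toEnd (MvPolynomial τ k) b hb M' =
        Algebra.lmul (MvPolynomial τ k) A g :=
      Matrix.isRepresentation.eq_toEnd_of_represents _ _ hb M' hM
    have h2 : Polynomial.aeval M' M.charpoly = 0 := by
      apply Subtype.ext
      have := Polynomial.aeval_algHom_apply (Matrix.isRepresentation (MvPolynomial τ k) b).val M'
        M.charpoly
      exact this.symm.trans (Matrix.aeval_self_charpoly M)
    have h3 := congrArg (Matrix.isRepresentation.toEnd (MvPolynomial τ k) b hb) h2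
    rw [← Polynomial.aeval_algHom_apply, h1, map_zero, Polynomial.aeval_algHom_apply] at h3
    simpa using congrArg (fun f => f 1) h3
  have hdeg := totalDegree_coeff_charpoly_le M n hMd
  have hne : M.charpoly ≠ 0 := (Matrix.charpoly_monic M).ne_zero
  generalize M.charpoly = χ at hχ hdeg hne
  -- Write χ = X^r q with X not dividing q; the witness is q(0), a coefficient of χ itself, so the
  -- degree bound applies.
  have hX := Polynomial.exists_eq_pow_rootMultiplicity_mul_and_not_dvd χ hne 0
  rw [map_zero, sub_zero] at hX
  obtain ⟨q, hq, hXq⟩ := hX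
  have hq0 : q.coeff 0 ≠ 0 := fun h => hXq (Polynomial.X_dvd_iff.mpr h)
  generalize χ.rootMultiplicity 0 = r at hq
  subst hq
  have hqg : Polynomial.aeval g q = 0 := by
    rw [map_mul, map_pow, Polynomial.aeval_X] at hχ
    exact (mul_eq_zero.mp hχ).resolve_left (pow_ne_zero _ hg)
  refine ⟨q.coeff 0, hq0, ?_, ?_⟩
  · have := Polynomial.coeff_X_pow_mul q r 0
    rw [← this]
    exact hdeg _
  · rw [← Polynomial.X_mul_divX_add q, map_add, map_mul, Polynomial.aeval_X,
      Polynomial.aeval_C] at hqg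
    refine ⟨-Polynomial.aeval g q.divX, ?_⟩
    linear_combination hqg

end OrderBound
end FrobSeshadri

end

/-! ### Order of vanishing of a polynomial along a finite extension -/

noncomputable section
namespace FrobSeshadri

section OrderBound

open MvPolynomial

/-- Nullstellensatz: the residue field is finite over the algebraically closed field k, hence equal
to k. -/
theorem exists_sub_algebraMap_mem {k A : Type*} [Field k] [IsAlgClosed k] [CommRing A]
    [Algebra k A] [Algebra.FiniteType k A] (𝔪 : Ideal A) [h𝔪 : 𝔪.IsMaximal] (a : A) :
    ∃ α : k, a - algebraMap k A α ∈ 𝔪 := by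
  let _ : Field (A ⧸ 𝔪) := Ideal.Quotient.field 𝔪
  have : Algebra.FiniteType k (A ⧸ 𝔪) :=
    Algebra.FiniteType.of_surjective (Ideal.Quotient.mkₐ k 𝔪) (Ideal.Quotient.mkₐ_surjective k 𝔪)
  have : Module.Finite k (A ⧸ 𝔪) := finite_of_finite_type_of_isJacobsonRing k (A ⧸ 𝔪)
  obtain ⟨α, hα⟩ := (IsAlgClosed.algebraMap_bijective_of_isIntegral (k := k)
    (K := A ⧸ 𝔪)).2 (Ideal.Quotient.mk 𝔪 a)
  refine ⟨α, ?_⟩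
  rw [← Ideal.Quotient.eq]
  exact hα.symm

/-- In the Artinian ring A/I the powers of 𝔪 stabilize, and Nakayama gives an element congruent to 1
modulo 𝔪 that kills the stable power. This is 𝔪^e ⊆ I after localizing at 𝔪, with the denominator
made explicit. -/
theorem exists_mul_pow_le {A : Type*} [CommRing A] [IsNoetherianRing A] (I 𝔪 : Ideal A)
    [h𝔪 : 𝔪.IsPrime] (hI : I ≤ 𝔪) [IsArtinianRing (A ⧸ I)] :
    ∃ e : ℕ, ∃ s ∉ 𝔪, ∀ a ∈ 𝔪 ^ e, s * a ∈ I := by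
  let 𝔫 : Ideal (A ⧸ I) := 𝔪.map (Ideal.Quotient.mk I)
  let f : ℕ →o (Ideal (A ⧸ I))ᵒᵈ := ⟨fun n => OrderDual.toDual (𝔫 ^ n), fun m n h =>
    Ideal.pow_le_pow_right h⟩
  obtain ⟨e, he⟩ := IsArtinian.monotone_stabilizes f
  have h1 : 𝔫 ^ e = 𝔫 ^ (e + 1) := he (e + 1) (Nat.le_succ e)
  obtain ⟨r, hr, hr0⟩ := Submodule.exists_sub_one_mem_and_smul_eq_zero_of_fg_of_le_smul 𝔫 (𝔫 ^ e)
    (IsNoetherian.noetherian _) (by rw [smul_eq_mul, ← pow_succ', ← h1])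
  obtain ⟨s, rfl⟩ := Ideal.Quotient.mk_surjective r
  refine ⟨e, s, fun hs => ?_, fun a ha => ?_⟩
  · rw [← map_one (Ideal.Quotient.mk I), ← map_sub,
      Ideal.mem_map_iff_of_surjective _ Ideal.Quotient.mk_surjective] at hr
    obtain ⟨b, hb, hbs⟩ := hr
    rw [Ideal.Quotient.eq] at hbs
    have : (1 : A) ∈ 𝔪 := by
      have h2 := sub_mem (add_mem (hI hbs) hs) hb
      rwa [show b - (s - 1) + s - b = 1 by ring] at h2
    exact h𝔪.ne_top ((Ideal.eq_top_iff_one _).mpr this)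
  · rw [← Ideal.Quotient.eq_zero_iff_mem, map_mul]
    refine hr0 _ ?_
    rw [← Ideal.map_pow]
    exact Ideal.mem_map_of_mem _ ha

theorem mul_pow_mem {A : Type*} [CommRing A] {I 𝔪 : Ideal A} {e : ℕ} {s : A}
    (h : ∀ a ∈ 𝔪 ^ e, s * a ∈ I) (M : ℕ) : ∀ a ∈ 𝔪 ^ (e * M), s ^ M * a ∈ I ^ M := by
  induction M with
  | zero => simp
  | succ M ih =>
    intro a ha
    rw [mul_add, mul_one, pow_add] at ha
    refine Submodule.mul_induction_on ha ?_ ?_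
    · intro b hb c hc
      rw [pow_succ, pow_succ, show s ^ M * s * (b * c) = (s ^ M * b) * (s * c) by ring]
      exact Ideal.mul_mem_mul (ih b hb) (h c hc)
    · intro b c hb hc
      rw [mul_add]
      exact add_mem hb hc

theorem span_sup_pow_le {A : Type*} [CommRing A] (t : A) (P : Ideal A) (M : ℕ) :
    (Ideal.span {t} ⊔ P) ^ M ≤ Ideal.span {t ^ M} ⊔ P := by
  induction M with
  | zero => simp
  | succ M ih =>
    have h1 : (Ideal.span {t ^ M} ⊔ P) * (Ideal.span {t} ⊔ P) ≤ Ideal.span {t ^ (M + 1)} ⊔ P := by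
      rw [Ideal.mul_sup, Ideal.sup_mul, Ideal.span_singleton_mul_span_singleton, ← pow_succ]
      refine sup_le (sup_le le_sup_left (le_trans ?_ le_sup_right)) (le_trans ?_ le_sup_right)
      · exact Ideal.mul_le_left
      · exact Ideal.mul_le_right
    rw [pow_succ]
    exact (Ideal.mul_mono ih le_rfl).trans h1

/-- A polynomial in a Noether normalization cannot vanish at a point of the finite cover to an
order much larger than its degree. -/
theorem order_le_of_finite {k A τ : Type*} [Field k] [IsAlgClosed k] [Finite τ] [CommRing A]
    [IsDomain A] [Algebra k A] [Algebra (MvPolynomial τ k) A] [IsScalarTower k (MvPolynomial τ k) A]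
    [Module.Finite (MvPolynomial τ k) A] [FaithfulSMul (MvPolynomial τ k) A]
    (𝔪 : Ideal A) [h𝔪 : 𝔪.IsMaximal] :
    ∃ e : ℕ, ∀ (c : MvPolynomial τ k) (d : ℕ), c ≠ 0 → c.totalDegree ≤ d →
      ∀ s ∉ 𝔪, ∀ N, s * algebraMap _ A c ∈ 𝔪 ^ N → N ≤ e * (d + 1) := by
  have : Algebra.FiniteType (MvPolynomial τ k) A := inferInstance
  have : Algebra.FiniteType k A := Algebra.FiniteType.trans (S := MvPolynomial τ k)
    inferInstance inferInstance
  have : IsNoetherianRing A := Algebra.FiniteType.isNoetherianRing k A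
  let P := MvPolynomial τ k
  let 𝔭 : Ideal P := 𝔪.comap (algebraMap P A)
  -- α is the point of affine space below 𝔪; `heval` and `heval0` say that 𝔭 consists of the
  -- polynomials vanishing at α.
  choose α hα using fun i => exists_sub_algebraMap_mem (k := k) 𝔪 (algebraMap P A (X i))
  have hα' : ∀ i, (X i - C (α i) : P) ∈ 𝔭 := by
    intro i
    change algebraMap P A _ ∈ 𝔪
    rw [map_sub, ← algebraMap_eq, ← IsScalarTower.algebraMap_apply]
    exact hα i
  have heval : ∀ c : P, c - C (eval α c) ∈ 𝔭 := by
    intro c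
    rw [← Ideal.Quotient.eq]
    have : (Ideal.Quotient.mkₐ k 𝔭) = (Algebra.ofId k (P ⧸ 𝔭)).comp (aeval α) := by
      apply MvPolynomial.algHom_ext
      intro i
      simp only [AlgHom.comp_apply, aeval_X]
      exact (Ideal.Quotient.eq.mpr (hα' i))
    exact congr($this c)
  have heval0 : ∀ c : P, eval α c ≠ 0 → c ∉ 𝔭 := by
    intro c hc h
    have h1 := sub_mem h (heval c)
    rw [sub_sub_cancel] at h1
    have h2 := 𝔭.mul_mem_left (C (eval α c)⁻¹) h1
    rw [← C_mul, inv_mul_cancel₀ hc, C_1] at h2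
    have : 𝔭.IsPrime := inferInstance
    exact this.ne_top ((Ideal.eq_top_iff_one _).mpr h2)
  let I : Ideal A := 𝔭.map (algebraMap P A)
  have hI : I ≤ 𝔪 := Ideal.map_comap_le
  -- Polynomials act on A/𝔭A through their value at α, so generators over P are generators over k.
  have : Module.Finite k (A ⧸ I) := by
    have hfin : Module.Finite P (A ⧸ I) := Module.Finite.trans A (A ⧸ I)
    obtain ⟨S, hS⟩ := hfin.fg_top
    refine ⟨S, eq_top_iff.mpr fun x _ => ?_⟩
    have hx : x ∈ Submodule.span P (S : Set (A ⧸ I)) := by rw [hS]; trivial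
    induction hx using Submodule.span_induction with
    | mem x hx => exact Submodule.subset_span hx
    | zero => exact zero_mem _
    | add x y _ _ hx hy => exact add_mem (hx trivial) (hy trivial)
    | smul f x _ hx =>
      have h1 : f • x = eval α f • x := by
        have h2 : (f - C (eval α f)) • x = 0 := by
          obtain ⟨a, rfl⟩ := Ideal.Quotient.mk_surjective x
          have h3 : algebraMap P A (f - C (eval α f)) * a ∈ I :=
            Ideal.mul_mem_right _ _ (Ideal.mem_map_of_mem _ (heval f))
          have h4 := Ideal.Quotient.eq_zero_iff_mem.mpr h3
          rw [← h4, Algebra.smul_def, map_mul]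
          rfl
        rw [sub_smul, sub_eq_zero] at h2
        rw [h2, ← algebraMap_eq, algebraMap_smul]
      rw [h1]
      exact Submodule.smul_mem _ _ (hx trivial)
  have : IsArtinianRing (A ⧸ I) := IsArtinianRing.of_finite k (A ⧸ I)
  obtain ⟨e, s₀, hs₀, he⟩ := exists_mul_pow_le I 𝔪 hI
  refine ⟨e + 1, fun c d hc hcd s hs N hN => ?_⟩
  by_contra! hlt
  -- k is infinite, so the nonzero polynomial c has a nonzero value somewhere.
  obtain ⟨v, hv⟩ : ∃ v, eval v c ≠ 0 := by
    by_contra! h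
    exact hc (MvPolynomial.funext fun x => by rw [h x, map_zero])
  have hle : N ≥ e * (d + 1) := by nlinarith
  have h1 : s₀ ^ (d + 1) * (s * algebraMap P A c) ∈ I ^ (d + 1) :=
    mul_pow_mem he _ _ (Ideal.pow_le_pow_right hle hN)
  have hN1 : 1 ≤ N := by nlinarith
  by_cases hvα : v = α
  · subst hvα
    have h2 := Ideal.pow_le_self (by omega) hN
    rcases h𝔪.isPrime.mem_or_mem h2 with h3 | h3
    · exact hs h3
    · exact heval0 c hv h3
  obtain ⟨i₀, hi₀⟩ : ∃ i, v i - α i ≠ 0 := by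
    by_contra! h
    exact hvα (funext fun i => sub_eq_zero.mp (h i))
  -- Restriction to the line through α (parameter 0) and v (parameter 1); t is a linear form that
  -- restricts to the parameter.
  let ψ : P →ₐ[k] Polynomial k := aeval fun i => Polynomial.C (α i) +
    Polynomial.C (v i - α i) * Polynomial.X
  let t : P := C (v i₀ - α i₀)⁻¹ * (X i₀ - C (α i₀))
  have ht : ψ t = Polynomial.X := by
    have hC : ∀ a : k, ψ (C a) = Polynomial.C a := fun a => ψ.commutes a
    have hψX : ψ (X i₀) = Polynomial.C (α i₀) + Polynomial.C (v i₀ - α i₀) * Polynomial.X :=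
      aeval_X _ _
    rw [show ψ t = ψ (C (v i₀ - α i₀)⁻¹) * (ψ (X i₀) - ψ (C (α i₀))) by
      rw [← map_sub, ← map_mul], hC, hC, hψX, add_sub_cancel_left, ← mul_assoc, ← Polynomial.C_mul,
      inv_mul_cancel₀ hi₀, Polynomial.C_1, one_mul]
  have ht𝔭 : t ∈ 𝔭 := 𝔭.mul_mem_left _ (hα' i₀)
  let Q : Ideal P := RingHom.ker ψ
  have hψt : ∀ u : Polynomial k, ψ (Polynomial.aeval t u) = u := fun u => by
    rw [← Polynomial.aeval_algHom_apply, ht, Polynomial.aeval_X_left_apply]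
  have hψ0 : ∀ f, (ψ f).coeff 0 = eval α f := by
    intro f
    have : (Polynomial.aeval (0 : k)).comp ψ = aeval α := by
      apply MvPolynomial.algHom_ext
      intro i
      simp [ψ]
    rw [Polynomial.coeff_zero_eq_eval_zero]
    exact congr($this f)
  have hQ𝔭 : Q ≤ 𝔭 := by
    intro f hf
    by_contra hf'
    have h3 := hψ0 f
    rw [show ψ f = 0 from hf, Polynomial.coeff_zero] at h3
    have h4 := heval f
    rw [← h3, map_zero, sub_zero] at h4
    exact hf' h4
  have : 𝔪.LiesOver 𝔭 := ⟨rfl⟩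
  have : Q.IsPrime := RingHom.ker_isPrime ψ
  have : 𝔭.IsPrime := Ideal.IsPrime.comap _
  -- Going down: the line lifts to a prime 𝔓 of A contained in 𝔪. Modulo 𝔓 the ideal I is generated
  -- by t.
  obtain ⟨𝔓, h𝔓𝔪, h𝔓, hover⟩ := Ideal.exists_ideal_le_liesOver_of_le 𝔪 hQ𝔭
  have hQ𝔓 : ∀ f : P, f ∈ Q ↔ algebraMap P A f ∈ 𝔓 := fun f => by
    rw [hover.over]; rfl
  have hI𝔓 : I ≤ Ideal.span {algebraMap P A t} ⊔ 𝔓 := by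
    rw [Ideal.map_le_iff_le_comap]
    intro f hf
    have hf0 : (ψ f).coeff 0 = 0 := by
      rw [hψ0]
      by_contra h
      exact heval0 f h hf
    obtain ⟨u, hu⟩ := Polynomial.X_dvd_iff.mpr hf0
    have h2 : f - t * Polynomial.aeval t u ∈ Q := by
      change ψ _ = 0
      rw [map_sub, map_mul, hψt, ht, hu, sub_self]
    rw [hQ𝔓] at h2
    have h3 : algebraMap P A (t * Polynomial.aeval t u) ∈ Ideal.span {algebraMap P A t} := by
      rw [map_mul (algebraMap P A) t (Polynomial.aeval t u)]
      exact Ideal.mul_mem_right _ _ (Ideal.mem_span_singleton_self (algebraMap P A t))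
    have h4 : algebraMap P A (t * Polynomial.aeval t u) +
        algebraMap P A (f - t * Polynomial.aeval t u) ∈ Ideal.span {algebraMap P A t} ⊔ 𝔓 :=
      Submodule.add_mem_sup h3 h2
    rw [← map_add, add_sub_cancel] at h4
    exact h4
  have hψc : ψ c ≠ 0 := by
    intro h
    have h3 : Polynomial.eval 1 (ψ c) = eval v c := by
      have : (Polynomial.aeval (1 : k)).comp ψ = aeval v := by
        apply MvPolynomial.algHom_ext
        intro i
        simp [ψ]
      exact congr($this c)
    rw [h, Polynomial.eval_zero] at h3
    exact hv h3.symm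
  obtain ⟨w, hw, hXw⟩ := Polynomial.exists_eq_pow_rootMultiplicity_mul_and_not_dvd (ψ c) hψc 0
  -- On the line c has degree at most d, so it vanishes to order j ≤ d at α; this is strictly less
  -- than the exponent d + 1 of I.
  have hj : (ψ c).rootMultiplicity 0 ≤ d := by
    have h2 : (ψ c).natDegree ≤ d * 1 := aeval_natDegree_le c hcd _ fun i => by
      refine Polynomial.natDegree_add_le_of_degree_le (by simp) ?_
      exact (Polynomial.natDegree_C_mul_le _ _).trans Polynomial.natDegree_X_le
    rw [mul_one] at h2
    classical
    rw [← Polynomial.count_roots]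
    exact ((Multiset.count_le_card _ _).trans (Polynomial.card_roots' _)).trans h2
  generalize (ψ c).rootMultiplicity 0 = j at hw hj
  rw [map_zero, sub_zero] at hw hXw
  have hw0 : w.coeff 0 ≠ 0 := fun h => hXw (Polynomial.X_dvd_iff.mpr h)
  let w' : P := Polynomial.aeval t w
  have hw' : w' ∉ 𝔭 := by
    refine heval0 _ ?_
    rw [← hψ0, hψt]
    exact hw0
  have hcw : c - t ^ j * w' ∈ Q := by
    change ψ _ = 0
    rw [map_sub, map_mul, map_pow, hψt, ht, ← hw, sub_self]
  have h2 := span_sup_pow_le _ _ _ (Ideal.pow_right_mono hI𝔓 (d + 1) h1)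
  obtain ⟨_, hy, z, hz, hyz⟩ := Submodule.mem_sup.mp h2
  obtain ⟨b, rfl⟩ := Ideal.mem_span_singleton'.mp hy
  -- Modulo 𝔓, c is t^j w' with w' nonzero at α, while s₀^(d+1) s c is divisible by t^(d+1).
  -- Cancelling t^j, which is possible since t ∉ 𝔓, puts s₀^(d+1) s w' in 𝔪, although none of its
  -- factors lies there.
  have h3 : algebraMap P A t ^ j * (s₀ ^ (d + 1) * s * algebraMap P A w' -
      algebraMap P A t ^ (d + 1 - j) * b) ∈ 𝔓 := by
    rw [hQ𝔓, map_sub, map_mul, map_pow] at hcw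
    have h4 := sub_mem hz (𝔓.mul_mem_left (s₀ ^ (d + 1) * s) hcw)
    have h5 : algebraMap P A t ^ (d + 1) =
        algebraMap P A t ^ j * algebraMap P A t ^ (d + 1 - j) := by
      rw [← pow_add]; congr 1; omega
    convert h4 using 1
    rw [h5] at hyz
    linear_combination -hyz
  rcases h𝔓.mem_or_mem h3 with h4 | h4
  · have := h𝔓.mem_of_pow_mem _ h4
    rw [← hQ𝔓] at this
    have : ψ t = 0 := this
    rw [ht] at this
    exact Polynomial.X_ne_zero this
  · have h5 : algebraMap P A t ^ (d + 1 - j) * b ∈ 𝔪 :=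
      Ideal.mul_mem_right _ _ (Ideal.pow_mem_of_mem 𝔪 ht𝔭 (d + 1 - j) (by omega))
    have h6 := add_mem (h𝔓𝔪 h4) h5
    rw [sub_add_cancel] at h6
    rcases h𝔪.isPrime.mem_or_mem h6 with h7 | h7
    · rcases h𝔪.isPrime.mem_or_mem h7 with h8 | h8
      · exact hs₀ (h𝔪.isPrime.mem_of_pow_mem _ h8)
      · exact hs h8
    · exact hw' h7

end OrderBound
end FrobSeshadri

end

/-! ### Linear bounds for orders of vanishing -/

noncomputable section
namespace FrobSeshadri

section OrderBound

open MvPolynomial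

/-- In a finitely generated domain, the order of vanishing at a point is bounded linearly in terms
of the degree. -/
theorem exists_order_bound {k A σ : Type*} [Field k] [IsAlgClosed k] [CommRing A] [IsDomain A]
    [Algebra k A] [Algebra.FiniteType k A] [Finite σ] (z : σ → A) (𝔪 : Ideal A) [𝔪.IsMaximal] :
    ∃ C : ℕ, ∀ (n : ℕ) (G : MvPolynomial σ k), G.totalDegree ≤ n → aeval z G ≠ 0 →
      ∀ s ∉ 𝔪, ∀ N, s * aeval z G ∈ 𝔪 ^ N → N ≤ C * (n + 1) := by
  -- Noether normalization; the order of G(z) is at most that of the polynomial c of degree at most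
  -- D C n that it divides.
  obtain ⟨r, φ, hφ, hfin⟩ := exists_finite_inj_algHom_of_fg k A
  let _ : Algebra (MvPolynomial (Fin r) k) A := φ.toRingHom.toAlgebra
  have : IsScalarTower k (MvPolynomial (Fin r) k) A := IsScalarTower.of_algebraMap_eq'
    φ.comp_algebraMap.symm
  have : Module.Finite (MvPolynomial (Fin r) k) A := hfin
  have : FaithfulSMul (MvPolynomial (Fin r) k) A :=
    (faithfulSMul_iff_algebraMap_injective _ _).mpr hφ
  obtain ⟨D, b, hb⟩ := Module.Finite.exists_fin (R := MvPolynomial (Fin r) k) (M := A)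
  obtain ⟨C, hC⟩ := exists_aeval_mem_repDegreeLE (k := k) b hb z
  obtain ⟨e, he⟩ := order_le_of_finite (k := k) (τ := Fin r) 𝔪
  refine ⟨e * (D * C + 1), fun n G hG hG0 s hs N hN => ?_⟩
  obtain ⟨c, hc0, hcd, h, hh⟩ := exists_dvd_of_mem_repDegreeLE b hb hG0 (hC n G hG)
  have h1 : s * algebraMap (MvPolynomial (Fin r) k) A c ∈ 𝔪 ^ N := by
    rw [hh, ← mul_assoc]
    exact Ideal.mul_mem_right _ _ hN
  refine (he c _ hc0 hcd s hs N h1).trans ?_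
  rw [mul_assoc]
  refine Nat.mul_le_mul_left _ ?_
  nlinarith [Nat.zero_le (D * C), Nat.zero_le n]

variable {k K ι : Type*} [Field k] [Field K] [Algebra k K]

/-- The span of the monomials of degree `n` in the `z i`. -/
def monSpan (k : Type*) [Field k] {K ι : Type*} [Field K] [Algebra k K] (z : ι → K) (n : ℕ) :
    Submodule k K :=
  Submodule.span k ((fun s : ι →₀ ℕ => s.prod fun i j => z i ^ j) '' {s | s.degree = n})

theorem mul_mem_monSpan {z : ι → K} {m n : ℕ} {a b : K} (ha : a ∈ monSpan k z m)
    (hb : b ∈ monSpan k z n) : a * b ∈ monSpan k z (m + n) := by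
  have := Submodule.mul_mem_mul ha hb
  rw [monSpan, monSpan, Submodule.span_mul_span] at this
  refine Submodule.span_mono ?_ this
  rintro _ ⟨_, ⟨s, hs, rfl⟩, _, ⟨t, ht, rfl⟩, rfl⟩
  refine ⟨s + t, ?_, ?_⟩
  · change (s + t).degree = m + n
    rw [map_add, show s.degree = m from hs, show t.degree = n from ht]
  · classical
    exact Finsupp.prod_add_index' (fun _ => pow_zero _) (fun _ _ _ => pow_add _ _ _)

theorem self_mem_monSpan (z : ι → K) (i : ι) : z i ∈ monSpan k z 1 :=
  Submodule.subset_span ⟨Finsupp.single i 1, by simp, by simp⟩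

theorem one_mem_monSpan (z : ι → K) : (1 : K) ∈ monSpan k z 0 :=
  Submodule.subset_span ⟨0, by simp, by simp⟩

theorem pow_mem_monSpan {z : ι → K} {m : ℕ} {a : K} (ha : a ∈ monSpan k z m) (j : ℕ) :
    a ^ j ∈ monSpan k z (m * j) := by
  induction j with
  | zero => simpa using one_mem_monSpan z
  | succ j ih => rw [pow_succ, mul_add, mul_one]; exact mul_mem_monSpan ih ha

theorem prod_mem_monSpan {z : ι → K} {κ : Type*} (S : Finset κ) (c : κ → ℕ) (a : κ → K)
    (ha : ∀ i ∈ S, a i ∈ monSpan k z (c i)) : ∏ i ∈ S, a i ∈ monSpan k z (∑ i ∈ S, c i) := by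
  classical
  induction S using Finset.induction_on with
  | empty => simpa using one_mem_monSpan z
  | insert i S hi ih =>
    rw [Finset.prod_insert hi, Finset.sum_insert hi]
    exact mul_mem_monSpan (ha i (Finset.mem_insert_self _ _))
      (ih fun j hj => ha j (Finset.mem_insert_of_mem hj))

theorem exists_aeval_of_mem_monSpan {z : ι → K} {n : ℕ} {a : K} (ha : a ∈ monSpan k z n) :
    ∃ G : MvPolynomial ι k, G.totalDegree ≤ n ∧ aeval z G = a := by
  refine Submodule.span_induction ?_ ⟨0, by simp, by simp⟩ ?_ ?_ ha
  · rintro _ ⟨s, hs, rfl⟩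
    refine ⟨monomial s 1, ?_, by simp [aeval_monomial]⟩
    rw [totalDegree_monomial _ one_ne_zero]
    exact le_of_eq hs
  · rintro x y - - ⟨G, hG, rfl⟩ ⟨G', hG', rfl⟩
    exact ⟨G + G', (totalDegree_add _ _).trans (max_le hG hG'), map_add _ _ _⟩
  · rintro c x - ⟨G, hG, rfl⟩
    exact ⟨c • G, (totalDegree_smul_le _ _).trans hG, map_smul _ _ _⟩

/-- The coordinate ring of the chart `z i ≠ 0`. -/
def chart (k : Type*) [Field k] {K ι : Type*} [Field K] [Algebra k K] (z : ι → K) (i : ι) :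
    Subalgebra k K :=
  Algebra.adjoin k (Set.range fun j => z j / z i)

/-- Homogenization: a polynomial in the z j / z i becomes a form after multiplication by a power of
z i. -/
theorem exists_pow_mul_mem_monSpan {z : ι → K} {i : ι} (hi : z i ≠ 0) {a : K}
    (ha : a ∈ chart k z i) : ∃ c, z i ^ c * a ∈ monSpan k z c := by
  have hz : ∀ c, z i ^ c ∈ monSpan k z c := fun c => by
    simpa using pow_mem_monSpan (self_mem_monSpan (k := k) z i) c
  induction ha using Algebra.adjoin_induction with
  | mem x hx =>
    obtain ⟨j, rfl⟩ := hx
    refine ⟨1, ?_⟩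
    rw [pow_one, mul_div_cancel₀ _ hi]
    exact self_mem_monSpan z j
  | algebraMap r =>
    refine ⟨0, ?_⟩
    rw [pow_zero, one_mul, Algebra.algebraMap_eq_smul_one]
    exact Submodule.smul_mem _ _ (one_mem_monSpan z)
  | add x y _ _ hx hy =>
    obtain ⟨c, hc⟩ := hx
    obtain ⟨d, hd⟩ := hy
    refine ⟨c + d, ?_⟩
    rw [show z i ^ (c + d) * (x + y) = z i ^ c * x * z i ^ d + z i ^ c * (z i ^ d * y) by ring]
    exact add_mem (mul_mem_monSpan hc (hz d)) (mul_mem_monSpan (hz c) hd)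
  | mul x y _ _ hx hy =>
    obtain ⟨c, hc⟩ := hx
    obtain ⟨d, hd⟩ := hy
    refine ⟨c + d, ?_⟩
    rw [show z i ^ (c + d) * (x * y) = (z i ^ c * x) * (z i ^ d * y) by ring]
    exact mul_mem_monSpan hc hd

/-- Locally on each chart h is a form of degree n. A monomial of degree greater than the sum of the
b i contains z_i^(b i) for some i, which clears the denominator of h. The threshold N₀ depends on h.
-/
theorem exists_mul_monSpan_le [Finite ι] {z : ι → K} {h : K} {n : ℕ}
    (hh : ∀ i, ∃ b, z i ^ b * h ∈ monSpan k z (b + n)) :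
    ∃ N₀, ∀ N ≥ N₀, ∀ a ∈ monSpan k z N, a * h ∈ monSpan k z (N + n) := by
  classical
  have := Fintype.ofFinite ι
  choose b hb using hh
  refine ⟨∑ i, b i + 1, fun N hN a ha => ?_⟩
  refine Submodule.span_induction ?_ ?_ ?_ ?_ ha
  · rintro _ ⟨s, hs, rfl⟩
    obtain ⟨i, hi⟩ : ∃ i, b i ≤ s i := by
      by_contra! hlt
      have h1 : s.degree ≤ ∑ i, b i := by
        rw [Finsupp.degree_eq_sum]
        exact Finset.sum_le_sum fun i _ => (hlt i).le
      have h2 : s.degree = N := hs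
      omega
    obtain ⟨t, rfl⟩ : ∃ t, s = t + Finsupp.single i (b i) := by
      refine ⟨s - Finsupp.single i (b i), ?_⟩
      rw [tsub_add_cancel_of_le]
      simpa using hi
    have h1 : ((t + Finsupp.single i (b i)).prod fun i j => z i ^ j) =
        (t.prod fun i j => z i ^ j) * z i ^ b i := by
      rw [Finsupp.prod_add_index' (fun _ => pow_zero _) (fun _ _ _ => pow_add _ _ _),
        Finsupp.prod_single_index (h := fun i j => z i ^ j) (pow_zero _)]
    have h2 : t.degree + b i = N := by
      have : (t + Finsupp.single i (b i)).degree = N := hs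
      rwa [map_add, Finsupp.degree_single] at this
    have h3 : (t.prod fun i j => z i ^ j) ∈ monSpan k z t.degree :=
      Submodule.subset_span ⟨t, rfl, rfl⟩
    simp only [h1]
    rw [mul_assoc, ← h2, add_assoc]
    exact mul_mem_monSpan h3 (hb i)
  · rw [zero_mul]; exact zero_mem _
  · intro x y _ _ hx hy
    rw [add_mul]; exact add_mem hx hy
  · intro c x _ hx
    rw [smul_mul_assoc]; exact Submodule.smul_mem _ _ hx

/-- Rational functions with poles bounded by `m` times a fixed divisor have order of vanishing
bounded linearly in `m`. -/
theorem exists_vanishing_bound [IsAlgClosed k] [Finite ι] (z : ι → K) (o : ι) (ho : z o = 1)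
    (M : ι → K) (hM : ∀ i, z i ≠ 0 → M i ∈ chart k z i) (hM0 : ∀ i, M i ≠ 0)
    {A : Type*} [CommRing A] [IsDomain A] [Algebra k A] [Algebra.FiniteType k A] [Algebra A K]
    [IsScalarTower k A K] [FaithfulSMul A K] (hz : ∀ i, z i ∈ (algebraMap A K).range)
    (𝔪 : Ideal A) [h𝔪 : 𝔪.IsMaximal] :
    ∃ C : ℕ, ∀ (m : ℕ) (f : K), f ≠ 0 → (∀ i, z i ≠ 0 → M i ^ m * f ∈ chart k z i) →
      ∀ s ∉ 𝔪, ∀ N, ∀ a ∈ 𝔪 ^ N, algebraMap A K s * f = algebraMap A K a → N ≤ C * m := by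
  classical
  have := Fintype.ofFinite ι
  choose zA hzA using hz
  have hinj := FaithfulSMul.algebraMap_injective A K
  obtain ⟨C, hC⟩ := exists_order_bound (k := k) zA 𝔪
  have hc : ∀ i, ∃ c, ∃ G ∈ monSpan k z c, G ≠ 0 ∧ (z i ≠ 0 → z i ^ c * M i = G) := by
    intro i
    by_cases hi : z i = 0
    · exact ⟨0, 1, one_mem_monSpan z, one_ne_zero, fun h => (h hi).elim⟩
    · obtain ⟨c, hc⟩ := exists_pow_mul_mem_monSpan hi (hM i hi)
      exact ⟨c, _, hc, mul_ne_zero (pow_ne_zero _ hi) (hM0 i), fun _ => rfl⟩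
  -- G i is the homogenization of M i. Their product P is one form of degree c₀ whose m-th power
  -- clears the poles of f on all charts.
  choose c G hG hG0 hGM using hc
  let c₀ := ∑ i, c i
  let P := ∏ i, G i
  have hP0 : P ≠ 0 := Finset.prod_ne_zero_iff.mpr fun i _ => hG0 i
  have hP : P ∈ monSpan k z c₀ := prod_mem_monSpan _ _ _ fun i _ => hG i
  have haev : ∀ G : MvPolynomial ι k, algebraMap A K (aeval zA G) = aeval z G := by
    intro G
    rw [← MvPolynomial.aeval_algebraMap_apply]
    congr 2
    exact funext hzA
  refine ⟨C * c₀, fun m f hf hfm s hs N a ha hsa => ?_⟩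
  let h := P ^ m * f
  have hh0 : h ≠ 0 := mul_ne_zero (pow_ne_zero _ hP0) hf
  have hh : ∀ i, ∃ b, z i ^ b * h ∈ monSpan k z (b + c₀ * m) := by
    intro i
    by_cases hi : z i = 0
    · exact ⟨1, by rw [hi, pow_one, zero_mul]; exact zero_mem _⟩
    · obtain ⟨b, hb⟩ := exists_pow_mul_mem_monSpan hi (hfm i hi)
      refine ⟨b, ?_⟩
      have hP' : P = G i * ∏ j ∈ Finset.univ.erase i, G j :=
        (Finset.mul_prod_erase _ _ (Finset.mem_univ i)).symm
      have hc' : c₀ = c i + ∑ j ∈ Finset.univ.erase i, c j :=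
        (Finset.add_sum_erase _ _ (Finset.mem_univ i)).symm
      have h1 : (∏ j ∈ Finset.univ.erase i, G j) ∈
        monSpan k z (∑ j ∈ Finset.univ.erase i, c j) := prod_mem_monSpan _ _ _ fun j _ => hG j
      have h2 : z i ^ c i ∈ monSpan k z (c i) := by
        simpa using pow_mem_monSpan (self_mem_monSpan (k := k) z i) (c i)
      have h3 := mul_mem_monSpan (mul_mem_monSpan hb (pow_mem_monSpan h2 m)) (pow_mem_monSpan h1 m)
      convert h3 using 1
      · rw [hc']; ring_nf
      · change z i ^ b * (P ^ m * f) = _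
        rw [hP', ← hGM i hi]
        ring
  obtain ⟨N₀, hN₀⟩ := exists_mul_monSpan_le hh
  have hone : ∀ n, (1 : K) ∈ monSpan k z n := fun n => by
    have := pow_mem_monSpan (self_mem_monSpan (k := k) z o) n
    rwa [ho, one_pow, one_mul] at this
  -- Since N₀ depends on h, its contribution is removed by passing to powers: it enters the degree
  -- of h^j only once, while the order of vanishing grows like j.
  have hpow : ∀ j, h ^ j ∈ monSpan k z (N₀ + c₀ * m * j) := by
    intro j
    induction j with
    | zero => simpa using hone N₀
    | succ j ih =>
      have := hN₀ _ (Nat.le_add_right _ _) _ ih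
      rwa [← pow_succ, add_assoc, ← Nat.mul_succ] at this
  have key : ∀ j, N * j ≤ C * (N₀ + c₀ * m * j + 1) := by
    intro j
    obtain ⟨H, hHd, hH⟩ := exists_aeval_of_mem_monSpan (hpow j)
    obtain ⟨Q, -, hQ⟩ := exists_aeval_of_mem_monSpan hP
    refine hC _ H hHd ?_ (s ^ j) (fun h => hs (h𝔪.isPrime.mem_of_pow_mem _ h)) _ ?_
    · intro h0
      have := haev H
      rw [h0, map_zero, hH] at this
      exact pow_ne_zero j hh0 this.symm
    · have h1 : s ^ j * aeval zA H = a ^ j * (aeval zA Q) ^ (m * j) := by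
        apply hinj
        rw [map_mul, map_mul, map_pow, map_pow, map_pow, haev, haev, hH, hQ, ← hsa]
        change _ * (P ^ m * f) ^ j = _
        ring
      rw [h1, pow_mul]
      exact Ideal.mul_mem_right _ _ (Ideal.pow_mem_pow ha j)
  by_contra! hlt
  -- From N j ≤ C c₀ m j + C (N₀ + 1), any j larger than C (N₀ + 1) forces N ≤ C c₀ m.
  have h1 := key (C * (N₀ + 1) + 1)
  have h2 : (C * c₀ * m + 1) * (C * (N₀ + 1) + 1) ≤ N * (C * (N₀ + 1) + 1) :=
    Nat.mul_le_mul_right _ hlt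
  have h3 : C * (N₀ + c₀ * m * (C * (N₀ + 1) + 1) + 1) =
      C * (N₀ + 1) + C * c₀ * m * (C * (N₀ + 1) + 1) := by ring
  have h4 : (C * c₀ * m + 1) * (C * (N₀ + 1) + 1) =
      C * c₀ * m * (C * (N₀ + 1) + 1) + (C * (N₀ + 1) + 1) := by ring
  omega

end OrderBound
end FrobSeshadri

end

/-! ### Ampleness gives separation of jets -/

noncomputable section
namespace FrobSeshadri

section Algebra

variable {k A : Type*} [Field k] [IsAlgClosed k] [CommRing A] [Algebra k A]
  [Algebra.FiniteType k A]

/-- The residue field is k, so ideal generators of 𝔪^N span 𝔪^N modulo 𝔪^(N+1) over k. Finite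
dimension is what later allows a single twist to serve all jets. -/
theorem exists_fg_sup_pow_eq_top (𝔪 : Ideal A) [h𝔪 : 𝔪.IsMaximal] (N : ℕ) :
    ∃ W : Submodule k A, W.FG ∧ ∀ a, ∃ w ∈ W, a - w ∈ 𝔪 ^ N := by
  have : IsNoetherianRing A := Algebra.FiniteType.isNoetherianRing k A
  induction N with
  | zero => exact ⟨⊥, Submodule.fg_bot, fun a => ⟨0, zero_mem _, by simp⟩⟩
  | succ N ih =>
    obtain ⟨W, hW, h⟩ := ih
    obtain ⟨S, hS⟩ := IsNoetherian.noetherian (𝔪 ^ N)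
    refine ⟨W ⊔ Submodule.span k (S : Set A), hW.sup (Submodule.fg_span S.finite_toSet),
      fun a => ?_⟩
    have key : ∀ b ∈ 𝔪 ^ N, ∃ w ∈ Submodule.span k (S : Set A), b - w ∈ 𝔪 ^ (N + 1) := by
      intro b hb
      have hS' : ∀ g ∈ (S : Set A), g ∈ 𝔪 ^ N := fun g hg => hS ▸ Submodule.subset_span hg
      rw [← hS] at hb
      refine Submodule.closure_induction (p := fun b _ => ∃ w ∈ Submodule.span k (S : Set A),
        b - w ∈ 𝔪 ^ (N + 1)) ⟨0, zero_mem _, by simp⟩ ?_ ?_ hb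
      · rintro b c - - ⟨w, hw, h⟩ ⟨v, hv, h'⟩
        refine ⟨w + v, add_mem hw hv, ?_⟩
        convert add_mem h h' using 1
        ring
      · intro r g hg
        obtain ⟨α, hα⟩ := exists_sub_algebraMap_mem (k := k) 𝔪 r
        refine ⟨α • g, Submodule.smul_mem _ _ (Submodule.subset_span hg), ?_⟩
        change r * g - α • g ∈ _
        rw [Algebra.smul_def, ← sub_mul, pow_succ']
        exact Ideal.mul_mem_mul hα (hS' g hg)
    obtain ⟨w, hw, hwa⟩ := h a
    obtain ⟨v, hv, hva⟩ := key _ hwa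
    refine ⟨w + v, add_mem (Submodule.mem_sup_left hw) (Submodule.mem_sup_right hv), ?_⟩
    rwa [← sub_sub]

theorem exists_sub_algebraMap_mem_maximalIdeal_pow {A O : Type*} [CommRing A] [CommRing O]
    [IsLocalRing O] [Algebra A O] (𝔪 : Ideal A) [h𝔪 : 𝔪.IsMaximal]
    [IsLocalization.AtPrime O 𝔪] (N : ℕ) (g : O) :
    ∃ a : A, algebraMap A O a - g ∈ IsLocalRing.maximalIdeal O ^ N := by
  obtain ⟨a, ha⟩ := Ideal.Quotient.mk_surjective
    ((IsLocalization.AtPrime.equivQuotMaximalIdealPow 𝔪 O N).symm (Ideal.Quotient.mk _ g))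
  refine ⟨a, ?_⟩
  rw [← Ideal.Quotient.mk_eq_mk_iff_sub_mem,
    ← IsLocalization.AtPrime.equivQuotMaximalIdealPow_apply_mk 𝔪 O N a, ha,
    AlgEquiv.apply_symm_apply]

end Algebra

variable {X : Scheme.{u}}

section Nonvanishing

variable {M : X.Modules} {U : X.Opens} {t : Γ(M, U)} (ht : IsGen M U t)

theorem germ_module_smul {U : X.Opens} {y : X} (hy : y ∈ U) (a : Γ(X, U)) (s : Γ(M, U)) :
    M.presheaf.germ U y hy (a • s) = X.presheaf.germ U y hy a • M.presheaf.germ U y hy s :=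
  PresheafOfModules.germ_smul (R := X.presheaf) M.val y U hy a s

theorem germ_module_res {U V : X.Opens} (h : V ≤ U) {y : X} (hy : y ∈ V) (s : Γ(M, U)) :
    M.presheaf.germ V y hy (res M h s) = M.presheaf.germ U y (h hy) s :=
  TopCat.Presheaf.germ_res_apply M.presheaf (homOfLE h) y hy s

include ht

theorem IsGen.exists_smul_germ {y : X} (hy : y ∈ U) (m : M.presheaf.stalk y) :
    ∃ a : X.presheaf.stalk y, a • M.presheaf.germ U y hy t = m := by
  obtain ⟨V, hyV, s, rfl⟩ := TopCat.Presheaf.exists_germ_eq M.presheaf m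
  obtain ⟨a, ha⟩ := (ht.mono (inf_le_right : V ⊓ U ≤ U)).exists_smul_eq (res M inf_le_left s)
  refine ⟨X.presheaf.germ (V ⊓ U) y (inf_mem hyV hy) a, ?_⟩
  rw [← germ_module_res (inf_le_right : V ⊓ U ≤ U) (inf_mem hyV hy), ← germ_module_smul, ha,
    germ_module_res]

theorem IsGen.germ_ne_zero {y : X} (hy : y ∈ U) : M.presheaf.germ U y hy t ≠ 0 := by
  intro h
  rw [← map_zero (M.presheaf.germ U y hy).hom] at h
  obtain ⟨W, hyW, i₁, i₂, h⟩ := TopCat.Presheaf.germ_eq M.presheaf y hy hy t 0 h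
  have h1 : (1 : Γ(X, W)) = 0 := by
    refine (ht.mono i₁.le).eq_of_smul_eq ?_
    rw [one_smul, zero_smul]
    exact h.trans (map_zero _)
  have h2 := congrArg (X.presheaf.germ W y hyW).hom h1
  rw [map_one, map_zero] at h2
  exact one_ne_zero h2

/-- If the germ of F is a unit and F t = b t with b in the maximal ideal, then the unit F - b kills
the germ of t, which is nonzero. -/
theorem IsGen.mem_nonvanishingLocus_iff {s : Γ(M, ⊤)} {F : Γ(X, U)} (hF : F • t = res M le_top s)
    {y : X} (hy : y ∈ U) : y ∈ nonvanishingLocus M s ↔ y ∈ X.basicOpen F := by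
  rw [Scheme.mem_basicOpen _ _ _ hy, nonvanishingLocus, Set.mem_ofPred_eq, iff_comm, ← not_iff_not,
    not_not]
  have h1 : M.presheaf.germ ⊤ y trivial s =
      X.presheaf.germ U y hy F • M.presheaf.germ U y hy t := by
    rw [← germ_module_smul, hF, germ_module_res]
  rw [h1]
  constructor
  · intro h
    exact Submodule.smul_mem_smul ((IsLocalRing.mem_maximalIdeal _).mpr h) trivial
  · intro h hu
    have : ∀ m ∈ IsLocalRing.maximalIdeal (X.presheaf.stalk y) •
        (⊤ : Submodule (X.presheaf.stalk y) (M.presheaf.stalk y)),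
        ∃ b ∈ IsLocalRing.maximalIdeal (X.presheaf.stalk y), b • M.presheaf.germ U y hy t = m := by
      intro m hm
      refine Submodule.smul_induction_on hm ?_ ?_
      · intro r hr n _
        obtain ⟨c, rfl⟩ := ht.exists_smul_germ hy n
        exact ⟨r * c, Ideal.mul_mem_right _ _ hr, mul_smul _ _ _⟩
      · rintro _ _ ⟨b, hb, rfl⟩ ⟨c, hc, rfl⟩
        exact ⟨b + c, Ideal.add_mem _ hb hc, add_smul _ _ _⟩
    obtain ⟨b, hb, hbt⟩ := this _ h
    have hv : IsUnit (X.presheaf.germ U y hy F - b) := by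
      by_contra hnu
      have := Ideal.add_mem _ ((IsLocalRing.mem_maximalIdeal _).mpr hnu) hb
      rw [sub_add_cancel] at this
      exact (IsLocalRing.mem_maximalIdeal _).mp this hu
    obtain ⟨v, hv⟩ := hv
    apply ht.germ_ne_zero hy
    have h0 : (v : X.presheaf.stalk y) • M.presheaf.germ U y hy t = 0 := by
      rw [hv, sub_smul, hbt, sub_self]
    rwa [← Units.smul_def, smul_eq_zero_iff_eq] at h0

end Nonvanishing

section Scalars

variable {k : Type u} [Field k] (f : X ⟶ Spec (CommRingCat.of k))

/-- The scalars in the ring of functions on `U`. -/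
def scalar (U : X.Opens) : k →+* Γ(X, U) :=
  (f.appLE ⊤ U le_top).hom.comp (Scheme.ΓSpecIso (CommRingCat.of k)).inv.hom

theorem resO_scalar {U V : X.Opens} (h : V ≤ U) (α : k) : resO h (scalar f U α) = scalar f V α := by
  have := Scheme.Hom.appLE_map f (U := ⊤) (V := U) (fun _ _ => trivial) (homOfLE h).op
  exact congr($(this) _)

theorem scalar_finiteType [LocallyOfFiniteType f] {U : X.Opens} (hU : IsAffineOpen U) :
    (scalar f U).FiniteType := by
  refine (f.finiteType_appLE (isAffineOpen_top _) hU le_top).comp ?_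
  exact RingHom.FiniteType.of_surjective _
    (Scheme.ΓSpecIso (CommRingCat.of k)).commRingCatIsoToRingEquiv.symm.surjective

end Scalars


variable [IsIntegral X] {L : X.Modules} {x : X} (T : Triv L x)

namespace Triv

theorem jets_mul {a b : ℕ} {f g : X.presheaf.stalk x} (hf : f ∈ T.jets a) (hg : g ∈ T.jets b) :
    f * g ∈ T.jets (a + b) := by
  change algebraMap _ X.functionField (f * g) ∈ T.sec (a + b)
  rw [map_mul]
  exact T.mul_mem_sec hf hg

theorem jets_pow {a : ℕ} {f : X.presheaf.stalk x} (hf : f ∈ T.jets a) (j : ℕ) :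
    f ^ j ∈ T.jets (a * j) := by
  change algebraMap _ X.functionField (f ^ j) ∈ T.sec (a * j)
  rw [map_pow]
  exact T.pow_mem_sec hf j

/-- A function on X_s extends to a global section after multiplication by a high power of s. On each
chart X_s is the locus where F i is invertible, and the finite cover makes the exponent uniform. -/
theorem exists_mul_pow_mem_sec {n : ℕ} {s : Γ(tensorPow L n, ⊤)} {φ : X.functionField}
    (hs : T.Rep n s φ) {U : X.Opens} (hgU : genericPoint X ∈ U)
    (hU : (U : Set X) = nonvanishingLocus (tensorPow L n) s) (a : Γ(X, U)) :
    ∃ J, ∀ j, J ≤ j → toK hgU a * φ ^ j ∈ T.sec (n * j) := by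
  choose F hF hFφ using hs
  have := T.fin
  have := Fintype.ofFinite T.ι
  have hle : ∀ i, X.basicOpen (F i) ≤ U := by
    intro i y hy
    have hyi : y ∈ T.U i := X.basicOpen_le (F i) hy
    rw [← SetLike.mem_coe, hU,
      (isGen_tpow (T.isGen i) n).mem_nonvanishingLocus_iff (hF i) hyi]
    exact hy
  have hgen : ∀ i, genericPoint X ∈ X.basicOpen (F i) := by
    intro i
    rw [← (isGen_tpow (T.isGen i) n).mem_nonvanishingLocus_iff (hF i) (T.gen i), ← hU]
    exact hgU
  have h1 : ∀ i, ∃ J, ∃ b : Γ(X, T.U i), toK hgU a * toK (T.gen i) (F i) ^ J = toK (T.gen i) b := by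
    intro i
    let : Algebra Γ(X, T.U i) Γ(X, X.basicOpen (F i)) :=
      (resO (X.basicOpen_le (F i))).toAlgebra
    have : IsLocalization.Away (F i) Γ(X, X.basicOpen (F i)) :=
      (T.affine i).isLocalization_basicOpen _
    obtain ⟨J, b, hb⟩ := IsLocalization.Away.surj (F i) (resO (hle i) a)
    refine ⟨J, b, ?_⟩
    have hb' : resO (hle i) a * resO (X.basicOpen_le (F i)) (F i) ^ J =
      resO (X.basicOpen_le (F i)) b := hb
    have := congrArg (toK (hgen i)) hb'
    rwa [map_mul, map_pow, toK_resO _ hgU, toK_resO _ (T.gen i), toK_resO _ (T.gen i)] at this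
  choose J b hb using h1
  refine ⟨∑ i, J i, fun j hj i y hy => ?_⟩
  have hij : J i ≤ j := (Finset.single_le_sum (fun _ _ => Nat.zero_le _) (Finset.mem_univ i)).trans hj
  have h2 : toK hgU a * φ ^ j * T.w i ^ (n * j) = toK (T.gen i) (b i * F i ^ (j - J i)) := by
    rw [map_mul, map_pow, ← hb, mul_assoc (toK hgU a) (_ ^ J i), ← pow_add,
      Nat.add_sub_cancel' hij, hFφ, mul_pow, pow_mul, mul_assoc]
  rw [h2]
  exact toK_mem_regAt _ hy _

theorem exists_surjMod {k : Type u} [Field k] [IsAlgClosed k] (f : X ⟶ Spec (CommRingCat.of k))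
    [LocallyOfFiniteType f] (hL : IsAmple L) (hx : IsClosed ({x} : Set X)) (N : ℕ) :
    ∃ m, 1 ≤ m ∧ SurjMod T.jets m (IsLocalRing.maximalIdeal (X.presheaf.stalk x) ^ N) := by
  obtain ⟨n, hn, s, U, hUa, hU, hxU⟩ := hL.exists_affine x
  obtain ⟨φ, -, hs⟩ := T.exists_rep_of_section n s
  have hgU := genericPoint_mem hxU
  let : Algebra k Γ(X, U) := (scalar f U).toAlgebra
  have : Algebra.FiniteType k Γ(X, U) := scalar_finiteType f hUa
  let : Algebra Γ(X, U) (X.presheaf.stalk x) := X.presheaf.algebra_section_stalk ⟨x, hxU⟩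
  let 𝔪 := (hUa.primeIdealOf ⟨x, hxU⟩).asIdeal
  have hloc : IsLocalization.AtPrime (X.presheaf.stalk x) 𝔪 := hUa.isLocalization_stalk ⟨x, hxU⟩
  have hmax : 𝔪.IsMaximal := hUa.primeIdealOf_isMaximal_of_isClosed ⟨x, hxU⟩ hx
  obtain ⟨W, ⟨S, rfl⟩, hW⟩ := exists_fg_sup_pow_eq_top (k := k) 𝔪 N
  choose J hJ using T.exists_mul_pow_mem_sec hs hgU hU
  -- One exponent for all generators of W; the summand 1 keeps the degree n j positive.
  let j := 1 + ∑ a ∈ S, J a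
  have hj : ∀ a ∈ Submodule.span k (S : Set Γ(X, U)), toK hgU a * φ ^ j ∈ T.sec (n * j) := by
    intro a ha
    refine Submodule.closure_induction (p := fun a _ => toK hgU a * φ ^ j ∈ T.sec (n * j))
      ?_ ?_ ?_ ha
    · rw [map_zero, zero_mul]; exact zero_mem _
    · intro a b _ _ ha hb
      rw [map_add, add_mul]; exact add_mem ha hb
    · intro α a ha i y hy
      -- Scalars come from global functions, so multiplying by them preserves regularity at every
      -- point.
      have h1 : toK hgU (α • a) = toK (U := ⊤) trivial (scalar f ⊤ α) * toK hgU a := by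
        rw [Algebra.smul_def, map_mul]
        congr 1
        change toK hgU (scalar f U α) = _
        rw [← resO_scalar f le_top, toK_resO le_top trivial hgU]
      rw [h1, mul_assoc, mul_assoc]
      refine mul_mem (toK_mem_regAt (U := ⊤) trivial trivial _) ?_
      rw [← mul_assoc]
      refine hJ a j ?_ i y hy
      have := Finset.single_le_sum (f := J) (fun _ _ => Nat.zero_le _) ha
      simp only [j]
      omega
  obtain ⟨F, hF, hFφ⟩ := hs T.o
  rw [T.w_o, one_pow, mul_one] at hFφ
  have hu : IsUnit (X.presheaf.germ _ x T.mem F) := by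
    rw [← Scheme.mem_basicOpen _ _ _ T.mem,
      ← (isGen_tpow (T.isGen T.o) n).mem_nonvanishingLocus_iff hF T.mem, ← hU]
    exact hxU
  obtain ⟨v, hv⟩ := hu
  refine ⟨n * j, Nat.mul_pos hn (by simp [j]), fun g => ?_⟩
  -- The section s is a unit v at x. Approximating v^(-j) g by a function from W and multiplying
  -- back by v^j approximates g.
  obtain ⟨a, ha⟩ := exists_sub_algebraMap_mem_maximalIdeal_pow 𝔪 N (↑(v⁻¹ ^ j) * g)
  obtain ⟨a', ha', haa'⟩ := hW a
  refine ⟨algebraMap _ _ a' * v ^ j, ?_, ?_⟩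
  · change algebraMap _ X.functionField (X.presheaf.germ _ x hxU a' * v ^ j) ∈
      T.sec (n * j)
    rw [map_mul, map_pow, algebraMap_germ hgU, hv, algebraMap_germ (T.gen _), hFφ]
    exact hj a' ha'
  · have h1 : algebraMap _ (X.presheaf.stalk x) (a - a') ∈
        IsLocalRing.maximalIdeal (X.presheaf.stalk x) ^ N := by
      rw [← IsLocalization.AtPrime.map_eq_maximalIdeal 𝔪, ← Ideal.map_pow]
      exact Ideal.mem_map_of_mem _ haa'
    have h2 : algebraMap _ (X.presheaf.stalk x) a' * (v : X.presheaf.stalk x) ^ j - g =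
        (v : X.presheaf.stalk x) ^ j * ((algebraMap _ (X.presheaf.stalk x) a - ↑(v⁻¹ ^ j) * g) -
          algebraMap _ (X.presheaf.stalk x) (a - a')) := by
      have h3 : (v : X.presheaf.stalk x) ^ j * (↑(v⁻¹ ^ j) * g) = g := by
        rw [← mul_assoc, ← Units.val_pow_eq_pow_val, ← Units.val_mul, inv_pow, mul_inv_cancel,
          Units.val_one, one_mul]
      rw [map_sub, mul_sub, mul_sub, h3]
      ring
    rw [h2]
    exact Ideal.mul_mem_left _ _ (sub_mem ha h1)

end Triv

end FrobSeshadri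

end

/-! ### Homogeneous coordinates as rational functions -/

noncomputable section
namespace FrobSeshadri

attribute [local instance] MvPolynomial.gradedAlgebra

section Graded

/-- The grading of the polynomial ring by degree. -/
abbrev polyGrading (k : Type u) [Field k] (n : ℕ) :
    ℕ → Submodule k (MvPolynomial (Fin (n + 1)) k) :=
  MvPolynomial.homogeneousSubmodule (Fin (n + 1)) k

variable {k : Type u} [Field k] {n : ℕ}

theorem algebraMap_degreeZero_surjective :
    Function.Surjective (algebraMap k (polyGrading k n 0)) := by
  rintro ⟨r, hr⟩
  have h : r.totalDegree = 0 := by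
    have := MvPolynomial.IsHomogeneous.totalDegree_le
      ((MvPolynomial.mem_homogeneousSubmodule _ _).mp hr)
    omega
  refine ⟨_, Subtype.ext (MvPolynomial.totalDegree_eq_zero_iff_eq_C.mp h).symm⟩

theorem adjoin_degreeZero_range_X :
    Algebra.adjoin (polyGrading k n 0)
      (Set.range (MvPolynomial.X : Fin (n + 1) → MvPolynomial _ k)) = ⊤ := by
  rw [eq_top_iff]
  rintro p -
  induction p using MvPolynomial.induction_on with
  | C a => exact algebraMap_mem (R := (polyGrading k n) 0) _ (algebraMap k (polyGrading k n 0) a)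
  | add p q hp hq => exact add_mem hp hq
  | mul_X p i hp => exact mul_mem hp (Algebra.subset_adjoin ⟨i, rfl⟩)

instance finiteType_degreeZero :
    Algebra.FiniteType (polyGrading k n 0) (MvPolynomial (Fin (n + 1)) k) := by
  classical
  refine ⟨⟨Finset.univ.image MvPolynomial.X, ?_⟩⟩
  simpa using adjoin_degreeZero_range_X

theorem X_mem_one (j : Fin (n + 1)) : (MvPolynomial.X j : MvPolynomial _ k) ∈ polyGrading k n 1 :=
  MvPolynomial.isHomogeneous_X k j

variable (k n) in
/-- The open subset `x_j ≠ 0` of projective space. -/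
abbrev chartOpen (j : Fin (n + 1)) : (Proj (polyGrading k n)).Opens :=
  Proj.basicOpen (polyGrading k n) (MvPolynomial.X j)

variable (k n) in
/-- The map from degree zero fractions to functions on the open subset `x_j ≠ 0`. -/
abbrev chartMap (j : Fin (n + 1)) :
    CommRingCat.of (HomogeneousLocalization.Away (polyGrading k n) (MvPolynomial.X j)) ⟶
      Γ(Proj (polyGrading k n), chartOpen k n j) :=
  Proj.awayToSection (polyGrading k n) (MvPolynomial.X j)

theorem isAffineOpen_chartOpen (j : Fin (n + 1)) : IsAffineOpen (chartOpen k n j) :=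
  Proj.isAffineOpen_basicOpen (polyGrading k n) (MvPolynomial.X j) (X_mem_one j) one_pos

/-- The function `x_i / x_j`. -/
def ratio (i j : Fin (n + 1)) : HomogeneousLocalization.Away (polyGrading k n) (MvPolynomial.X j) :=
  HomogeneousLocalization.Away.mk (polyGrading k n) (X_mem_one j) 1 (MvPolynomial.X i) (X_mem_one i)

/-- The ring of degree zero fractions on x_j ≠ 0 is generated by the scalars and the ratios x_i /
x_j. -/
theorem away_mem (j : Fin (n + 1))
    {S : Subring (HomogeneousLocalization.Away (polyGrading k n) (MvPolynomial.X j))}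
    (hS : ∀ c : k, HomogeneousLocalization.fromZeroRingHom (polyGrading k n) _
      (algebraMap k (polyGrading k n 0) c) ∈ S)
    (hS' : ∀ i, ratio i j ∈ S)
    (a : HomogeneousLocalization.Away (polyGrading k n) (MvPolynomial.X j)) : a ∈ S := by
  have h := HomogeneousLocalization.Away.span_mk_prod_pow_eq_top (X_mem_one (k := k) j)
    MvPolynomial.X adjoin_degreeZero_range_X (fun _ => 1) X_mem_one
  have ha : a ∈ (⊤ : Submodule (polyGrading k n 0)
      (HomogeneousLocalization.Away (polyGrading k n) (MvPolynomial.X j))) := trivial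
  rw [← h] at ha
  induction ha using Submodule.span_induction with
  | mem b hb =>
    obtain ⟨d, ai, hai, rfl⟩ := hb
    have h1 : HomogeneousLocalization.Away.mk (polyGrading k n) (X_mem_one (k := k) j) d
        (∏ i, MvPolynomial.X i ^ ai i)
        (hai ▸ SetLike.prod_pow_mem_graded _ _ _ _ fun i _ ↦ X_mem_one i) =
        ∏ i, ratio i j ^ ai i := by
      apply HomogeneousLocalization.val_injective
      have hd : ∑ i, ai i = d := by simpa using hai
      rw [← HomogeneousLocalization.algebraMap_apply, ← HomogeneousLocalization.algebraMap_apply,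
        map_prod]
      simp only [map_pow, ratio, HomogeneousLocalization.algebraMap_apply,
        HomogeneousLocalization.Away.val_mk, Localization.mk_pow, Localization.mk_prod]
      congr 1
      ext
      simp [Finset.prod_pow_eq_pow_sum, hd]
    rw [h1]
    exact prod_mem fun i _ => pow_mem (hS' i) _
  | zero => exact zero_mem _
  | add b c _ _ hb hc => exact add_mem hb hc
  | smul r b _ hb =>
    obtain ⟨c, rfl⟩ := algebraMap_degreeZero_surjective r
    rw [Algebra.smul_def]
    exact mul_mem (hS c) hb

end Graded

variable {X : Scheme.{u}} {k : Type u} [Field k]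

theorem IsProjectiveVariety.locallyOfFiniteType {f : X ⟶ Spec (CommRingCat.of k)}
    (hX : IsProjectiveVariety k f) : LocallyOfFiniteType f := by
  obtain ⟨n, i, hi, rfl⟩ := hX.exists_embedding
  have : LocallyOfFiniteType (Spec.map (CommRingCat.ofHom
      (algebraMap k (polyGrading k n 0)))) := by
    rw [HasRingHomProperty.Spec_iff (P := @LocallyOfFiniteType)]
    exact RingHom.FiniteType.of_surjective _ algebraMap_degreeZero_surjective
  have : LocallyOfFiniteType (projSpaceStructure k n) := by
    exact MorphismProperty.comp_mem @LocallyOfFiniteType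
      (Proj.toSpecZero (polyGrading k n)) _ inferInstance this
  infer_instance

theorem app_scalar {P : Scheme.{u}} (i : X ⟶ P) (π : P ⟶ Spec (CommRingCat.of k)) (U : P.Opens)
    (c : k) : i.app U (scalar π U c) = scalar (i ≫ π) (i ⁻¹ᵁ U) c := by
  have := Scheme.Hom.appLE_comp_appLE i π ⊤ U (i ⁻¹ᵁ U) le_top le_rfl
  rw [← Scheme.Hom.app_eq_appLE] at this
  exact congr($(this) _)

theorem scalar_eq_of_comp_eq (π : X ⟶ Spec (CommRingCat.of k)) (U : X.Opens)
    (c : CommRingCat.of k ⟶ Γ(X, U)) (h : U.ι ≫ π = U.toSpecΓ ≫ Spec.map c) :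
    scalar π U = c.hom := by
  have h1 := congr($(h).appTop ≫ U.topIso.hom)
  rw [Scheme.Hom.comp_appTop, Scheme.Hom.comp_appTop, Scheme.Opens.toSpecΓ_appTop] at h1
  simp only [Category.assoc, Iso.inv_hom_id, Category.comp_id] at h1
  have h2 : scalar π U = ((Scheme.ΓSpecIso (CommRingCat.of k)).inv ≫ π.appTop ≫
      X.presheaf.map (homOfLE le_top).op).hom := rfl
  have h3 : U.ι.appTop ≫ U.topIso.hom = X.presheaf.map (homOfLE le_top).op := by
    rw [Scheme.Opens.ι_appTop, Scheme.Opens.topIso_hom]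
    exact (X.presheaf.map_comp _ _).symm
  rw [h2, ← h3, h1, Scheme.ΓSpecIso_naturality, Iso.inv_hom_id_assoc]

theorem basicOpen_ι_toSpecZero {n : ℕ} (j : Fin (n + 1)) :
    (chartOpen k n j).ι ≫ Proj.toSpecZero (polyGrading k n) =
      (chartOpen k n j).toSpecΓ ≫
        Spec.map (CommRingCat.ofHom (HomogeneousLocalization.fromZeroRingHom (polyGrading k n) _) ≫
          chartMap k n j) := by
  have h := Proj.awayι_toSpecZero (polyGrading k n) (MvPolynomial.X j) (X_mem_one j) one_pos
  rw [← Proj.basicOpenIsoSpec_inv_ι, Category.assoc, Iso.inv_comp_eq, Proj.basicOpenIsoSpec_hom,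
    Proj.basicOpenToSpec, Category.assoc, ← Spec.map_comp] at h
  exact h

theorem scalar_projSpaceStructure {n : ℕ} (j : Fin (n + 1)) (c : k) :
    scalar (projSpaceStructure k n) (chartOpen k n j) c =
      chartMap k n j
        (HomogeneousLocalization.fromZeroRingHom _ _ (algebraMap k _ c)) := by
  have h := scalar_eq_of_comp_eq (Proj.toSpecZero (polyGrading k n) ≫
    Spec.map (CommRingCat.ofHom (algebraMap k (polyGrading k n 0))))
    (chartOpen k n j)
    (CommRingCat.ofHom (algebraMap k (polyGrading k n 0)) ≫
      CommRingCat.ofHom (HomogeneousLocalization.fromZeroRingHom (polyGrading k n) _) ≫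
      chartMap k n j) (by
      rw [Spec.map_comp (CommRingCat.ofHom (algebraMap k (polyGrading k n 0))), ← Category.assoc,
        basicOpen_ι_toSpecZero, Category.assoc])
  exact congr($(h) c)

/-- Rational functions on the homogeneous coordinate chart at the image of the generic point. -/
theorem exists_charts [IsIntegral X] {f : X ⟶ Spec (CommRingCat.of k)}
    (hX : IsProjectiveVariety k f) (x : X) :
    ∃ (n : ℕ) (z : Fin (n + 1) → X.functionField) (Y : Fin (n + 1) → X.Opens) (o : Fin (n + 1)),
      x ∈ Y o ∧ z o = 1 ∧ (∀ i, IsAffineOpen (Y i)) ∧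
      (∀ (hg : genericPoint X ∈ Y o) (i), ∃ a, toK hg a = z i) ∧
      ∀ i, z i ≠ 0 → ∃ hg : genericPoint X ∈ Y i, ∀ (S : Subring X.functionField),
        (∀ c, toK (U := ⊤) trivial (scalar f ⊤ c) ∈ S) → (∀ j, z j / z i ∈ S) →
          ∀ a, toK hg a ∈ S := by
  obtain ⟨n, i, hi, rfl⟩ := hX.exists_embedding
  have haff : IsAffineHom i := inferInstance
  let Y : Fin (n + 1) → X.Opens := fun j =>
    i ⁻¹ᵁ (chartOpen k n j)
  let y := i (genericPoint X)
  let 𝔭 : ProjectiveSpectrum (polyGrading k n) := y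
  let st := Proj.stalkIso' (polyGrading k n) y
  -- Pullback of degree zero fractions to the function field, via the stalk map at the generic
  -- point. It is a local homomorphism into a field, so fractions with nonzero image are units.
  let Θ : HomogeneousLocalization.AtPrime (polyGrading k n) 𝔭.asHomogeneousIdeal.toIdeal →+*
    X.functionField := (i.stalkMap (genericPoint X)).hom.comp st.symm.toRingHom
  have hΘ : ∀ a, Θ a ≠ 0 → IsUnit a := by
    intro a ha
    have h1 : IsUnit (st.symm a) := by
      have := isUnit_iff_ne_zero.mpr ha
      exact isUnit_of_map_unit (i.stalkMap (genericPoint X)).hom _ this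
    simpa using h1.map st.toRingHom
  have hY : ∀ j, genericPoint X ∈ Y j ↔ MvPolynomial.X j ∉ 𝔭.asHomogeneousIdeal := fun j => Iff.rfl
  have hsec : ∀ j (hj : genericPoint X ∈ Y j) a, toK hj (i.app _ (chartMap k n j a)) =
      Θ (HomogeneousLocalization.mapId _ (Submonoid.powers_le.mpr hj) a) := by
    intro j hj a
    have h1 := i.germ_stalkMap_apply (chartOpen k n j)
      (genericPoint X) hj (chartMap k n j a)
    refine h1.symm.trans ?_
    have h2 := ProjectiveSpectrum.Proj.awayToSection_germ (polyGrading k n) (MvPolynomial.X j) 𝔭 hj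
    exact congr((i.stalkMap (genericPoint X)).hom ($(h2) a))
  have hsurj : ∀ j, Function.Surjective fun a => i.app (chartOpen k n j)
      (chartMap k n j a) := by
    intro j
    refine (i.app_surjective _ (isAffineOpen_chartOpen j)).comp ?_
    exact (Proj.basicOpenIsoAway (polyGrading k n) (MvPolynomial.X j) (X_mem_one j)
      one_pos).commRingCatIsoToRingEquiv.surjective
  have hcover : ∃ o, x ∈ Y o := by
    have := Proj.iSup_basicOpen_eq_top' (polyGrading k n) MvPolynomial.X
      (fun i => ⟨1, X_mem_one i⟩) adjoin_degreeZero_range_X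
    have hx : i x ∈ (⊤ : (projSpace k n).Opens) := trivial
    obtain ⟨o, ho⟩ := TopologicalSpace.Opens.mem_iSup.mp
      ((congr(i x ∈ $(this)) : _ = _).mpr hx)
    exact ⟨o, ho⟩
  obtain ⟨o, ho⟩ := hcover
  have hgo : genericPoint X ∈ Y o := genericPoint_mem ho
  let R (i j) (hj : genericPoint X ∈ Y j) :
      HomogeneousLocalization.AtPrime (polyGrading k n) 𝔭.asHomogeneousIdeal.toIdeal :=
    HomogeneousLocalization.mapId _ (Submonoid.powers_le.mpr hj) (ratio i j)
  have hR : ∀ i j hj, (R i j hj).val = Localization.mk (MvPolynomial.X i) ⟨MvPolynomial.X j, hj⟩ := by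
    intro i j hj
    have h1 : (R i j hj).val = Localization.mk (MvPolynomial.X i) ⟨MvPolynomial.X j ^ 1, _⟩ := rfl
    simp only [h1, pow_one]
  -- z i is x_i / x_o restricted to X. It is nonzero exactly when the generic point lies in the
  -- chart x_i ≠ 0; it vanishes when X lies in the hyperplane x_i = 0.
  let z i := Θ (R i o hgo)
  have hzR : ∀ i j hj, z j * Θ (R i j hj) = z i := by
    intro i j hj
    rw [← map_mul]
    congr 1
    apply HomogeneousLocalization.val_injective
    rw [HomogeneousLocalization.val_mul, hR _ _ hgo, hR _ _ hj, hR _ _ hgo,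
      Localization.mk_mul, Localization.mk_eq_mk_iff,
      Localization.r_iff_exists]
    refine ⟨1, ?_⟩
    simp only [Submonoid.coe_mul]
    ring
  refine ⟨n, z, Y, o, ho, ?_, ?_, ?_, ?_⟩
  · have : R o o hgo = 1 := by
      apply HomogeneousLocalization.val_injective
      rw [hR, HomogeneousLocalization.val_one]
      exact Localization.mk_self (⟨_, hgo⟩ : 𝔭.asHomogeneousIdeal.toIdeal.primeCompl)
    simp only [z, this, map_one]
  · intro j
    exact haff.isAffine_preimage _
      (isAffineOpen_chartOpen j)
  · intro hg j
    exact ⟨_, hsec o hg (ratio j o)⟩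
  · intro j hj
    have hgj : genericPoint X ∈ Y j := by
      have h1 := (hΘ _ hj).map (algebraMap _ (Localization.AtPrime 𝔭.asHomogeneousIdeal.toIdeal))
      rw [HomogeneousLocalization.algebraMap_apply, hR _ _ hgo, Localization.mk_eq_mk'] at h1
      rw [hY]
      exact (IsLocalization.AtPrime.isUnit_mk'_iff _ 𝔭.asHomogeneousIdeal.toIdeal _ _).mp h1
    refine ⟨hgj, fun S hS hS' a => ?_⟩
    obtain ⟨b, rfl⟩ := hsurj j a
    refine away_mem j (S := S.comap ((toK hgj).comp ((i.app _).hom.comp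
      (chartMap k n j).hom))) ?_ ?_ b
    · intro c
      change toK hgj (i.app _ (chartMap k n j _)) ∈ S
      have h1 := hS c
      rw [← toK_resO le_top trivial hgj, resO_scalar] at h1
      have h2 := app_scalar i (projSpaceStructure k n) (chartOpen k n j) c
      rw [scalar_projSpaceStructure] at h2
      exact (congrArg (toK hgj) h2) ▸ h1
    · intro l
      change toK hgj (i.app _ (chartMap k n j _)) ∈ S
      rw [hsec]
      have h1 := hS' l
      rw [← hzR l j hgj, mul_div_cancel_left₀ _ hj] at h1
      exact h1

end FrobSeshadri

end

/-! ### The linear bound on separated Frobenius jets -/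

noncomputable section
namespace FrobSeshadri

/-- Otherwise 𝔪^n = 𝔪^(n+1), so Nakayama gives 𝔪^n = 0, and a domain with this property is a field.
-/
theorem exists_mem_pow_notMem_pow_succ {O : Type*} [CommRing O] [IsDomain O] [IsLocalRing O]
    [IsNoetherianRing O] (hO : ¬ IsField O) (n : ℕ) :
    ∃ g ∈ IsLocalRing.maximalIdeal O ^ n, g ∉ IsLocalRing.maximalIdeal O ^ (n + 1) := by
  by_contra! hle
  have h1 : IsLocalRing.maximalIdeal O ^ n = ⊥ := by
    refine Submodule.eq_bot_of_le_smul_of_le_jacobson_bot (IsLocalRing.maximalIdeal O) _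
      (IsNoetherian.noetherian _) ?_ (IsLocalRing.maximalIdeal_le_jacobson _)
    rw [smul_eq_mul, ← pow_succ']
    exact hle
  rcases Nat.eq_zero_or_pos n with rfl | hn
  · rw [pow_zero, Ideal.one_eq_top] at h1
    exact bot_ne_top h1.symm
  · exact hO (IsLocalRing.isField_iff_maximalIdeal_eq.mpr (eq_zero_of_pow_eq_zero h1))

variable {X : Scheme.{u}}

theorem isNoetherianRing_stalk {k : Type u} [Field k] (f : X ⟶ Spec (CommRingCat.of k))
    [LocallyOfFiniteType f] (x : X) : IsNoetherianRing (X.presheaf.stalk x) := by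
  have : IsLocallyNoetherian X := LocallyOfFiniteType.isLocallyNoetherian f
  infer_instance

theorem expChar_stalk {k : Type u} [Field k] (f : X ⟶ Spec (CommRingCat.of k)) (p : ℕ)
    [Fact p.Prime] [CharP k p] (x : X) : ExpChar (X.presheaf.stalk x) p := by
  let φ : k →+* X.presheaf.stalk x := (X.presheaf.germ ⊤ x trivial).hom.comp (scalar f ⊤)
  have := charP_of_injective_ringHom φ.injective p
  exact ExpChar.prime Fact.out

/-- If the stalk were a field, the generic point would be the closed point x, so X would be a single
point of dimension zero. -/
theorem stalk_not_isField [IsIntegral X] (hdim : 0 < topologicalKrullDim X) (x : X)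
    (hx : IsClosed ({x} : Set X)) : ¬ IsField (X.presheaf.stalk x) := by
  intro hF
  let := hF.toField
  have h1 : genericPoint X ∈ Set.range (X.fromSpecStalk x) := by
    rw [Scheme.range_fromSpecStalk]
    exact genericPoint_specializes x
  obtain ⟨y, hy⟩ := h1
  have h2 : genericPoint X = x := by
    have : Subsingleton (PrimeSpectrum (X.presheaf.stalk x)) := inferInstance
    refine hy.symm.trans (Eq.trans ?_ (Scheme.fromSpecStalk_closedPoint (X := X) (x := x)))
    exact congrArg _ (Subsingleton.elim (α := PrimeSpectrum (X.presheaf.stalk x)) _ _)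
  have h3 : ∀ y : X, y = x := by
    intro y
    have : y ∈ closure {genericPoint X} := by
      rw [genericPoint_closure]; trivial
    rw [h2, hx.closure_eq] at this
    exact this
  have : Subsingleton (TopologicalSpace.IrreducibleCloseds X) := by
    refine ⟨fun a b => ?_⟩
    have ha : ∀ a : TopologicalSpace.IrreducibleCloseds X, (a : Set X) = Set.univ := by
      intro a
      obtain ⟨y, hy⟩ := a.isIrreducible.nonempty
      refine Set.eq_univ_of_forall fun w => ?_
      rwa [h3 w, ← h3 y]
    exact SetLike.coe_injective ((ha a).trans (ha b).symm)
  exact hdim.not_ge (Order.krullDim_nonpos_of_subsingleton)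

theorem exists_denominator [IsIntegral X] {U : X.Opens} (hU : IsAffineOpen U)
    (hg : genericPoint X ∈ U) {α : Type*} [Finite α] (v : α → X.functionField) :
    ∃ b : Γ(X, U), toK hg b ≠ 0 ∧ ∀ a, ∃ c, toK hg c = toK hg b * v a := by
  have : Nonempty U := ⟨⟨_, hg⟩⟩
  have := functionField_isFractionRing_of_isAffineOpen X U hU
  obtain ⟨b, hb⟩ := IsLocalization.exist_integer_multiples_of_finite (nonZeroDivisors Γ(X, U)) v
  refine ⟨b, ?_, fun a => ?_⟩
  · exact (map_ne_zero_iff _ (toK_injective hg)).mpr (nonZeroDivisors.ne_zero b.2)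
  · obtain ⟨c, hc⟩ := hb a
    refine ⟨c, ?_⟩
    rw [Algebra.smul_def] at hc
    exact hc

namespace Triv

variable [IsIntegral X] {L : X.Modules} {x : X} (T : Triv L x)

theorem exists_linear_bound {k : Type u} [Field k] [IsAlgClosed k]
    {f : X ⟶ Spec (CommRingCat.of k)} (hX : IsProjectiveVariety k f)
    (hdim : 0 < topologicalKrullDim X) (hx : IsClosed ({x} : Set X)) (ℓ : ℕ) :
    ∃ C : ℕ, ∀ m q : ℕ, SurjMod T.jets m (idealFrobPow
      (IsLocalRing.maximalIdeal (X.presheaf.stalk x) ^ (ℓ + 1)) q) → q - 1 ≤ C * m := by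
  have hft := hX.locallyOfFiniteType
  obtain ⟨n, z, Y, o, hxo, hzo, hYaff, hzA, hchart⟩ := exists_charts hX x
  have hgo := genericPoint_mem hxo
  have hno : Nonempty (Y o) := ⟨⟨x, hxo⟩⟩
  have := T.fin
  let : Algebra k X.functionField := ((toK (U := ⊤) trivial).comp (scalar f ⊤)).toAlgebra
  let : Algebra k Γ(X, Y o) := (scalar f (Y o)).toAlgebra
  have : Algebra.FiniteType k Γ(X, Y o) := scalar_finiteType f (hYaff o)
  let : Algebra Γ(X, Y o) X.functionField := (toK hgo).toAlgebra
  have : IsScalarTower k Γ(X, Y o) X.functionField := by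
    refine IsScalarTower.of_algebraMap_eq fun c => ?_
    change toK (U := ⊤) trivial (scalar f ⊤ c) = toK hgo (scalar f (Y o) c)
    exact ((congrArg (toK hgo) (resO_scalar f le_top c)).symm.trans
      (toK_resO le_top trivial hgo _)).symm
  have : FaithfulSMul Γ(X, Y o) X.functionField :=
    (faithfulSMul_iff_algebraMap_injective _ _).mpr (toK_injective hgo)
  let : Algebra Γ(X, Y o) (X.presheaf.stalk x) := X.presheaf.algebra_section_stalk ⟨x, hxo⟩
  let 𝔪 := ((hYaff o).primeIdealOf ⟨x, hxo⟩).asIdeal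
  have hloc : IsLocalization.AtPrime (X.presheaf.stalk x) 𝔪 :=
    (hYaff o).isLocalization_stalk ⟨x, hxo⟩
  have hmax : 𝔪.IsMaximal := (hYaff o).primeIdealOf_isMaximal_of_isClosed ⟨x, hxo⟩ hx
  have : IsNoetherianRing Γ(X, Y o) := Algebra.FiniteType.isNoetherianRing k _
  have : IsNoetherianRing (X.presheaf.stalk x) := IsLocalization.isNoetherianRing 𝔪.primeCompl _ this
  have hreg : ∀ i, z i ≠ 0 → ∃ hg : genericPoint X ∈ Y i, ∀ a, toK hg a ∈ chart k z i := by
    intro i hi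
    obtain ⟨hg, h⟩ := hchart i hi
    exact ⟨hg, h (chart k z i).toSubring (fun c => (chart k z i).algebraMap_mem c)
      fun j => Algebra.subset_adjoin ⟨j, rfl⟩⟩
  -- M is a common denominator b on the chart Y i for all w_α⁻¹. Then b^m g = (b w_α⁻¹)^m (g w_α^m)
  -- is regular wherever g gives a section of L^m, with b independent of m.
  have hM : ∀ i, ∃ M : X.functionField, M ≠ 0 ∧ (z i ≠ 0 → M ∈ chart k z i ∧
      ∀ (m : ℕ), ∀ g ∈ T.sec m, M ^ m * g ∈ chart k z i) := by
    intro i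
    by_cases hi : z i = 0
    · exact ⟨1, one_ne_zero, fun h => (h hi).elim⟩
    obtain ⟨hg, h⟩ := hreg i hi
    obtain ⟨b, hb0, hb⟩ := exists_denominator (hYaff i) hg fun α => (T.w α)⁻¹
    refine ⟨toK hg b, hb0, fun _ => ⟨h b, fun m g hgm => ?_⟩⟩
    obtain ⟨c, hc⟩ := exists_toK (f := toK hg b ^ m * g) hg (by
      intro y hy
      obtain ⟨α, hα⟩ := T.cover y
      obtain ⟨c, hc⟩ := hb α
      have h1 : toK hg b ^ m * g = toK hg c ^ m * (g * T.w α ^ m) := by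
        have h2 : toK hg b = toK hg c * T.w α := by
          rw [hc, inv_mul_cancel_right₀ (T.w_ne α)]
        rw [h2]
        ring
      rw [h1]
      exact mul_mem (pow_mem (toK_mem_regAt hg hy c) m) (hgm α y hα))
    rw [← hc]
    exact h c
  choose M hM0 hM using hM
  obtain ⟨C, hC⟩ := exists_vanishing_bound z o hzo M (fun i hi => (hM i hi).1) hM0
    (A := Γ(X, Y o)) (fun i => hzA hgo i) 𝔪
  refine ⟨C, fun m q hq => ?_⟩
  rcases Nat.eq_zero_or_pos q with rfl | hq0
  · simp
  -- Take g of exact order N = q - 1. The jet ideal lies in 𝔪^q, so the section r approximating g is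
  -- nonzero and lies in 𝔪^N.
  obtain ⟨N, rfl⟩ : ∃ N, q = N + 1 := ⟨q - 1, by omega⟩
  obtain ⟨g, hg, hg'⟩ := exists_mem_pow_notMem_pow_succ (stalk_not_isField hdim x hx) N
  obtain ⟨r, hr, hrg⟩ := hq g
  have hle : idealFrobPow (IsLocalRing.maximalIdeal (X.presheaf.stalk x) ^ (ℓ + 1)) (N + 1) ≤
      IsLocalRing.maximalIdeal (X.presheaf.stalk x) ^ (N + 1) :=
    (idealFrobPow_le_pow _ _).trans (Ideal.pow_right_mono (Ideal.pow_le_self (by omega)) _)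
  have hr0 : r ≠ 0 := by
    rintro rfl
    rw [zero_sub, neg_mem_iff] at hrg
    exact hg' (hle hrg)
  have hrN : r ∈ IsLocalRing.maximalIdeal (X.presheaf.stalk x) ^ N := by
    have := add_mem (Ideal.pow_le_pow_right (Nat.le_succ N) (hle hrg)) hg
    rwa [sub_add_cancel] at this
  rw [← IsLocalization.AtPrime.map_eq_maximalIdeal 𝔪, ← Ideal.map_pow,
    IsLocalization.mem_map_algebraMap_iff 𝔪.primeCompl] at hrN
  obtain ⟨⟨a, s⟩, has⟩ := hrN
  have hinj := IsFractionRing.injective (X.presheaf.stalk x) X.functionField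
  refine hC m (algebraMap _ X.functionField r) ((map_ne_zero_iff _ hinj).mpr hr0)
    (fun i hi => (hM i hi).2 m _ hr) s s.2 N a a.2 ?_
  have h1 := congrArg (algebraMap _ X.functionField) has
  rw [map_mul, mul_comm] at h1
  exact ((congrArg (· * _) (algebraMap_germ hgo hxo _)).symm.trans h1).trans
    (algebraMap_germ hgo hxo _)

end Triv

end FrobSeshadri

end

/-! ### Quotients, suprema and the limit superior -/

noncomputable section
namespace FrobSeshadri

section Quotients

variable {X : Scheme.{u}} {p : ℕ} {L : X.Modules} {x : X} {hx : IsClosed ({x} : Set X)} {ℓ : ℕ}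

/-- The quotient `(p ^ e - 1) / (m / (ℓ + 1))`. -/
abbrev jetQuotient (p ℓ m e : ℕ) : ℝ := ((p : ℝ) ^ e - 1) / ((m : ℝ) / ((ℓ : ℝ) + 1))

theorem jetQuotient_nonneg (hp : 1 < p) (m e : ℕ) : 0 ≤ jetQuotient p ℓ m e := by
  have : (1 : ℝ) ≤ (p : ℝ) ^ e := one_le_pow₀ (by exact_mod_cast hp.le)
  exact div_nonneg (sub_nonneg.mpr this) (by positivity)

/-- The geometric sum multiplying m is (p^(e(r+1)) - 1)/(p^e - 1), which cancels against the
numerator. This is the role of the -1 in the definition of the constant. -/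
theorem jetQuotient_geom (hp : 1 < p) {m e r : ℕ} (hm : 1 ≤ m) (he : 1 ≤ e) :
    jetQuotient p ℓ (m * ∑ i ∈ Finset.range (r + 1), (p ^ e) ^ i) (e * (r + 1)) =
      jetQuotient p ℓ m e := by
  have h1 : (1 : ℝ) < (p : ℝ) ^ e := one_lt_pow₀ (by exact_mod_cast hp) (by omega)
  have h2 : (p : ℝ) ^ (e * (r + 1)) - 1 =
      (∑ i ∈ Finset.range (r + 1), ((p : ℝ) ^ e) ^ i) * ((p : ℝ) ^ e - 1) := by
    rw [geom_sum_mul, pow_mul]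
  have h3 : 0 < ∑ i ∈ Finset.range (r + 1), ((p : ℝ) ^ e) ^ i :=
    Finset.sum_pos (fun i _ => by positivity) ⟨0, by simp⟩
  have hm' : (0 : ℝ) < m := by exact_mod_cast hm
  simp only [jetQuotient]
  push_cast
  rw [h2]
  field_simp

theorem sF_eq_bot {M : X.Modules} (h : ∀ e, ¬ SeparatesFrobJets p M x hx ℓ e) :
    sF p M x hx ℓ = ⊥ := by
  simp [sF, h]

theorem sF_eq_coe {M : X.Modules} {e : ℕ} (he : SeparatesFrobJets p M x hx ℓ e)
    (hmax : ∀ e', SeparatesFrobJets p M x hx ℓ e' → e' ≤ e) :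
    sF p M x hx ℓ = ((e : ℕ∞) : WithBot ℕ∞) := by
  refine le_antisymm (iSup₂_le fun e' he' => ?_) (le_iSup₂ (f := fun (e : ℕ)
    (_ : SeparatesFrobJets p M x hx ℓ e) => ((e : ℕ∞) : WithBot ℕ∞)) e he)
  exact_mod_cast hmax e' he'

theorem frobQuotient_nonpos {m : ℕ}
    (h : ∀ e, ¬ SeparatesFrobJets p (tensorPow L m) x hx ℓ e) :
    frobQuotient p L x hx ℓ m ≤ 0 := by
  rw [frobQuotient, sF_eq_bot h]
  have h1 : extPow p ⊥ = ((0 : ℝ) : EReal) := rfl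
  rw [h1, ← EReal.coe_one, ← EReal.coe_sub, ← EReal.coe_div, ← EReal.coe_zero, EReal.coe_le_coe_iff]
  exact div_nonpos_of_nonpos_of_nonneg (by norm_num) (by positivity)

theorem frobQuotient_eq {m e : ℕ} (he : SeparatesFrobJets p (tensorPow L m) x hx ℓ e)
    (hmax : ∀ e', SeparatesFrobJets p (tensorPow L m) x hx ℓ e' → e' ≤ e) :
    frobQuotient p L x hx ℓ m = (jetQuotient p ℓ m e : EReal) := by
  rw [frobQuotient, sF_eq_coe he hmax]
  have h1 : extPow p ((e : ℕ∞) : WithBot ℕ∞) = (((p : ℝ) ^ e : ℝ) : EReal) := rfl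
  rw [h1, ← EReal.coe_one, ← EReal.coe_sub, ← EReal.coe_div]

variable {C : ℕ} (hp : 1 < p)
  (hC : ∀ m e, SeparatesFrobJets p (tensorPow L m) x hx ℓ e → p ^ e - 1 ≤ C * m)
include hp hC

/-- As e < p^e, the linear bound gives e ≤ C m, so s_F is a genuine maximum whenever some e exists.
-/
theorem exists_max_of_separates {m e : ℕ} (he : SeparatesFrobJets p (tensorPow L m) x hx ℓ e) :
    ∃ e', e ≤ e' ∧ SeparatesFrobJets p (tensorPow L m) x hx ℓ e' ∧
      ∀ e'', SeparatesFrobJets p (tensorPow L m) x hx ℓ e'' → e'' ≤ e' := by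
  classical
  have hb : ∀ e', SeparatesFrobJets p (tensorPow L m) x hx ℓ e' → e' ≤ C * m := by
    intro e' he'
    have := hC m e' he'
    have := Nat.lt_pow_self hp (n := e')
    omega
  exact ⟨_, Nat.le_findGreatest (hb e he) he, Nat.findGreatest_spec (hb e he) he,
    fun e'' he'' => Nat.le_findGreatest (hb e'' he'') he''⟩

theorem jetQuotient_le_frobQuotient {m e : ℕ}
    (he : SeparatesFrobJets p (tensorPow L m) x hx ℓ e) :
    (jetQuotient p ℓ m e : EReal) ≤ frobQuotient p L x hx ℓ m := by
  obtain ⟨e', hle, he', hmax⟩ := exists_max_of_separates hp hC he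
  rw [frobQuotient_eq he' hmax, EReal.coe_le_coe_iff]
  have : (p : ℝ) ^ e ≤ (p : ℝ) ^ e' := pow_le_pow_right₀ (by exact_mod_cast hp.le) hle
  simp only [jetQuotient]
  gcongr

theorem frobSeshadri_eq_iSup
    (hex : ∃ m e : ℕ, 1 ≤ m ∧ 1 ≤ e ∧ SeparatesFrobJets p (tensorPow L m) x hx ℓ e) :
    frobSeshadri p L x hx ℓ = ⨆ (m : ℕ) (e : ℕ) (_ : 1 ≤ m ∧ 1 ≤ e ∧
      SeparatesFrobJets p (tensorPow L m) x hx ℓ e), (jetQuotient p ℓ m e : EReal) := by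
  set R := ⨆ (m : ℕ) (e : ℕ) (_ : 1 ≤ m ∧ 1 ≤ e ∧
      SeparatesFrobJets p (tensorPow L m) x hx ℓ e), (jetQuotient p ℓ m e : EReal) with hR
  have hle : ∀ m e, 1 ≤ m ∧ 1 ≤ e ∧ SeparatesFrobJets p (tensorPow L m) x hx ℓ e →
      (jetQuotient p ℓ m e : EReal) ≤ R := fun m e h => le_iSup_of_le m (le_iSup₂_of_le e h le_rfl)
  have h0 : 0 ≤ R := by
    obtain ⟨m, e, h⟩ := hex
    exact (EReal.coe_nonneg.mpr (jetQuotient_nonneg hp m e)).trans (hle m e h)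
  refine le_antisymm (iSup₂_le fun m hm => ?_) (iSup_le fun m => iSup₂_le fun e h => ?_)
  · by_cases h : ∃ e, SeparatesFrobJets p (tensorPow L m) x hx ℓ e
    · obtain ⟨e, he⟩ := h
      obtain ⟨e', -, he', hmax⟩ := exists_max_of_separates hp hC he
      rw [frobQuotient_eq he' hmax]
      -- The value e' = 0 contributes 0, and an m without separation contributes a nonpositive term;
      -- both are dominated because the right-hand supremum is nonnegative by part (i).
      rcases Nat.eq_zero_or_pos e' with rfl | hpos
      · simpa [jetQuotient] using h0
      · exact hle m e' ⟨hm, hpos, he'⟩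
    · push Not at h
      exact (frobQuotient_nonpos h).trans h0
  · exact (jetQuotient_le_frobQuotient hp hC h.2.2).trans
      (le_iSup₂ (f := fun m (_ : 1 ≤ m) => frobQuotient p L x hx ℓ m) m h.1)

theorem exists_coe_eq_frobSeshadri
    (hex : ∃ m e : ℕ, 1 ≤ m ∧ 1 ≤ e ∧ SeparatesFrobJets p (tensorPow L m) x hx ℓ e) :
    ∃ ε : ℝ, frobSeshadri p L x hx ℓ = (ε : EReal) := by
  have hub : frobSeshadri p L x hx ℓ ≤ ((C * (ℓ + 1) : ℝ) : EReal) := by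
    rw [frobSeshadri_eq_iSup hp hC hex]
    refine iSup_le fun m => iSup₂_le fun e h => ?_
    rw [EReal.coe_le_coe_iff]
    have hm : (0 : ℝ) < m := by exact_mod_cast h.1
    have h1 : (p : ℝ) ^ e - 1 ≤ C * m := by
      have h2 : p ^ e ≤ C * m + 1 := by
        have := hC m e h.2.2
        omega
      have : ((p ^ e : ℕ) : ℝ) ≤ ((C * m + 1 : ℕ) : ℝ) := by exact_mod_cast h2
      push_cast at this
      linarith
    rw [div_le_iff₀ (by positivity)]
    refine h1.trans (le_of_eq ?_)
    field_simp
  have hlb : 0 ≤ frobSeshadri p L x hx ℓ := by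
    obtain ⟨m, e, h⟩ := hex
    rw [frobSeshadri_eq_iSup hp hC ⟨m, e, h⟩]
    exact (EReal.coe_nonneg.mpr (jetQuotient_nonneg hp m e)).trans
      (le_iSup_of_le m (le_iSup₂_of_le e h le_rfl))
  refine ⟨_, (EReal.coe_toReal (hub.trans_lt (EReal.coe_lt_top _)).ne ?_).symm⟩
  exact ((EReal.bot_lt_coe 0).trans_le (by simpa using hlb)).ne'

theorem exists_lt_jetQuotient
    (hex : ∃ m e : ℕ, 1 ≤ m ∧ 1 ≤ e ∧ SeparatesFrobJets p (tensorPow L m) x hx ℓ e) {c : EReal}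
    (hc : c < frobSeshadri p L x hx ℓ) :
    ∃ m e, 1 ≤ m ∧ 1 ≤ e ∧ SeparatesFrobJets p (tensorPow L m) x hx ℓ e ∧
      c < (jetQuotient p ℓ m e : EReal) := by
  rw [frobSeshadri_eq_iSup hp hC hex] at hc
  simp only [lt_iSup_iff] at hc
  obtain ⟨m, e, h, hlt⟩ := hc
  exact ⟨m, e, h.1, h.2.1, h.2.2, hlt⟩

theorem frobSeshadri_eq_limsup
    (hex : ∃ m e : ℕ, 1 ≤ m ∧ 1 ≤ e ∧ SeparatesFrobJets p (tensorPow L m) x hx ℓ e)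
    (hgeom : ∀ m e r, SeparatesFrobJets p (tensorPow L m) x hx ℓ e →
      SeparatesFrobJets p (tensorPow L (m * ∑ i ∈ Finset.range (r + 1), (p ^ e) ^ i)) x hx ℓ
        (e * (r + 1))) :
    frobSeshadri p L x hx ℓ = limsup (fun m : ℕ => frobQuotient p L x hx ℓ m) atTop := by
  refine le_antisymm (le_of_forall_lt_imp_le_of_dense fun c hc => ?_) ?_
  · obtain ⟨m, e, hm, he, hs, hlt⟩ := exists_lt_jetQuotient hp hC hex hc
    refine le_limsup_of_frequently_le (frequently_atTop.mpr fun M => ?_)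
    -- Amplifying one good pair gives an index beyond M with the same quotient, so the values exceed
    -- c infinitely often.
    refine ⟨m * ∑ i ∈ Finset.range (M + 1), (p ^ e) ^ i, ?_, ?_⟩
    · have h1 : M + 1 ≤ ∑ i ∈ Finset.range (M + 1), (p ^ e) ^ i := by
        calc M + 1 = ∑ i ∈ Finset.range (M + 1), 1 := by simp
          _ ≤ _ := Finset.sum_le_sum fun i _ => Nat.one_le_pow _ _ (Nat.pow_pos (by omega))
      exact (Nat.le_succ M).trans (h1.trans (Nat.le_mul_of_pos_left _ hm))
    · refine le_trans ?_ (jetQuotient_le_frobQuotient hp hC (hgeom m e M hs))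
      rw [jetQuotient_geom hp hm he]
      exact hlt.le
  · refine limsup_le_of_le (h := ?_)
    filter_upwards [eventually_ge_atTop 1] with m hm
    exact le_iSup₂ (f := fun m (_ : 1 ≤ m) => frobQuotient p L x hx ℓ m) m hm

end Quotients

end FrobSeshadri

end

/-! ### Transfer to Frobenius jets and the main theorem -/

noncomputable section
namespace FrobSeshadri

theorem jetQuotient_lt_geom {c : EReal} {p ℓ m e r : ℕ} (hp : 1 < p) (hm : 1 ≤ m) (he : 1 ≤ e)
    (h : c < (jetQuotient p ℓ m e : EReal)) :
    c < (jetQuotient p ℓ (m * ∑ i ∈ Finset.range (r + 1), (p ^ e) ^ i) (e * (r + 1)) : EReal) := by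
  rwa [jetQuotient_geom hp hm he]

variable {X : Scheme.{u}} [IsIntegral X] {L : X.Modules} {x : X}

namespace Triv

variable (p : ℕ) (hx : IsClosed ({x} : Set X)) (ℓ : ℕ)

theorem separates_iff_surjMod (T : Triv L x) (e m : ℕ) :
    SeparatesFrobJets p (tensorPow L m) x hx ℓ e ↔
    SurjMod T.jets m
      (idealFrobPow (IsLocalRing.maximalIdeal (X.presheaf.stalk x) ^ (ℓ + 1)) (p ^ e)) :=
  T.separates_iff p hx ℓ e m

theorem separates_geom (T : Triv L x) [IsNoetherianRing (X.presheaf.stalk x)]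
    [ExpChar (X.presheaf.stalk x) p]
    {m e : ℕ} (h : SeparatesFrobJets p (tensorPow L m) x hx ℓ e) (r : ℕ) :
    SeparatesFrobJets p (tensorPow L (m * ∑ i ∈ Finset.range (r + 1), (p ^ e) ^ i)) x hx ℓ
      (e * (r + 1)) := by
  have hJ : (IsLocalRing.maximalIdeal (X.presheaf.stalk x) ^ (ℓ + 1)).FG :=
    IsNoetherian.noetherian _
  exact (T.separates_iff_surjMod p hx ℓ _ _).mpr
    (SurjMod.frob_iterate (R := T.jets) T.jets_mul T.jets_pow hJ
      ((T.separates_iff_surjMod p hx ℓ e m).mp h) r)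

/-- Separation of ordinary jets to order (ℓ+1)N suffices, since 𝔪^((ℓ+1)N) = J^N lies in the
Frobenius power of J for large N. -/
theorem exists_separates (T : Triv L x) [IsNoetherianRing (X.presheaf.stalk x)] {k : Type u} [Field k]
    [IsAlgClosed k] (f : X ⟶ Spec (CommRingCat.of k)) [LocallyOfFiniteType f] (hL : IsAmple L)
    (e : ℕ) : ∃ m, 1 ≤ m ∧ SeparatesFrobJets p (tensorPow L m) x hx ℓ e := by
  obtain ⟨N, hN⟩ := exists_pow_le_idealFrobPow
    (J := IsLocalRing.maximalIdeal (X.presheaf.stalk x) ^ (ℓ + 1))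
    (IsNoetherian.noetherian _) (p ^ e)
  obtain ⟨m, hm, h⟩ := T.exists_surjMod f hL hx ((ℓ + 1) * N)
  refine ⟨m, hm, (T.separates_iff_surjMod p hx ℓ e m).mpr fun g => ?_⟩
  obtain ⟨r, hr, hrg⟩ := h g
  rw [pow_mul] at hrg
  exact ⟨r, hr, hN hrg⟩

theorem exists_bound_of_separates (T : Triv L x) {k : Type u} [Field k] [IsAlgClosed k]
    {f : X ⟶ Spec (CommRingCat.of k)} (hX : IsProjectiveVariety k f)
    (hdim : 0 < topologicalKrullDim X) : ∃ C : ℕ, ∀ m e,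
      SeparatesFrobJets p (tensorPow L m) x hx ℓ e → p ^ e - 1 ≤ C * m := by
  obtain ⟨C, hC⟩ := T.exists_linear_bound hX hdim hx ℓ
  exact ⟨C, fun m e h => hC m (p ^ e) ((T.separates_iff_surjMod p hx ℓ e m).mp h)⟩

end Triv

end FrobSeshadri

end

theorem mainTheorem5 (p : ℕ) [Fact p.Prime] (k : Type u) [Field k] [IsAlgClosed k] [CharP k p]
    (X : Scheme.{u}) (f : X ⟶ Spec (CommRingCat.of k))
    (hX : FrobSeshadri.IsProjectiveVariety k f) (hdim : 0 < topologicalKrullDim X)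
    (L : X.Modules) (hL : FrobSeshadri.IsAmple L)
    (x : X) (hx : IsClosed ({x} : Set X)) (ℓ : ℕ) :
    (∃ m e : ℕ, 1 ≤ m ∧ 1 ≤ e ∧
      FrobSeshadri.SeparatesFrobJets p (FrobSeshadri.tensorPow L m) x hx ℓ e) ∧
    FrobSeshadri.frobSeshadri p L x hx ℓ =
      (⨆ (m : ℕ) (e : ℕ) (_ : 1 ≤ m ∧ 1 ≤ e ∧
          FrobSeshadri.SeparatesFrobJets p (FrobSeshadri.tensorPow L m) x hx ℓ e),
        ((((p : ℝ) ^ e - 1) / ((m : ℝ) / ((ℓ : ℝ) + 1)) : ℝ) : EReal)) ∧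
    (∀ δ : ℝ, 0 < δ → ∃ e₀ : ℕ, 1 ≤ e₀ ∧ ∀ e : ℕ, 1 ≤ e → e₀ ∣ e → ∃ m : ℕ, 1 ≤ m ∧
      FrobSeshadri.SeparatesFrobJets p (FrobSeshadri.tensorPow L m) x hx ℓ e ∧
      FrobSeshadri.frobSeshadri p L x hx ℓ - (δ : EReal) <
        ((((p : ℝ) ^ e - 1) / ((m : ℝ) / ((ℓ : ℝ) + 1)) : ℝ) : EReal)) ∧
    FrobSeshadri.frobSeshadri p L x hx ℓ =
      limsup (fun m : ℕ => FrobSeshadri.frobQuotient p L x hx ℓ m) atTop := by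
  have hp := (Fact.out : p.Prime).one_lt
  have := hX.isIntegral
  have := hL.compactSpace
  have := hX.locallyOfFiniteType
  have := FrobSeshadri.isNoetherianRing_stalk f x
  have := FrobSeshadri.expChar_stalk f p x
  obtain ⟨T⟩ := FrobSeshadri.exists_triv hL.isLineBundle x
  have hex : ∃ m e : ℕ, 1 ≤ m ∧ 1 ≤ e ∧
      FrobSeshadri.SeparatesFrobJets p (FrobSeshadri.tensorPow L m) x hx ℓ e := by
    obtain ⟨m, hm, h⟩ := T.exists_separates p hx ℓ f hL 1
    exact ⟨m, 1, hm, le_rfl, h⟩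
  obtain ⟨C, hC⟩ := T.exists_bound_of_separates p hx ℓ hX hdim
  refine ⟨hex, FrobSeshadri.frobSeshadri_eq_iSup hp hC hex, fun δ hδ => ?_,
    FrobSeshadri.frobSeshadri_eq_limsup hp hC hex fun _ _ r h => T.separates_geom p hx ℓ h r⟩
  obtain ⟨ε, hε⟩ := FrobSeshadri.exists_coe_eq_frobSeshadri hp hC hex
  have hlt : FrobSeshadri.frobSeshadri p L x hx ℓ - (δ : EReal) <
      FrobSeshadri.frobSeshadri p L x hx ℓ := by
    rw [hε, ← EReal.coe_sub, EReal.coe_lt_coe_iff]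
    linarith
  -- One pair within δ of the supremum; finiteness of the constant is what makes subtracting δ
  -- strict.
  obtain ⟨m, e₀, hm, he₀, hs, hlt⟩ := FrobSeshadri.exists_lt_jetQuotient hp hC hex hlt
  refine ⟨e₀, he₀, ?_⟩
  rintro e he ⟨r, rfl⟩
  -- A positive multiple of e₀ has the form e₀ (r + 1), reached by r amplifications with the
  -- quotient unchanged.
  obtain ⟨r, rfl⟩ : ∃ r', r = r' + 1 :=
    ⟨r - 1, by have := Nat.pos_of_mul_pos_left he; omega⟩
  refine ⟨m * ∑ i ∈ Finset.range (r + 1), (p ^ e₀) ^ i, ?_, T.separates_geom p hx ℓ hs r,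
    FrobSeshadri.jetQuotient_lt_geom hp hm he₀ hlt⟩
  exact Nat.mul_pos hm
    (Finset.sum_pos (fun i _ => Nat.pow_pos (Nat.pow_pos (by omega))) ⟨0, by simp⟩)
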